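/- Let $n\ge 1$, $\mathsf k\ge 3$, $\sigma>0$. Write $(a\vec 1,b)=(a,\dots,a,b)\in\mathbb R^n$. Let $f$ be a symmetric function, homogeneous of degree one, on a set $\Omega\subset\mathbb R^n$ that is closed under permutations of the coordinates and under homotheties; let $\mathcal K\subset\Omega$ be a bounded open neighbourhood of $(\vec 1,0)$ on which $f$ is $C^{\mathsf k+1}$ with $\|f\|_{C^{\mathsf k+1}(\mathcal K)}<\infty$ and $\partial_i f>0$ for $i=1,\dots,n$. For $R>0$ let $C_0^{\mathsf k}[R,\infty)$ be the space of $C^{\mathsf k}$ functions on $[R,\infty)$ which tend to $0$ at infinity together with their derivatives of order $\le \mathsf k$, let $\|\cdot\|$ be the norm of $L^\infty[R,\infty)$, and let $\Im$ be the space of all $v\in C_0^{\mathsf k}[R,\infty)$ with $$\|v\|_\Im=\max\{\|s v\|,\|s^2\partial_s v\|,\dots,\|s^{\mathsf k}\partial_s^{\mathsf k-1}v\|,\|s^{\mathsf k}\partial_s^{\mathsf k}v\|\}<\infty .$$ For a function $u$ on $[R,\infty)$ and $\theta\in[0,1]$ put $\mathbf z=\sigma s+\theta u$, $\mathbf p=\sigma+\theta\partial_s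 u$, $\mathbf q=\theta\partial_s^2u$, $\omega=\sigma s\left(\frac1{\mathbf z}\vec 1,\frac{-\mathbf q}{1+\mathbf p^2}\right)$, and $$\mathcal Lu=\partial_s^2u-\frac12\,\frac{1+\sigma^2}{\partial_nf(\vec 1,0)}\,(s\,\partial_su-u),$$ $$\begin{aligned}\mathcal Qu={}&\Big(\int_0^1\frac{\sigma s\,\partial^2_{nn}f\circ\omega}{(1+\mathbf p^2)^2}(1-\theta)d\theta\Big)(\partial_s^2u)^2\\ &+\Big(\int_0^1\Big(\sigma s\,\partial^2_{nn}f\circ\omega\,\frac{4\mathbf q^2\mathbf p^2}{(1+\mathbf p^2)^4}+\partial_nf\circ\omega\,\frac{2\mathbf q(1-3\mathbf p^2)}{(1+\mathbf p^2)^3}\Big)(1-\theta)d\theta\Big)(\partial_su)^2\\ &+\Big(\int_0^1\frac{\sum_{i,j=1}^{n-1}\sigma s\,\partial^2_{ij}f\circ\omega+2\mathbf z\sum_{i=1}^{n-1}\partial_if\circ\omega}{\mathbf z^4}(1-\theta)d\theta\Big)u^2\\ &+2\Big(\int_0^1\Big(\sigma s\,\partial^2_{nn}f\circ\omega\,\frac{-2\mathbf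 q\mathbf p}{(1+\mathbf p^2)^3}+\partial_nf\circ\omega\,\frac{2\mathbf p}{(1+\mathbf p^2)^2}\Big)(1-\theta)d\theta\Big)\partial_s^2u\,\partial_su\\ &+2\Big(\int_0^1\sum_{i=1}^{n-1}\frac{\sigma s\,\partial^2_{ni}f\circ\omega}{(1+\mathbf p^2)\mathbf z^2}(1-\theta)d\theta\Big)u\,\partial_s^2u\\ &-2\Big(\int_0^1\sum_{i=1}^{n-1}\sigma s\,\partial^2_{ni}f\circ\omega\,\frac{2\mathbf q\mathbf p}{(1+\mathbf p^2)^2\mathbf z^2}(1-\theta)d\theta\Big)u\,\partial_su .\end{aligned}$$ **Theorem.** There are $R=R(n,\mathsf k,\sigma,\mathcal K,\|f\|_{C^{\mathsf k+1}(\mathcal K)})\ge1$ and $u\in\Im$ such that $\mathbf z>0$ and $\omega\in\mathcal K$ for all $s\ge R$, $\theta\in[0,1]$ (so that $\mathcal Qu$ is well defined) and $$\mathcal Lu=\frac{1+\sigma^2}{\partial_nf(\vec 1,0)}\left(\frac{f(\vec 1,0)}{\sigma s}-\sum_{i=1}^{n-1}\frac{\partial_if(\vec 1,0)}{\sigma^2s^2}\,u+\mathcal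 Qu\right)\quad\text{on }[R,\infty).$$ Moreover $u(s)=\frac{f(\vec 1,0)}{\sigma s}+\mathring u(s)$ with $\mathring u\in C_0^{\mathsf k}[R,\infty)$ and $$\sum_{j=0}^{\mathsf k-1}\|s^{j+3}\partial_s^j\mathring u\|\le C\big(n,\mathsf k,\sigma,\|f\|_{C^{\mathsf k}(\mathcal K)}\big),\qquad \|s^{\mathsf k+1}\partial_s^{\mathsf k}\mathring u\|\le C\big(n,\mathsf k,\sigma,\mathcal K,\|f\|_{C^{\mathsf k}(\mathcal K)}\big).$$ Finally, $r(s)=\sigma s+u(s)$ is positive and solves the $f$ self-shrinker equation $$f\left(\frac1r\vec 1,\frac{-\partial_s^2r}{1+(\partial_sr)^2}\right)+\frac12(s\,\partial_sr-r)=0\quad\text{on }[R,\infty)$$ (the argument of $f$ lying in $\Omega$), and $r$ is $C^{\mathsf k}$ asymptotic to $\sigma s$: $\varrho\,r(s/\varrho)-\sigma s\to0$ in $C^{\mathsf k}_{\rm loc}$ on $(0,\infty)$ as $\varrho\searrow0$. Dependence on a norm means that $R$ and the constants can be chosen uniformly for all $f$ (and $\Omega$) for which that norm is at most a given number. -/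

import Mathlib

open Set Filter Topology
open scoped NNReal ENNReal

noncomputable section

namespace FShrinker

/-- The vector `(a, …, a, b)` of `ℝⁿ`, `n = m + 1`, with `m` entries equal to `a`. -/
def vec (m : ℕ) (a b : ℝ) : Fin (m + 1) → ℝ :=
  Fin.snoc (α := fun _ => ℝ) (fun _ : Fin m => a) b

/-- The partial derivative `∂ᵢ f`. -/
def pd {n : ℕ} (i : Fin n) (f : (Fin n → ℝ) → ℝ) (x : Fin n → ℝ) : ℝ :=
  lineDeriv ℝ f x (Pi.single i 1)

/-- `f` is symmetric and homogeneous of degree one on `Ω`, a set closed under permutations of the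
coordinates and under homotheties (values of `f` outside `Ω` are irrelevant). -/
structure IsSymmHomogeneous {n : ℕ} (Ω : Set (Fin n → ℝ)) (f : (Fin n → ℝ) → ℝ) : Prop where
  perm_mem : ∀ x ∈ Ω, ∀ τ : Equiv.Perm (Fin n), x ∘ τ ∈ Ω
  smul_mem : ∀ x ∈ Ω, ∀ ρ : ℝ, 0 < ρ → ρ • x ∈ Ω
  map_perm : ∀ x ∈ Ω, ∀ τ : Equiv.Perm (Fin n), f (x ∘ τ) = f x
  map_smul : ∀ x ∈ Ω, ∀ ρ : ℝ, 0 < ρ → f (ρ • x) = ρ * f x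

/-- The norm of `f` in `C^j(K)` for an open set `K`: the largest supremum over `K` of a
derivative of order at most `j`. -/
def cNorm {n : ℕ} (j : ℕ) (K : Set (Fin n → ℝ)) (f : (Fin n → ℝ) → ℝ) : ℝ≥0∞ :=
  ⨆ i ∈ Finset.range (j + 1), ⨆ x ∈ K, ‖iteratedFDeriv ℝ i f x‖ₑ

/-- The derivative `∂ₛʲ v` of a function on `[R, ∞)` (one-sided at `R`). -/
def dd (R : ℝ) (j : ℕ) (v : ℝ → ℝ) (s : ℝ) : ℝ :=
  iteratedDerivWithin j v (Ici R) s

/-- The sup norm of `g` on `[R, ∞)`; for continuous `g` it is the norm of `L^∞[R, ∞)`. -/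
def supNorm (R : ℝ) (g : ℝ → ℝ) : ℝ≥0∞ :=
  ⨆ s ∈ Ici R, ‖g s‖ₑ

/-- The space `C₀ᵏ[R, ∞)`: functions of class `Cᵏ` on `[R, ∞)` that tend to `0` at infinity
together with their derivatives of order at most `k`. -/
def C0k (k : ℕ) (R : ℝ) : Set (ℝ → ℝ) :=
  {v | ContDiffOn ℝ k v (Ici R) ∧ ∀ j ≤ k, Tendsto (dd R j v) atTop (𝓝 0)}

/-- The weighted norm
`max {‖s v‖, ‖s² ∂ₛv‖, …, ‖sᵏ ∂ₛᵏ⁻¹v‖, ‖sᵏ ∂ₛᵏv‖}`, with sup norms on `[R, ∞)`. -/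
def imNorm (k : ℕ) (R : ℝ) (v : ℝ → ℝ) : ℝ≥0∞ :=
  max (⨆ j ∈ Finset.range k, supNorm R (fun s => s ^ (j + 1) * dd R j v s))
    (supNorm R (fun s => s ^ k * dd R k v s))

/-- The weighted space `ℑ ⊆ C₀ᵏ[R, ∞)`. -/
def imSpace (k : ℕ) (R : ℝ) : Set (ℝ → ℝ) :=
  {v | v ∈ C0k k R ∧ imNorm k R v < ∞}

/-- `z(u(s); θ) = σ s + θ u(s)`. -/
def zz (σ : ℝ) (u : ℝ → ℝ) (s θ : ℝ) : ℝ := σ * s + θ * u s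

/-- `p(u(s); θ) = σ + θ ∂ₛu(s)`. -/
def pp (σ R : ℝ) (u : ℝ → ℝ) (s θ : ℝ) : ℝ := σ + θ * dd R 1 u s

/-- `q(u(s); θ) = θ ∂ₛ²u(s)`. -/
def qq (R : ℝ) (u : ℝ → ℝ) (s θ : ℝ) : ℝ := θ * dd R 2 u s

/-- `ω(u(s); θ) = σ s (1/z, …, 1/z, -q/(1 + p²))`. -/
def omega (m : ℕ) (σ R : ℝ) (u : ℝ → ℝ) (s θ : ℝ) : Fin (m + 1) → ℝ :=
  (σ * s) • vec m (1 / zz σ u s θ) (-qq R u s θ / (1 + pp σ R u s θ ^ 2))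

/-- The nonlinear operator `𝒬`; the index `n` is `Fin.last m` and the indices `1, …, n - 1` are
`Fin.castSucc i`. -/
def Qop (m : ℕ) (f : (Fin (m + 1) → ℝ) → ℝ) (σ R : ℝ) (u : ℝ → ℝ) (s : ℝ) : ℝ :=
  let z := zz σ u s
  let p := pp σ R u s
  let q := qq R u s
  let ω := omega m σ R u s
  let fn : ℝ → ℝ := fun θ => pd (Fin.last m) f (ω θ)
  let fi : ℝ → ℝ := fun θ => ∑ i : Fin m, pd i.castSucc f (ω θ)
  let fnn : ℝ → ℝ := fun θ => pd (Fin.last m) (pd (Fin.last m) f) (ω θ)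
  let fni : ℝ → ℝ := fun θ => ∑ i : Fin m, pd (Fin.last m) (pd i.castSucc f) (ω θ)
  let fij : ℝ → ℝ := fun θ => ∑ i : Fin m, ∑ j : Fin m, pd i.castSucc (pd j.castSucc f) (ω θ)
  (∫ θ in (0 : ℝ)..1, σ * s * fnn θ / (1 + p θ ^ 2) ^ 2 * (1 - θ)) * dd R 2 u s ^ 2
  + (∫ θ in (0 : ℝ)..1,
      (σ * s * fnn θ * (4 * q θ ^ 2 * p θ ^ 2 / (1 + p θ ^ 2) ^ 4)
        + fn θ * (2 * q θ * (1 - 3 * p θ ^ 2) / (1 + p θ ^ 2) ^ 3)) * (1 - θ)) * dd R 1 u s ^ 2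
  + (∫ θ in (0 : ℝ)..1,
      (σ * s * fij θ + 2 * z θ * fi θ) / z θ ^ 4 * (1 - θ)) * u s ^ 2
  + 2 * (∫ θ in (0 : ℝ)..1,
      (σ * s * fnn θ * (-2 * q θ * p θ / (1 + p θ ^ 2) ^ 3)
        + fn θ * (2 * p θ / (1 + p θ ^ 2) ^ 2)) * (1 - θ)) * dd R 2 u s * dd R 1 u s
  + 2 * (∫ θ in (0 : ℝ)..1,
      σ * s * fni θ / ((1 + p θ ^ 2) * z θ ^ 2) * (1 - θ)) * u s * dd R 2 u s
  - 2 * (∫ θ in (0 : ℝ)..1,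
      σ * s * fni θ * (2 * q θ * p θ / ((1 + p θ ^ 2) ^ 2 * z θ ^ 2)) * (1 - θ))
      * u s * dd R 1 u s

/-- The linear operator
`ℒu = ∂ₛ²u - (1/2) (1 + σ²)/∂ₙf(1, …, 1, 0) (s ∂ₛu - u)`. -/
def Lop (m : ℕ) (f : (Fin (m + 1) → ℝ) → ℝ) (σ R : ℝ) (u : ℝ → ℝ) (s : ℝ) : ℝ :=
  dd R 2 u s
    - 1 / 2 * ((1 + σ ^ 2) / pd (Fin.last m) f (vec m 1 0)) * (s * dd R 1 u s - u s)

/-- The reduced equation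
`ℒu = (1 + σ²)/∂ₙf(1, 0) (f(1, 0)/(σ s) - ∑ ∂ᵢf(1, 0)/(σ² s²) u + 𝒬u)` on `[R, ∞)`. -/
def SolvesReduced (m : ℕ) (f : (Fin (m + 1) → ℝ) → ℝ) (σ R : ℝ) (u : ℝ → ℝ) : Prop :=
  ∀ s ∈ Ici R,
    Lop m f σ R u s =
      (1 + σ ^ 2) / pd (Fin.last m) f (vec m 1 0) *
        (f (vec m 1 0) / (σ * s)
          - (∑ i : Fin m, pd i.castSucc f (vec m 1 0) / (σ ^ 2 * s ^ 2)) * u s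
          + Qop m f σ R u s)

/-- The `f` self-shrinker equation for the radius function `r` on `[R, ∞)`:
`f(1/r, …, 1/r, -∂ₛ²r/(1 + (∂ₛr)²)) + (1/2) (s ∂ₛr - r) = 0`, where `r > 0` and the argument of
`f` lies in the domain `Ω`. -/
def SolvesShrinker (m : ℕ) (Ω : Set (Fin (m + 1) → ℝ)) (f : (Fin (m + 1) → ℝ) → ℝ) (R : ℝ)
    (r : ℝ → ℝ) : Prop :=
  ∀ s ∈ Ici R,
    0 < r s ∧
    vec m (1 / r s) (-dd R 2 r s / (1 + dd R 1 r s ^ 2)) ∈ Ω ∧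
    f (vec m (1 / r s) (-dd R 2 r s / (1 + dd R 1 r s ^ 2)))
      + 1 / 2 * (s * dd R 1 r s - r s) = 0

/-- `ϱ r(s/ϱ) - σ s → 0` in `Cᵏ_loc` as `ϱ ↘ 0`: all derivatives of order at most `k` converge
uniformly on compact subsets of `(0, ∞)`. For fixed `ϱ` the function lives on `[ϱ R, ∞)`, which
contains a given compact subset of `(0, ∞)` once `ϱ` is small. -/
def CkAsymptotic (k : ℕ) (σ R : ℝ) (r : ℝ → ℝ) : Prop :=
  ∀ T : Set ℝ, IsCompact T → T ⊆ Ioi 0 → ∀ j ≤ k,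
    TendstoUniformlyOn (fun ϱ s => dd (ϱ * R) j (fun x => ϱ * r (x / ϱ) - σ * x) s)
      (fun _ => 0) (𝓝[>] 0) T

end FShrinker

end

/-!
By homogeneity the self-shrinker equation involves `f` only through the profile
`g y = f (1, …, 1, y)`, evaluated at `y = -r ∂ₛ²r / (1 + (∂ₛr)²)`. With `W = (r / s)²`,
`η = s² y` and the Euler derivative `D = s ∂ₛ` the equation becomes the first-order system

* `D W = -4 s⁻² g(y)`,
* `s⁻² g'(y) Z = Γ + β η`, where `Z = D η - 2 η`, `Γ = g (1 - 2 g / (s² W))` and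
  `β = (1 + (∂ₛr)²) / 2 ≥ 1/2`.

The second equation degenerates at infinity and, since no lower bound of `g'` may enter the
constants, must be treated as a singularly perturbed one. Its sign is favourable: a solution of
`e D X = c X + F` with `e > 0` and `c ≥ c₀ > 0` which grows at most polynomially is bounded by
`sup |F| / c₀` when `e = O(s⁻²)` (`abs_le_of_singular_ode`), whatever the lower bound of `e`.

*Existence.* Solutions that lie on the cone at `s = N` are continued towards smaller `s`. In this
direction the region `|s² y| < M` cannot be left, with `M` depending only on `sup |g|`, and a limit
`N → ∞` exists by compactness (`exists_solution_W_y`). A second use of the same principle, for the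
differentiated equation, bounds `Z`, which gives all the smallness needed on a half-line that
depends on a bound of `g, g', g''` only (`exists_small_solution`). The values of `u`, `∂ₛu`, `∂ₛ²u`
are then so small that `ω` stays in a ball contained in `K` (`exists_closeness`).

*Estimates.* They are uniform over the family of all solutions (`RadialSol`) with the same `k`, `σ`
and `A`, and are expressed by membership of families of functions in symbol classes: `SymbolMem 𝒜 J`
says that `J` Euler derivatives lie in the algebra `𝒜`. All derivatives are first seen to grow
polynomially, by solving for `Z`; this makes the growth lemma applicable, and its differentiated
form `SymbolMem.of_singular_ode` bounds `k - 2` Euler derivatives of `η`. The regular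
equations of `s² (g - g(0))`, of `V = s² (W - σ²)` and of `s² (V - 2 g(0))` give back the remaining
derivatives, hence the weighted bounds for `u = s (√W - σ)` and for
`u - g(0) / (σ s)` (`RadialSol.exists_bound`).

*The reduced equation* is the shrinker equation with `f` expanded by Taylor's formula with integral
remainder along `θ ↦ ω(θ)` (`reduced_eq_of_shrinker_eq`), and the blow-downs converge because
`sʲ⁺¹ ∂ₛʲu` is bounded (`ckAsymptotic_of_bound`).
-/

namespace FShrinker

/-! ### Maximum principles at infinity -/

/-- A function that can cross the level `M` only upwards, and that ends below `M`, starts below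
`M`. -/
theorem lt_of_deriv_pos_at_level {a b M : ℝ} {f : ℝ → ℝ} (hab : a ≤ b)
    (hf : ContinuousOn f (Icc a b)) (hb : f b < M)
    (hM : ∀ s ∈ Ico a b, f s = M → ∃ f' > 0, HasDerivWithinAt f f' (Ici s) s) : f a < M := by
  by_contra! ha
  have hScl : IsCompact (Icc a b ∩ f ⁻¹' Ici M) :=
    isCompact_Icc.of_isClosed_subset
      (hf.preimage_isClosed_of_isClosed isClosed_Icc isClosed_Ici) inter_subset_left
  obtain ⟨t, ⟨htab, htM⟩, htmax⟩ :=
    hScl.exists_isGreatest ⟨a, ⟨left_mem_Icc.2 hab, ha⟩⟩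
  have htb : t < b := lt_of_le_of_ne htab.2 (by rintro rfl; exact absurd hb (not_lt.2 htM))
  have hlt : ∀ s ∈ Ioc t b, f s < M := fun s hs => by
    by_contra! h
    exact absurd (htmax ⟨⟨htab.1.trans hs.1.le, hs.2⟩, h⟩) (not_le.2 hs.1)
  have hev : ∀ᶠ s in 𝓝[>] t, s ∈ Ioc t b := Ioc_mem_nhdsGT htb
  have hft : f t = M := by
    refine le_antisymm ?_ htM
    have h1 : Tendsto f (𝓝[>] t) (𝓝 (f t)) :=
      (hf t htab).mono_left (nhdsWithin_le_iff.2
        (mem_of_superset hev fun s hs => ⟨htab.1.trans hs.1.le, hs.2⟩))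
    exact le_of_tendsto h1 (hev.mono fun s hs => (hlt s hs).le)
  obtain ⟨f', hf', hd⟩ := hM t ⟨htab.1, htb⟩ hft
  have h2 := (hasDerivWithinAt_iff_tendsto_slope' (by simp)).1 (hd.Ioi_of_Ici)
  obtain ⟨s, hs1, hs2⟩ := ((h2.eventually_const_lt hf').and hev).exists
  have h3 : 0 < f s - f t := by
    have := (slope_def_field f t s) ▸ hs1
    exact (div_pos_iff_of_pos_right (sub_pos.2 hs2.1)).1 this
  linarith [hlt s hs2]

/-- A one-sided bound for the solutions of `e s X' = c X + F` that grow at most polynomially. As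
`e = O(s⁻²)`, a solution that exceeds the bound once grows at least like `exp (μ s²)`. The bound
does not involve a lower bound of `e`. -/
theorem le_of_singular_ode {R E c₀ K : ℝ} {X e c F : ℝ → ℝ} (hR : 1 ≤ R) (hc₀ : 0 < c₀)
    (hX : ∀ s, R < s → DifferentiableAt ℝ X s)
    (heq : ∀ s, R < s → e s * (s * deriv X s) = c s * X s + F s)
    (he : ∀ s, R < s → 0 < e s) (heE : ∀ s, R < s → e s ≤ E * (s ^ 2)⁻¹)
    (hc : ∀ s, R < s → c₀ ≤ c s) (hF : ∀ s, R < s → |F s| ≤ K)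
    (hpoly : ∃ (C : ℝ) (N : ℕ), ∀ s, R < s → |X s| ≤ C * s ^ N) :
    ∀ s, R < s → X s ≤ K / c₀ := by
  intro s₀ hs₀
  by_contra! hlt
  have hE : 0 < E := by
    have h := (he s₀ hs₀).trans_le (heE s₀ hs₀)
    have : 0 < (s₀ ^ 2)⁻¹ := by have : 0 < s₀ := by linarith
                                positivity
    exact (pos_iff_pos_of_mul_pos h).2 this
  have hK : 0 ≤ K := (abs_nonneg _).trans (hF s₀ hs₀)
  set M := K / c₀ with hMdef
  have hM0 : 0 ≤ M := by positivity
  have hMK : c₀ * M = K := by rw [hMdef]; field_simp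
  set μ := c₀ / (4 * E) with hμ
  have hμ0 : 0 < μ := by positivity
  set φ : ℝ → ℝ := fun s => (X s - M) * Real.exp (-μ * s ^ 2) with hφ
  obtain ⟨C, N, hCN⟩ := hpoly
  have hφ0 : 0 < φ s₀ := mul_pos (by linarith) (Real.exp_pos _)
  have hlim : Tendsto (fun s : ℝ => (C * s ^ N + M) * Real.exp (-μ * s)) atTop (𝓝 0) := by
    have h1 : Tendsto (fun s : ℝ => s ^ N * Real.exp (-μ * s)) atTop (𝓝 0) := by
      have := (isLittleO_pow_exp_pos_mul_atTop (k := N) hμ0).tendsto_div_nhds_zero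
      refine this.congr fun s => ?_
      rw [neg_mul, Real.exp_neg]; rfl
    have h2 : Tendsto (fun s : ℝ => Real.exp (-μ * s)) atTop (𝓝 0) := by
      have := (isLittleO_pow_exp_pos_mul_atTop (k := 0) hμ0).tendsto_div_nhds_zero
      refine this.congr fun s => ?_
      rw [neg_mul, Real.exp_neg]; simp
    have := (h1.const_mul C).add (h2.const_mul M)
    simp only [mul_zero, add_zero] at this
    refine this.congr fun s => by ring
  obtain ⟨b, hb1, hb2⟩ := ((hlim.eventually_lt_const hφ0).and (eventually_gt_atTop s₀)).exists
  have hRb : R < b := hs₀.trans hb2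
  have hb3 : φ b < φ s₀ := by
    refine lt_of_le_of_lt ?_ hb1
    have h1 : X b - M ≤ C * b ^ N + M := by
      have := (abs_le.1 (hCN b hRb)).2; linarith
    have h0 : 0 ≤ C * b ^ N + M := by
      have := (abs_nonneg _).trans (hCN b hRb); linarith
    have h2 : Real.exp (-μ * b ^ 2) ≤ Real.exp (-μ * b) := by
      apply Real.exp_le_exp.2
      nlinarith [mul_nonneg hμ0.le (mul_nonneg (by linarith : 0 ≤ b) (by linarith : 0 ≤ b - 1))]
    exact mul_le_mul h1 h2 (Real.exp_pos _).le h0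
  have hder : ∀ s, R < s → HasDerivAt φ
      (deriv X s * Real.exp (-μ * s ^ 2)
        + (X s - M) * (Real.exp (-μ * s ^ 2) * (-μ * (2 * s)))) s := by
    intro s hs
    have h1 := (hX s hs).hasDerivAt.sub_const M
    have h2 : HasDerivAt (fun s : ℝ => Real.exp (-μ * s ^ 2))
        (Real.exp (-μ * s ^ 2) * (-μ * (2 * s))) s := by
      have := ((hasDerivAt_pow 2 s).const_mul (-μ)).exp
      simpa using this
    exact h1.mul h2
  have := lt_of_deriv_pos_at_level (M := φ s₀) hb2.le
    (fun s hs => (hder s (hs₀.trans_le hs.1)).continuousAt.continuousWithinAt) hb3 ?_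
  · exact lt_irrefl _ this
  intro s hs hlev
  have hRs : R < s := hs₀.trans_le hs.1
  refine ⟨_, ?_, (hder s hRs).hasDerivWithinAt⟩
  have hs1 : 0 < s := by linarith
  have hexp := Real.exp_pos (-μ * s ^ 2)
  have hh : 0 < X s - M := by
    have : 0 < φ s := hlev ▸ hφ0
    exact (pos_iff_pos_of_mul_pos this).2 hexp
  have h1 : c₀ * (X s - M) ≤ e s * (s * deriv X s) := by
    rw [heq s hRs]
    have := mul_le_mul_of_nonneg_right (hc s hRs) (by linarith : 0 ≤ X s)
    have := (abs_le.1 (hF s hRs)).1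
    nlinarith
  have hd0 : 0 < s * deriv X s :=
    (pos_iff_pos_of_mul_pos ((mul_pos hc₀ hh).trans_le h1)).1 (he s hRs)
  have h2 : c₀ * (X s - M) ≤ E * (s ^ 2)⁻¹ * (s * deriv X s) :=
    h1.trans (mul_le_mul_of_nonneg_right (heE s hRs) hd0.le)
  have h3 : c₀ * (X s - M) * s ≤ E * deriv X s := by
    have : E * (s ^ 2)⁻¹ * (s * deriv X s) * s = E * deriv X s := by field_simp
    rw [← this]; exact mul_le_mul_of_nonneg_right h2 hs1.le
  have h4 : (X s - M) * (μ * (2 * s)) < deriv X s := by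
    have h5 : E * ((X s - M) * (μ * (2 * s))) = c₀ * (X s - M) * s / 2 := by
      rw [hμ]; field_simp; ring
    have h6 : 0 < c₀ * (X s - M) * s := by positivity
    refine lt_of_mul_lt_mul_left ?_ hE.le
    linarith
  nlinarith

/-- The two-sided form of `le_of_singular_ode`. -/
theorem abs_le_of_singular_ode {R E c₀ K : ℝ} {X e c F : ℝ → ℝ} (hR : 1 ≤ R) (hc₀ : 0 < c₀)
    (hX : ∀ s, R < s → DifferentiableAt ℝ X s)
    (heq : ∀ s, R < s → e s * (s * deriv X s) = c s * X s + F s)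
    (he : ∀ s, R < s → 0 < e s) (heE : ∀ s, R < s → e s ≤ E * (s ^ 2)⁻¹)
    (hc : ∀ s, R < s → c₀ ≤ c s) (hF : ∀ s, R < s → |F s| ≤ K)
    (hpoly : ∃ (C : ℝ) (N : ℕ), ∀ s, R < s → |X s| ≤ C * s ^ N) :
    ∀ s, R < s → |X s| ≤ K / c₀ := by
  intro s hs
  refine abs_le'.2 ⟨le_of_singular_ode hR hc₀ hX heq he heE hc hF hpoly s hs, ?_⟩
  refine le_of_singular_ode (X := fun s => -X s) (F := fun s => -F s) hR hc₀
    (fun s hs => (hX s hs).neg) (fun s hs => ?_) he heE hc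
    (fun s hs => by rw [abs_neg]; exact hF s hs) ?_ s hs
  · rw [deriv.fun_neg]; linarith [heq s hs]
  · obtain ⟨C, N, h⟩ := hpoly
    exact ⟨C, N, fun s hs => by rw [abs_neg]; exact h s hs⟩

theorem hasDerivAt_div_pow (C : ℝ) (a : ℕ) {s : ℝ} (hs : s ≠ 0) :
    HasDerivAt (fun s : ℝ => C / s ^ a) (-(a * C / s ^ (a + 1))) s := by
  have h := ((hasDerivAt_pow a s).inv (pow_ne_zero a hs)).const_mul C
  have h2 : (fun s : ℝ => C / s ^ a) = fun s => C * (fun s : ℝ => s ^ a)⁻¹ s := by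
    ext s; simp [div_eq_mul_inv]
  rw [h2]
  refine h.congr_deriv ?_
  rcases a with _ | a
  · simp
  · simp only [Nat.add_sub_cancel]
    field_simp
    ring

/-- Integration of a decaying derivative from infinity. -/
theorem abs_le_div_pow_of_abs_deriv_le {R C : ℝ} {a : ℕ} {f : ℝ → ℝ} (hR : 0 ≤ R) (ha : a ≠ 0)
    (hf : ∀ s, R < s → DifferentiableAt ℝ f s)
    (hf' : ∀ s, R < s → |deriv f s| ≤ a * C / s ^ (a + 1))
    (hlim : Tendsto f atTop (𝓝 0)) : ∀ s, R < s → |f s| ≤ C / s ^ a := by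
  have key : ∀ g : ℝ → ℝ, (∀ s, R < s → DifferentiableAt ℝ g s) →
      (∀ s, R < s → |deriv g s| ≤ a * C / s ^ (a + 1)) → Tendsto g atTop (𝓝 0) →
      ∀ s, R < s → g s ≤ C / s ^ a := by
    intro g hg hg' hgl s hs
    have hmono : MonotoneOn (fun s => g s - C / s ^ a) (Ioi R) := by
      have hd : ∀ s ∈ Ioi R, HasDerivAt (fun s => g s - C / s ^ a)
          (deriv g s - -(a * C / s ^ (a + 1))) s := fun s hs =>
        (hg s hs).hasDerivAt.sub
          (hasDerivAt_div_pow C a (ne_of_gt (lt_of_le_of_lt hR hs)))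
      refine monotoneOn_of_deriv_nonneg (convex_Ioi R)
        (fun s hs => (hd s hs).continuousAt.continuousWithinAt)
        (fun s hs => ?_) (fun s hs => ?_)
      · rw [interior_Ioi] at hs; exact (hd s hs).differentiableAt.differentiableWithinAt
      · rw [interior_Ioi] at hs
        rw [(hd s hs).deriv]
        have := (abs_le.1 (hg' s hs)).1
        linarith
    have hl : Tendsto (fun s => g s - C / s ^ a) atTop (𝓝 0) := by
      have h1 : Tendsto (fun s : ℝ => C / s ^ a) atTop (𝓝 0) :=
        (tendsto_pow_atTop ha).const_div_atTop C
      simpa using hgl.sub h1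
    have := ge_of_tendsto hl ((eventually_ge_atTop s).mono fun t ht =>
      hmono hs (mem_Ioi.2 (lt_of_lt_of_le hs ht)) ht)
    linarith
  intro s hs
  refine abs_le'.2 ⟨key f hf hf' hlim s hs, ?_⟩
  refine key (fun s => -f s) (fun s hs => (hf s hs).neg) (fun s hs => ?_) ?_ s hs
  · rw [deriv.fun_neg, abs_neg]; exact hf' s hs
  · simpa using hlim.neg

/-! ### Symbol classes for families of functions near infinity -/

section SymbolClass

variable {ι : Type*} {R : ι → ℝ}

/-- Two families of functions agree on the half-lines `(R i, ∞)`. -/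
def FamEq (R : ι → ℝ) (F G : ι → ℝ → ℝ) : Prop := ∀ i s, R i < s → F i s = G i s

/-- The Euler derivative `s ∂ₛ` of the members of the family `F` is `F'` on `(R i, ∞)`. -/
def HasEuler (R : ι → ℝ) (F F' : ι → ℝ → ℝ) : Prop :=
  ∀ i s, R i < s → DifferentiableAt ℝ (F i) s ∧ s * deriv (F i) s = F' i s

/-- An algebra of families of functions on half-lines, which tells what counts as a bound. -/
structure GrowthClass (R : ι → ℝ) where
  alg : Subalgebra ℝ (ι → ℝ → ℝ)
  congr : ∀ F G, FamEq R F G → F ∈ alg → G ∈ alg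

/-- Families of functions that are bounded, uniformly over the family. -/
def bddClass (R : ι → ℝ) : GrowthClass R where
  alg :=
    { carrier := {F | ∃ C : ℝ, ∀ i s, R i < s → |F i s| ≤ C}
      mul_mem' := by
        rintro F G ⟨C, hC⟩ ⟨C', hC'⟩
        refine ⟨C * C', fun i s hs => ?_⟩
        simp only [Pi.mul_apply, abs_mul]
        exact mul_le_mul (hC i s hs) (hC' i s hs) (abs_nonneg _)
          ((abs_nonneg _).trans (hC i s hs))
      add_mem' := by
        rintro F G ⟨C, hC⟩ ⟨C', hC'⟩
        exact ⟨C + C', fun i s hs => (abs_add_le _ _).trans (add_le_add (hC i s hs) (hC' i s hs))⟩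
      algebraMap_mem' := fun r => ⟨|r|, fun i s _ => le_rfl⟩ }
  congr := by
    rintro F G h ⟨C, hC⟩
    exact ⟨C, fun i s hs => h i s hs ▸ hC i s hs⟩

/-- Families of functions that grow at most polynomially. Neither the constant nor the exponent is
uniform over the family. -/
def polyClass (R : ι → ℝ) (hR : ∀ i, 1 ≤ R i) : GrowthClass R where
  alg :=
    { carrier := {F | ∀ i, ∃ (C : ℝ) (N : ℕ), ∀ s, R i < s → |F i s| ≤ C * s ^ N}
      mul_mem' := by
        intro F G hF hG i
        obtain ⟨C, N, hC⟩ := hF i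
        obtain ⟨C', N', hC'⟩ := hG i
        refine ⟨C * C', N + N', fun s hs => ?_⟩
        have : C * C' * s ^ (N + N') = (C * s ^ N) * (C' * s ^ N') := by ring
        simp only [Pi.mul_apply, abs_mul, this]
        exact mul_le_mul (hC s hs) (hC' s hs) (abs_nonneg _) ((abs_nonneg _).trans (hC s hs))
      add_mem' := by
        intro F G hF hG i
        obtain ⟨C, N, hC⟩ := hF i
        obtain ⟨C', N', hC'⟩ := hG i
        refine ⟨|C| + |C'|, N + N', fun s hs => (abs_add_le _ _).trans ?_⟩
        have hs1 : 1 ≤ s := (hR i).trans hs.le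
        rw [add_mul]
        refine add_le_add ((hC s hs).trans ?_) ((hC' s hs).trans ?_)
        · exact mul_le_mul (le_abs_self C) (pow_le_pow_right₀ hs1 (by omega)) (by positivity)
            (abs_nonneg _)
        · exact mul_le_mul (le_abs_self C') (pow_le_pow_right₀ hs1 (by omega)) (by positivity)
            (abs_nonneg _)
      algebraMap_mem' := fun r i => ⟨|r|, 0, fun s _ => by simp⟩ }
  congr := by
    intro F G h hF i
    obtain ⟨C, N, hC⟩ := hF i
    exact ⟨C, N, fun s hs => h i s hs ▸ hC s hs⟩

/-- Families whose iterated Euler derivatives of order at most `J` lie in the class `𝒜`. -/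
def SymbolMem (𝒜 : GrowthClass R) : ℕ → (ι → ℝ → ℝ) → Prop
  | 0, F => F ∈ 𝒜.alg
  | J + 1, F => F ∈ 𝒜.alg ∧ ∃ F', HasEuler R F F' ∧ SymbolMem 𝒜 J F'

variable {F G H F' G' : ι → ℝ → ℝ}

theorem FamEq.eventuallyEq (h : FamEq R F G) {i : ι} {s : ℝ} (hs : R i < s) :
    F i =ᶠ[𝓝 s] G i :=
  (eventually_gt_nhds hs).mono fun t ht => h i t ht

theorem HasEuler.congr_left (h : HasEuler R F F') (e : FamEq R F G) : HasEuler R G F' := by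
  intro i s hs
  have he := e.eventuallyEq hs
  refine ⟨(h i s hs).1.congr_of_eventuallyEq he.symm, ?_⟩
  rw [← he.deriv_eq]; exact (h i s hs).2

theorem HasEuler.congr_right (h : HasEuler R F F') (e : FamEq R F' G') : HasEuler R F G' :=
  fun i s hs => ⟨(h i s hs).1, (h i s hs).2.trans (e i s hs)⟩

theorem HasEuler.unique (h : HasEuler R F F') (h' : HasEuler R F G') : FamEq R F' G' :=
  fun i s hs => (h i s hs).2.symm.trans (h' i s hs).2

theorem HasEuler.add (hF : HasEuler R F F') (hG : HasEuler R G G') :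
    HasEuler R (F + G) (F' + G') := by
  intro i s hs
  refine ⟨(hF i s hs).1.add (hG i s hs).1, ?_⟩
  have := deriv_add (hF i s hs).1 (hG i s hs).1
  simp only [Pi.add_apply] at this ⊢
  rw [this, mul_add, (hF i s hs).2, (hG i s hs).2]

theorem HasEuler.mul (hF : HasEuler R F F') (hG : HasEuler R G G') :
    HasEuler R (F * G) (F' * G + F * G') := by
  intro i s hs
  refine ⟨(hF i s hs).1.mul (hG i s hs).1, ?_⟩
  have := deriv_mul (hF i s hs).1 (hG i s hs).1
  simp only [Pi.mul_apply, Pi.add_apply] at this ⊢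
  rw [this, ← (hF i s hs).2, ← (hG i s hs).2]; ring

theorem HasEuler.const (c : ℝ) : HasEuler R (fun _ _ => c) 0 := fun i s _ =>
  ⟨differentiableAt_const c, by simp⟩

theorem HasEuler.const_mul (c : ℝ) (hF : HasEuler R F F') :
    HasEuler R (fun i s => c * F i s) (fun i s => c * F' i s) := fun i s hs =>
  ⟨(hF i s hs).1.const_mul c, by
    beta_reduce; rw [deriv_const_mul c (hF i s hs).1, ← (hF i s hs).2]; ring⟩

theorem HasEuler.neg (hF : HasEuler R F F') : HasEuler R (-F) (-F') := by
  refine ((hF.const_mul (-1)).congr_left ?_).congr_right ?_ <;> intro i s _ <;> simp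

theorem HasEuler.sub (hF : HasEuler R F F') (hG : HasEuler R G G') :
    HasEuler R (F - G) (F' - G') := by
  simpa [sub_eq_add_neg] using hF.add hG.neg

/-- The usual derivative in terms of the Euler derivative. -/
theorem HasEuler.hasDerivAt (hF : HasEuler R F F') {i : ι} {s : ℝ} (hs : R i < s) (h0 : s ≠ 0) :
    HasDerivAt (F i) (F' i s / s) s := by
  have := (hF i s hs).1.hasDerivAt
  rwa [← (hF i s hs).2, mul_div_cancel_left₀ _ h0]

theorem hasEuler_of_hasDerivAt (h : ∀ i s, R i < s → HasDerivAt (F i) (F' i s / s) s)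
    (h0 : ∀ i s, R i < s → s ≠ 0) : HasEuler R F F' := fun i s hs =>
  ⟨(h i s hs).differentiableAt, by
    rw [(h i s hs).deriv, mul_div_cancel₀ _ (h0 i s hs)]⟩

theorem HasEuler.inv (hF : HasEuler R F F') (h0 : ∀ i s, R i < s → F i s ≠ 0) :
    HasEuler R F⁻¹ (-F' * (F⁻¹ * F⁻¹)) := by
  intro i s hs
  refine ⟨(hF i s hs).1.inv (h0 i s hs), ?_⟩
  have : deriv (F⁻¹ i) s = -deriv (F i) s / F i s ^ 2 := deriv_inv'' (hF i s hs).1 (h0 i s hs)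
  rw [this]
  simp only [Pi.mul_apply, Pi.neg_apply, Pi.inv_apply, ← (hF i s hs).2]
  have := h0 i s hs
  field_simp

variable {𝒜 : GrowthClass R}

theorem SymbolMem.mem {J : ℕ} (h : SymbolMem 𝒜 J F) : F ∈ 𝒜.alg := by
  cases J with
  | zero => exact h
  | succ J => exact h.1

theorem SymbolMem.congr {J : ℕ} (h : SymbolMem 𝒜 J F) (e : FamEq R F G) : SymbolMem 𝒜 J G := by
  cases J with
  | zero => exact 𝒜.congr _ _ e h
  | succ J =>
    obtain ⟨h0, F', hF', h1⟩ := h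
    exact ⟨𝒜.congr _ _ e h0, F', hF'.congr_left e, h1⟩

theorem SymbolMem.succ_le {J : ℕ} (h : SymbolMem 𝒜 (J + 1) F) : SymbolMem 𝒜 J F := by
  induction J generalizing F with
  | zero => exact h.mem
  | succ J ih =>
    obtain ⟨h0, F', hF', h1⟩ := h
    exact ⟨h0, F', hF', ih h1⟩

theorem SymbolMem.mono {J J' : ℕ} (h : SymbolMem 𝒜 J F) (hJ : J' ≤ J) : SymbolMem 𝒜 J' F := by
  induction hJ with
  | refl => exact h
  | step _ ih => exact ih h.succ_le

theorem SymbolMem.euler {J : ℕ} (h : SymbolMem 𝒜 (J + 1) F) (hF : HasEuler R F F') :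
    SymbolMem 𝒜 J F' := by
  obtain ⟨_, G, hG, h1⟩ := h
  exact h1.congr (hG.unique hF)

theorem SymbolMem.succ {J : ℕ} (h : F ∈ 𝒜.alg) (hF : HasEuler R F F') (h' : SymbolMem 𝒜 J F') :
    SymbolMem 𝒜 (J + 1) F := ⟨h, F', hF, h'⟩

theorem SymbolMem.const {J : ℕ} (c : ℝ) : SymbolMem 𝒜 J (fun _ _ => c) := by
  have hc : ∀ c : ℝ, (fun _ _ => c : ι → ℝ → ℝ) ∈ 𝒜.alg := fun c => 𝒜.alg.algebraMap_mem c
  induction J generalizing c with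
  | zero => exact hc c
  | succ J ih => exact .succ (hc c) (.const c) (ih 0)

theorem SymbolMem.add {J : ℕ} (hF : SymbolMem 𝒜 J F) (hG : SymbolMem 𝒜 J G) :
    SymbolMem 𝒜 J (F + G) := by
  induction J generalizing F G with
  | zero => exact 𝒜.alg.add_mem hF hG
  | succ J ih =>
    obtain ⟨hF0, F', hF', hF1⟩ := hF
    obtain ⟨hG0, G', hG', hG1⟩ := hG
    exact .succ (𝒜.alg.add_mem hF0 hG0) (hF'.add hG') (ih hF1 hG1)

theorem SymbolMem.mul {J : ℕ} (hF : SymbolMem 𝒜 J F) (hG : SymbolMem 𝒜 J G) :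
    SymbolMem 𝒜 J (F * G) := by
  induction J generalizing F G with
  | zero => exact 𝒜.alg.mul_mem hF hG
  | succ J ih =>
    have hF2 := hF.succ_le
    have hG2 := hG.succ_le
    obtain ⟨hF0, F', hF', hF1⟩ := hF
    obtain ⟨hG0, G', hG', hG1⟩ := hG
    exact .succ (𝒜.alg.mul_mem hF0 hG0) (hF'.mul hG') ((ih hF1 hG2).add (ih hF2 hG1))

theorem SymbolMem.const_mul {J : ℕ} (c : ℝ) (hF : SymbolMem 𝒜 J F) :
    SymbolMem 𝒜 J (fun i s => c * F i s) := (SymbolMem.const c).mul hF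

theorem SymbolMem.neg {J : ℕ} (hF : SymbolMem 𝒜 J F) : SymbolMem 𝒜 J (-F) :=
  (hF.const_mul (-1)).congr fun i s _ => by simp

theorem SymbolMem.sub {J : ℕ} (hF : SymbolMem 𝒜 J F) (hG : SymbolMem 𝒜 J G) :
    SymbolMem 𝒜 J (F - G) := by
  simpa [sub_eq_add_neg] using hF.add hG.neg

theorem SymbolMem.inv {J : ℕ} (hF : SymbolMem 𝒜 J F) (hF0 : F⁻¹ ∈ 𝒜.alg)
    (h0 : ∀ i s, R i < s → F i s ≠ 0) : SymbolMem 𝒜 J F⁻¹ := by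
  induction J with
  | zero => exact hF0
  | succ J ih =>
    have h2 := ih hF.succ_le
    obtain ⟨_, F', hF', hF1⟩ := hF
    exact .succ hF0 (hF'.inv h0) (hF1.neg.mul (h2.mul h2))

theorem SymbolMem.sqrt {J : ℕ} (hF : SymbolMem 𝒜 J F) (hi : SymbolMem 𝒜 J F⁻¹)
    (h : (fun i s => √(F i s)) ∈ 𝒜.alg) (h0 : ∀ i s, R i < s → 0 < F i s) :
    SymbolMem 𝒜 J (fun i s => √(F i s)) := by
  induction J with
  | zero => exact h
  | succ J ih =>
    have h2 := ih hF.succ_le hi.succ_le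
    have hi2 := hi.succ_le
    obtain ⟨_, F', hF', hF1⟩ := hF
    refine .succ (F' := fun i s => (1 / 2) * (F' * (fun i s => √(F i s)) * F⁻¹) i s) h ?_
      (((hF1.mul h2).mul hi2).const_mul _)
    intro i s hs
    have hp := h0 i s hs
    refine ⟨(hF' i s hs).1.sqrt hp.ne', ?_⟩
    rw [deriv_sqrt (hF' i s hs).1 hp.ne']
    simp only [Pi.mul_apply, Pi.inv_apply, ← (hF' i s hs).2]
    have h3 : F i s = √(F i s) * √(F i s) := (Real.mul_self_sqrt hp.le).symm
    have h4 : 0 < √(F i s) := Real.sqrt_pos.2 hp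
    generalize √(F i s) = q at *
    rw [h3]; field_simp

/-- The chain rule in symbol classes, for the derivatives `Γ l = g^(l) ∘ y`. -/
theorem SymbolMem.comp {Γ : ℕ → ι → ℝ → ℝ} {y' : ι → ℝ → ℝ} {L J : ℕ}
    (hΓ : ∀ l, l < L → HasEuler R (Γ l) (Γ (l + 1) * y'))
    (hb : ∀ l ≤ L, Γ l ∈ 𝒜.alg) (hy : ∀ j, j < J → SymbolMem 𝒜 j y') :
    ∀ l, l + J ≤ L → SymbolMem 𝒜 J (Γ l) := by
  induction J with
  | zero => intro l hl; exact hb l hl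
  | succ J ih =>
    intro l hl
    exact .succ (hb l (by omega)) (hΓ l (by omega))
      ((ih (fun j hj => hy j (by omega)) (l + 1) (by omega)).mul (hy J (by omega)))

/-- The weight `s⁻²`. -/
noncomputable def xi : ι → ℝ → ℝ := fun _ s => (s ^ 2)⁻¹

theorem hasEuler_xi (h0 : ∀ i s, R i < s → s ≠ 0) :
    HasEuler R (xi : ι → ℝ → ℝ) (fun i s => -2 * xi i s) := by
  refine hasEuler_of_hasDerivAt (fun i s hs => ?_) h0
  have := hasDerivAt_div_pow 1 2 (h0 i s hs)
  simp only [one_div] at this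
  refine this.congr_deriv ?_
  have := h0 i s hs
  simp only [xi]; field_simp; push_cast; ring

theorem symbolMem_xi {J : ℕ} (h0 : ∀ i s, R i < s → s ≠ 0) (hx : (xi : ι → ℝ → ℝ) ∈ 𝒜.alg) :
    SymbolMem 𝒜 J xi := by
  induction J with
  | zero => exact hx
  | succ J ih => exact .succ hx (hasEuler_xi h0) (ih.const_mul _)

theorem hasEuler_pow (n : ℕ) :
    HasEuler R (fun _ s => s ^ n) (fun _ s => n * s ^ n) := by
  intro i s hs
  refine ⟨by fun_prop, ?_⟩
  rw [deriv_pow_field]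
  rcases n with _ | n
  · simp
  · simp only [Nat.add_sub_cancel]; ring

theorem symbolMem_pow {J : ℕ} (n : ℕ) (hx : (fun _ s => s ^ n : ι → ℝ → ℝ) ∈ 𝒜.alg) :
    SymbolMem 𝒜 J (fun _ s => s ^ n : ι → ℝ → ℝ) := by
  induction J with
  | zero => exact hx
  | succ J ih => exact .succ hx (hasEuler_pow n) (ih.const_mul _)

theorem SymbolMem.contDiffOn {J : ℕ} (h0 : ∀ i, 0 ≤ R i) (h : SymbolMem 𝒜 (J + 1) F) (i : ι) :
    ContDiffOn ℝ J (F i) (Ioi (R i)) := by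
  induction J generalizing F with
  | zero =>
    obtain ⟨_, F', hF', _⟩ := h
    exact contDiffOn_zero.2 fun s hs => (hF' i s hs).1.continuousAt.continuousWithinAt
  | succ J ih =>
    obtain ⟨_, F', hF', h1⟩ := h
    push_cast
    refine (contDiffOn_succ_iff_deriv_of_isOpen isOpen_Ioi).2
      ⟨fun s hs => (hF' i s hs).1.differentiableWithinAt, by simp, ?_⟩
    have h2 : ContDiffOn ℝ J (fun s => F' i s / s) (Ioi (R i)) :=
      (ih h1).div contDiffOn_id fun s hs => ne_of_gt (lt_of_le_of_lt (h0 i) hs)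
    refine h2.congr fun s hs => (hF'.hasDerivAt hs ?_).deriv
    exact ne_of_gt (lt_of_le_of_lt (h0 i) hs)

/-- The weighted derivatives `s ^ (a + j) ∂ₛʲ u` of a family `u` for which `s ^ a u` is a symbol
are symbols. -/
theorem SymbolMem.iteratedDeriv (h0 : ∀ i, 0 ≤ R i) {J : ℕ} (a : ℕ) {u : ι → ℝ → ℝ}
    (h : SymbolMem 𝒜 J (fun i s => s ^ a * u i s)) :
    ∀ j ≤ J, SymbolMem 𝒜 (J - j) (fun i s => s ^ (a + j) * iteratedDeriv j (u i) s) := by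
  intro j
  induction j with
  | zero => intro _; simpa using h
  | succ j ih =>
    intro hj
    have h1 := ih (by omega)
    have hJ : J - j = (J - (j + 1)) + 1 := by omega
    rw [hJ] at h1
    have h2 := h1.succ_le
    obtain ⟨-, P', hP', h3⟩ := h1
    refine (h3.sub (h2.const_mul ((a + j : ℕ) : ℝ))).congr fun i s hs => ?_
    have hs0 : s ≠ 0 := ne_of_gt (lt_of_le_of_lt (h0 i) hs)
    have hd : HasDerivAt (_root_.iteratedDeriv j (u i))
        (_root_.iteratedDeriv (j + 1) (u i) s) s := by
      rw [iteratedDeriv_succ]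
      refine DifferentiableAt.hasDerivAt ?_
      have h4 : DifferentiableAt ℝ
          (fun t => (t ^ (a + j) * _root_.iteratedDeriv j (u i) t) / t ^ (a + j)) s :=
        (hP' i s hs).1.div (by fun_prop) (pow_ne_zero _ hs0)
      refine h4.congr_of_eventuallyEq ?_
      filter_upwards [isOpen_ne.mem_nhds hs0] with t ht
      rw [mul_div_cancel_left₀ _ (pow_ne_zero _ ht)]
    have h5 := ((hasDerivAt_pow (a + j) s).mul hd).deriv
    have h6 := (hP' i s hs).2
    have h7 : deriv (fun s => s ^ (a + j) * _root_.iteratedDeriv j (u i) s) s = _ := h5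
    rw [h7] at h6
    simp only [Pi.sub_apply, ← h6]
    rcases hn : a + j with _ | n
    · have : a + (j + 1) = 1 := by omega
      simp [this]
    · have : a + (j + 1) = n + 2 := by omega
      simp only [this, Nat.add_sub_cancel]; ring

end SymbolClass

/-! ### Uniform symbol bounds for singularly perturbed linear equations -/

section SymbolClass

variable {ι : Type*} {R : ι → ℝ}

/-- Symbol bounds for the polynomially growing solutions of `e X' = c X + F`, `X' = s ∂ₛX`, that are
uniform as `e ↓ 0`: the `n`-th Euler derivative of `X` solves an equation of the same form with
coefficient `c - n e'`. -/
theorem SymbolMem.of_singular_ode (hR : ∀ i, 1 ≤ R i) {E c₀ : ℝ} (hc₀ : 0 < c₀) {J : ℕ}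
    {X X' e e' c F : ι → ℝ → ℝ} (hX : HasEuler R X X')
    (heq : FamEq R (e * X') (c * X + F)) (he : ∀ i s, R i < s → 0 < e i s)
    (heE : ∀ i s, R i < s → e i s ≤ E * (s ^ 2)⁻¹) (hee : HasEuler R e e')
    (he' : SymbolMem (bddClass R) J e') (hc : SymbolMem (bddClass R) J c)
    (hF : SymbolMem (bddClass R) J F)
    (hcn : ∀ n : ℕ, n ≤ J → ∀ i s, R i < s → c₀ ≤ c i s - n * e' i s)
    (hpoly : SymbolMem (polyClass R hR) (J + 1) X) : SymbolMem (bddClass R) J X := by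
  have key : ∀ (X X' c F : ι → ℝ → ℝ), HasEuler R X X' → FamEq R (e * X') (c * X + F) →
      F ∈ (bddClass R).alg → (∀ i s, R i < s → c₀ ≤ c i s) → X ∈ (polyClass R hR).alg →
      X ∈ (bddClass R).alg := by
    intro X X' c F hX heq hF hc hp
    obtain ⟨K, hK⟩ := hF
    refine ⟨K / c₀, fun i s hs => ?_⟩
    refine abs_le_of_singular_ode (hR i) hc₀ (fun s hs => (hX i s hs).1) (fun s hs => ?_)
      (he i) (heE i) (hc i) (hK i) (hp i) s hs
    rw [(hX i s hs).2]; exact heq i s hs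
  induction J generalizing X X' c F with
  | zero => exact key X X' c F hX heq hF (fun i s hs => by simpa using hcn 0 le_rfl i s hs) hpoly.mem
  | succ J ih =>
    have hXJ := ih hX heq he'.succ_le hc.succ_le hF.succ_le (fun n hn => hcn n (by omega))
      hpoly.succ_le
    have hp1 := hpoly.euler hX
    obtain ⟨_, X'', hX'', _⟩ := id hp1
    obtain ⟨_, c', hc', hc1⟩ := id hc
    obtain ⟨_, F', hF', hF1⟩ := id hF
    have h1 := ((hee.mul hX'').congr_left heq).unique ((hc'.mul hX).add hF')
    refine .succ hXJ.mem hX (ih (c := c - e') (F := F' + c' * X) hX'' ?_ he'.succ_le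
      (hc.succ_le.sub he'.succ_le) (hF1.add (hc1.mul hXJ)) ?_ hp1)
    · intro i s hs
      have := h1 i s hs
      simp only [Pi.add_apply, Pi.mul_apply, Pi.sub_apply] at this ⊢
      linarith
    · intro n hn i s hs
      have := hcn (n + 1) (by omega) i s hs
      push_cast at this
      simp only [Pi.sub_apply]
      linarith

end SymbolClass

/-! ### Decay estimates for solutions of the first-order system -/

/-- The forcing term `Γ = g (1 - 2 g / (s² W))`. -/
noncomputable def forcing (g W s : ℝ) : ℝ := g * (1 - 2 * (s ^ 2)⁻¹ * g * W⁻¹)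

/-- The coefficient `β = (1 + (∂ₛr)²) / 2`, where `(∂ₛr)² = (W - 2 g / s²)² / W`. -/
noncomputable def halfSlope (g W s : ℝ) : ℝ := (1 + (W - 2 * (s ^ 2)⁻¹ * g) ^ 2 * W⁻¹) / 2

theorem half_le_halfSlope {g W s : ℝ} (hW : 0 < W) : 1 / 2 ≤ halfSlope g W s := by
  have : 0 ≤ (W - 2 * (s ^ 2)⁻¹ * g) ^ 2 * W⁻¹ := by positivity
  unfold halfSlope; linarith

/-- The shrinker equation as a first-order system. The unknowns are `W = (r / s)²` and
`η = s² y`, where `y = -r ∂ₛ²r / (1 + (∂ₛr)²)` is the last argument of `g = f(1, …, 1, ·)`;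
`γ l` stands for `g^(l) ∘ y`, `c` for `g 0`, and `Z` for `s² (s ∂ₛ y)`. The numbers `k`, `σ`, `A`
are common to a family of solutions in which estimates are uniform. Bounds that are not uniform
over such a family are stated with `∃`. -/
structure RadialSol (k : ℕ) (σ A : ℝ) where
  R : ℝ
  γ : ℕ → ℝ → ℝ
  c : ℝ
  W : ℝ → ℝ
  η : ℝ → ℝ
  Z : ℝ → ℝ
  one_le : 1 ≤ R
  Z_eq : ∀ s, R < s →
    (s ^ 2)⁻¹ * γ 1 s * Z s = forcing (γ 0 s) (W s) s + halfSlope (γ 0 s) (W s) s * η s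
  hη : ∀ s, R < s → HasDerivAt η ((Z s + 2 * η s) / s) s
  hW : ∀ s, R < s → HasDerivAt W ((-4 * ((s ^ 2)⁻¹ * γ 0 s)) / s) s
  hγ : ∀ l ≤ k, ∀ s, R < s → HasDerivAt (γ l) (γ (l + 1) s * ((s ^ 2)⁻¹ * Z s) / s) s
  γ_le : ∀ l ≤ k, ∀ s, R < s → |γ l s| ≤ A
  γ_one_pos : ∀ s, R < s → 0 < γ 1 s
  γ_one_inv_le : ∃ C, ∀ s, R < s → |(γ 1 s)⁻¹| ≤ C
  γ_top_le : ∃ C, ∀ s, R < s → |γ (k + 1) s| ≤ C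
  γ_sub_le : ∀ s, R < s → |γ 0 s - c| ≤ A * ((s ^ 2)⁻¹ * |η s|)
  η_le : ∃ C, ∀ s, R < s → |η s| ≤ C
  W_near : ∀ s, R < s → |W s - σ ^ 2| ≤ σ ^ 2 / 2
  W_lim : Tendsto W atTop (𝓝 (σ ^ 2))
  small : ∀ s, R < s → |((s ^ 2)⁻¹) ^ 2 * γ 2 s * Z s| ≤ 1 / (4 * (k + 3))

namespace RadialSol

variable {k : ℕ} {σ A : ℝ}

theorem pos_of_lt (d : RadialSol k σ A) {s : ℝ} (hs : d.R < s) : 0 < s := by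
  linarith [d.one_le]

/-- The half-lines on which the members of the family of all solutions live. -/
abbrev dom : RadialSol k σ A → ℝ := RadialSol.R

theorem dom_one_le (d : RadialSol k σ A) : 1 ≤ dom d := d.one_le

theorem dom_ne (d : RadialSol k σ A) (s : ℝ) (hs : dom d < s) : s ≠ 0 := (d.pos_of_lt hs).ne'

theorem W_pos (hσ : 0 < σ) (d : RadialSol k σ A) {s : ℝ} (hs : d.R < s) : 0 < d.W s := by
  have := (abs_le.1 (d.W_near s hs)).1
  have : 0 < σ ^ 2 := by positivity
  linarith

/-- Bounded families. -/
abbrev Bd (k : ℕ) (σ A : ℝ) : GrowthClass (dom (k := k) (σ := σ) (A := A)) := bddClass _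

/-- Families of polynomial growth. -/
abbrev Po (k : ℕ) (σ A : ℝ) : GrowthClass (dom (k := k) (σ := σ) (A := A)) :=
  polyClass _ dom_one_le

/-- The family of the functions `W`. -/
abbrev fW (d : RadialSol k σ A) : ℝ → ℝ := d.W

/-- The family of the functions `η`. -/
abbrev fη (d : RadialSol k σ A) : ℝ → ℝ := d.η

/-- The family of the functions `Z`. -/
abbrev fZ (d : RadialSol k σ A) : ℝ → ℝ := d.Z

/-- The family of the functions `γ l = g^(l) ∘ y`. -/
abbrev fγ (l : ℕ) (d : RadialSol k σ A) : ℝ → ℝ := d.γ l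

/-- The family of the forcing terms `Γ`. -/
noncomputable def fΓ (d : RadialSol k σ A) (s : ℝ) : ℝ := forcing (d.γ 0 s) (d.W s) s

/-- The family of the coefficients `β`. -/
noncomputable def fβ (d : RadialSol k σ A) (s : ℝ) : ℝ := halfSlope (d.γ 0 s) (d.W s) s

theorem bd_le_po {F : RadialSol k σ A → ℝ → ℝ} (h : F ∈ (Bd k σ A).alg) :
    F ∈ (Po k σ A).alg := by
  obtain ⟨C, hC⟩ := h
  exact fun i => ⟨C, 0, fun s hs => by simpa using hC i s hs⟩

theorem xi_mem : (xi : RadialSol k σ A → ℝ → ℝ) ∈ (Bd k σ A).alg := by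
  refine ⟨1, fun d s hs => ?_⟩
  have h1 : 1 ≤ s := d.one_le.trans hs.le
  rw [xi, abs_of_nonneg (by positivity)]
  exact inv_le_one_of_one_le₀ (one_le_pow₀ h1)

theorem W_mem : (fW : RadialSol k σ A → ℝ → ℝ) ∈ (Bd k σ A).alg := by
  refine ⟨2 * σ ^ 2, fun d s hs => ?_⟩
  have := abs_le.1 (d.W_near s hs)
  exact abs_le.2 ⟨by nlinarith, by nlinarith⟩

theorem W_inv_mem (hσ : 0 < σ) : (fW⁻¹ : RadialSol k σ A → ℝ → ℝ) ∈ (Bd k σ A).alg := by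
  refine ⟨2 / σ ^ 2, fun d s hs => ?_⟩
  have := abs_le.1 (d.W_near s hs)
  have hW := d.W_pos hσ hs
  have h2 : 0 < σ ^ 2 := by positivity
  simp only [Pi.inv_apply]
  rw [abs_of_pos (inv_pos.2 hW), inv_eq_one_div, div_le_div_iff₀ hW h2]
  linarith

theorem γ_mem (l : ℕ) (hl : l ≤ k) : (fγ l : RadialSol k σ A → ℝ → ℝ) ∈ (Bd k σ A).alg :=
  ⟨A, fun d s hs => d.γ_le l hl s hs⟩

theorem hasEuler_W : HasEuler dom (fW : RadialSol k σ A → ℝ → ℝ)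
    (fun d s => -4 * (xi d s * fγ 0 d s)) :=
  hasEuler_of_hasDerivAt (fun d s hs => d.hW s hs) dom_ne

theorem hasEuler_η : HasEuler dom (fη : RadialSol k σ A → ℝ → ℝ)
    (fZ + fun d s => 2 * fη d s) :=
  hasEuler_of_hasDerivAt (fun d s hs => d.hη s hs) dom_ne

theorem hasEuler_γ (l : ℕ) (hl : l ≤ k) : HasEuler dom (fγ l : RadialSol k σ A → ℝ → ℝ)
    (fγ (l + 1) * (xi * fZ)) :=
  hasEuler_of_hasDerivAt (fun d s hs => d.hγ l hl s hs) dom_ne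

/-- The equation for `Z`. -/
theorem famEq_Z : FamEq dom (xi * fγ 1 * fZ : RadialSol k σ A → ℝ → ℝ) (fΓ + fβ * fη) :=
  fun d s hs => d.Z_eq s hs

theorem hasEuler_γ_zero : HasEuler dom (fγ 0 : RadialSol k σ A → ℝ → ℝ) (fΓ + fβ * fη) := by
  refine (hasEuler_γ 0 (Nat.zero_le _)).congr_right fun d s hs => ?_
  rw [← famEq_Z d s hs]; simp only [Pi.mul_apply]; ring

variable {𝒜 : GrowthClass (dom (k := k) (σ := σ) (A := A))} {J : ℕ}

theorem symbolMem_W (hx : xi ∈ 𝒜.alg) (hW : fW ∈ 𝒜.alg) (hγ : SymbolMem 𝒜 J (fγ 0)) :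
    SymbolMem 𝒜 (J + 1) fW :=
  .succ hW hasEuler_W (((symbolMem_xi dom_ne hx).mul hγ).const_mul _)

theorem symbolMem_W_inv (hσ : 0 < σ) (hW : SymbolMem 𝒜 J fW) (hW' : fW⁻¹ ∈ 𝒜.alg) :
    SymbolMem 𝒜 J fW⁻¹ := hW.inv hW' fun d _ hs => (d.W_pos hσ hs).ne'

theorem symbolMem_Γ (hx : xi ∈ 𝒜.alg) (hγ : SymbolMem 𝒜 J (fγ 0)) (hW : SymbolMem 𝒜 J fW⁻¹) :
    SymbolMem 𝒜 J fΓ := by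
  refine (hγ.mul ((SymbolMem.const 1).sub
    ((((symbolMem_xi dom_ne hx).mul hγ).mul hW).const_mul 2))).congr fun d s _ => ?_
  simp only [Pi.mul_apply, Pi.sub_apply, fΓ, forcing, xi, Pi.inv_apply]; ring

theorem symbolMem_β (hx : xi ∈ 𝒜.alg) (hγ : SymbolMem 𝒜 J (fγ 0)) (hW : SymbolMem 𝒜 J fW)
    (hW' : SymbolMem 𝒜 J fW⁻¹) : SymbolMem 𝒜 J fβ := by
  have h1 := hW.sub (((symbolMem_xi dom_ne hx).mul hγ).const_mul 2)
  refine (((SymbolMem.const 1).add ((h1.mul h1).mul hW')).const_mul (1 / 2)).congr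
    fun d s _ => ?_
  simp only [Pi.mul_apply, Pi.sub_apply, Pi.add_apply, fβ, halfSlope, xi, Pi.inv_apply]; ring

/-- Regularity of `η` is inherited, with a gain of one derivative, by `g ∘ y` and `W`. -/
theorem symbolMem_γ_zero_W (hσ : 0 < σ) (hx : xi ∈ 𝒜.alg) (hW : fW ∈ 𝒜.alg)
    (hW' : fW⁻¹ ∈ 𝒜.alg) (hγ : fγ 0 ∈ 𝒜.alg) (hη : SymbolMem 𝒜 J fη) :
    SymbolMem 𝒜 (J + 1) (fγ 0) ∧ SymbolMem 𝒜 (J + 1) fW := by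
  have aux : ∀ J, SymbolMem 𝒜 J (fγ 0) → SymbolMem 𝒜 J fW → SymbolMem 𝒜 J fη →
      SymbolMem 𝒜 (J + 1) (fγ 0) ∧ SymbolMem 𝒜 (J + 1) fW := by
    intro J h1 h2 h3
    have h4 := symbolMem_W_inv hσ h2 hW'
    exact ⟨.succ hγ hasEuler_γ_zero ((symbolMem_Γ hx h1 h4).add ((symbolMem_β hx h1 h2 h4).mul h3)),
      symbolMem_W hx hW h1⟩
  induction J with
  | zero => exact aux 0 hγ hW hη
  | succ J ih => exact aux _ (ih hη.succ_le).1 (ih hη.succ_le).2 hη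

/-- All derivatives of a solution grow at most polynomially, with constants that depend on the
solution. -/
theorem symbolMem_poly (hσ : 0 < σ) :
    ∀ j ≤ k, SymbolMem (Po k σ A) j fZ ∧ SymbolMem (Po k σ A) (j + 1) fη := by
  have hx : (xi : RadialSol k σ A → ℝ → ℝ) ∈ (Po k σ A).alg := bd_le_po xi_mem
  have hW : (fW : RadialSol k σ A → ℝ → ℝ) ∈ (Po k σ A).alg := bd_le_po W_mem
  have hW' : (fW⁻¹ : RadialSol k σ A → ℝ → ℝ) ∈ (Po k σ A).alg := bd_le_po (W_inv_mem hσ)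
  have hγ : ∀ l ≤ k + 1, (fγ l : RadialSol k σ A → ℝ → ℝ) ∈ (Po k σ A).alg := by
    intro l hl
    rcases Nat.lt_or_ge k l with h | h
    · obtain rfl : l = k + 1 := by omega
      intro d
      obtain ⟨C, hC⟩ := d.γ_top_le
      exact ⟨C, 0, fun s hs => by simpa using hC s hs⟩
    · exact bd_le_po (γ_mem l h)
  have hηm : (fη : RadialSol k σ A → ℝ → ℝ) ∈ (Po k σ A).alg := fun d => by
    obtain ⟨C, hC⟩ := d.η_le
    exact ⟨C, 0, fun s hs => by simpa using hC s hs⟩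
  have hi : ((fγ 1)⁻¹ : RadialSol k σ A → ℝ → ℝ) ∈ (Po k σ A).alg := fun d => by
    obtain ⟨C, hC⟩ := d.γ_one_inv_le
    exact ⟨C, 0, fun s hs => by simpa using hC s hs⟩
  have hp : SymbolMem (Po k σ A) k (fun _ s => s ^ 2) := symbolMem_pow 2
    fun d => ⟨1, 2, fun s _ => by rw [abs_of_nonneg (by positivity), one_mul]⟩
  have step : ∀ j ≤ k, SymbolMem (Po k σ A) j fη → (∀ i, i < j → SymbolMem (Po k σ A) i fZ) →
      SymbolMem (Po k σ A) j fZ := by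
    intro j hj h1 h2
    have h3 := symbolMem_γ_zero_W hσ hx hW hW' (hγ 0 (by omega)) h1
    have h4 : SymbolMem (Po k σ A) j (fγ 1) := SymbolMem.comp (L := k + 1)
      (y' := xi * fZ) (fun l hl => hasEuler_γ l (by omega)) hγ
      (fun i hi => (symbolMem_xi dom_ne hx).mul (h2 i hi)) 1 (by omega)
    have h5 := h4.inv hi fun d s hs => (d.γ_one_pos s hs).ne'
    have h6 := symbolMem_W_inv hσ h3.2.succ_le hW'
    have h7 := (symbolMem_Γ hx h3.1.succ_le h6).add
      ((symbolMem_β hx h3.1.succ_le h3.2.succ_le h6).mul h1)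
    refine (((hp.mono hj).mul h5).mul h7).congr fun d s hs => ?_
    rw [Pi.mul_apply, Pi.mul_apply, ← famEq_Z d s hs]
    have h8 := (d.γ_one_pos s hs).ne'
    have h9 := (d.pos_of_lt hs).ne'
    simp only [Pi.mul_apply, Pi.inv_apply, xi]
    field_simp
  intro j
  induction j using Nat.strong_induction_on with
  | _ j ih =>
    intro hj
    have h1 : SymbolMem (Po k σ A) j fη := by
      rcases j with _ | j
      · exact hηm
      · exact (ih j (by omega) (by omega)).2
    have h2 := step j hj h1 fun i hi => (ih i hi (by omega)).1
    exact ⟨h2, .succ hηm hasEuler_η (h2.add (h1.const_mul 2))⟩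

/-- The coefficient `ε = ξ g'` of the top order term, `ξ = s⁻²`. -/
noncomputable abbrev fε : RadialSol k σ A → ℝ → ℝ := xi * fγ 1

/-- The term `ξ² g'' Z` of the Euler derivative of `ε`, which is small by assumption. -/
noncomputable abbrev fδ : RadialSol k σ A → ℝ → ℝ := xi * xi * fγ 2 * fZ

/-- The Euler derivative of `ε`. -/
noncomputable abbrev fε' : RadialSol k σ A → ℝ → ℝ := (fun d s => -2 * fε d s) + fδ

theorem ε_pos (d : RadialSol k σ A) (s : ℝ) (hs : dom d < s) : 0 < fε d s := by
  have := d.γ_one_pos s hs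
  have := d.pos_of_lt hs
  simp only [Pi.mul_apply, xi]
  positivity

theorem ε_le (hk : 1 ≤ k) (d : RadialSol k σ A) (s : ℝ) (hs : dom d < s) :
    fε d s ≤ A * (s ^ 2)⁻¹ := by
  have h1 := (le_abs_self _).trans (d.γ_le 1 hk s hs)
  have := d.pos_of_lt hs
  simp only [Pi.mul_apply, xi, mul_comm _ (d.γ 1 s)]
  exact mul_le_mul_of_nonneg_right h1 (by positivity)

theorem hasEuler_ε (hk : 1 ≤ k) : HasEuler dom (fε : RadialSol k σ A → ℝ → ℝ) fε' := by
  refine ((hasEuler_xi dom_ne).mul (hasEuler_γ 1 hk)).congr_right fun d s _ => ?_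
  simp only [Pi.add_apply, Pi.mul_apply]; ring

theorem abs_δ_le (d : RadialSol k σ A) (s : ℝ) (hs : dom d < s) :
    |fδ d s| ≤ 1 / (4 * (k + 3)) := by
  have := d.small s hs
  rwa [pow_two] at this

theorem δ_mem : (fδ : RadialSol k σ A → ℝ → ℝ) ∈ (Bd k σ A).alg := ⟨_, abs_δ_le⟩

/-- Lower bounds for the coefficients of the equations of the Euler derivatives of `Z`. -/
theorem quarter_le_coeff (hσ : 0 < σ) (d : RadialSol k σ A) (s : ℝ) (hs : dom d < s) {a b : ℝ}
    (ha : 0 ≤ a) (hb : 0 ≤ b) (hbk : b ≤ k + 3) : 1 / 4 ≤ fβ d s + a * fε d s - b * fδ d s := by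
  have h1 := half_le_halfSlope (g := d.γ 0 s) (s := s) (d.W_pos hσ hs)
  have h2 := ε_pos d s hs
  have h4 : b * |fδ d s| ≤ 1 / 4 := by
    calc b * |fδ d s| ≤ (k + 3) * (1 / (4 * (k + 3))) :=
          mul_le_mul hbk (abs_δ_le d s hs) (abs_nonneg _) (by positivity)
      _ = 1 / 4 := by field_simp
  have h5 : b * fδ d s ≤ 1 / 4 := (mul_le_mul_of_nonneg_left (le_abs_self _) hb).trans h4
  have h6 : 0 ≤ a * fε d s := mul_nonneg ha h2.le
  have h7 : fβ d s = halfSlope (d.γ 0 s) (d.W s) s := rfl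
  linarith

theorem symbolMem_ξ {J : ℕ} : SymbolMem (Bd k σ A) J xi := symbolMem_xi dom_ne xi_mem

theorem symbolMem_η_zero (hσ : 0 < σ) (hk : 1 ≤ k) : SymbolMem (Bd k σ A) 0 fη := by
  have hW := W_inv_mem (k := k) (A := A) hσ
  have hγ := γ_mem (k := k) (σ := σ) (A := A) 0 (Nat.zero_le _)
  have hβ : SymbolMem (Bd k σ A) 0 fβ := symbolMem_β (J := 0) xi_mem hγ W_mem hW
  have hx : SymbolMem (Bd k σ A) 0 fε :=
    SymbolMem.mul (J := 0) xi_mem (γ_mem (k := k) (σ := σ) (A := A) 1 hk)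
  refine SymbolMem.of_singular_ode (E := A) (c₀ := 1 / 4) dom_one_le (by norm_num) (J := 0)
    (c := fβ + fun d s => 2 * fε d s) (F := fΓ) hasEuler_η ?_ ε_pos (ε_le hk) (hasEuler_ε hk)
    ((hx.const_mul (-2)).add δ_mem) (hβ.add (hx.const_mul 2))
    (symbolMem_Γ (J := 0) xi_mem hγ hW) ?_ (symbolMem_poly hσ 0 (Nat.zero_le _)).2
  · intro d s hs
    have := famEq_Z d s hs
    simp only [Pi.mul_apply, Pi.add_apply] at this ⊢
    linarith
  · intro n hn d s hs
    obtain rfl : n = 0 := by omega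
    have := quarter_le_coeff hσ d s hs (a := 2) (b := 0) (by norm_num) le_rfl (by positivity)
    simp only [Pi.add_apply] at this ⊢
    linarith

/-- The equation of `Z` after one differentiation, `ε s∂ₛZ = (β - ε') Z + F`. The term `ε' Z`
is quadratic in `Z`. -/
theorem exists_equation_Z (hσ : 0 < σ) (hk : 1 ≤ k) {J : ℕ} (hη : SymbolMem (Bd k σ A) J fη)
    {Z' : RadialSol k σ A → ℝ → ℝ} (hZ' : HasEuler dom fZ Z') :
    ∃ F, SymbolMem (Bd k σ A) J F ∧ FamEq dom (fε * Z') ((fβ - fε') * fZ + F) ∧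
      SymbolMem (Bd k σ A) (J + 1) fβ := by
  obtain ⟨h1, h2⟩ := symbolMem_γ_zero_W hσ xi_mem W_mem (W_inv_mem hσ)
    (γ_mem 0 (Nat.zero_le _)) hη
  have h3 := symbolMem_W_inv hσ h2 (W_inv_mem hσ)
  have hβ := symbolMem_β xi_mem h1 h2 h3
  obtain ⟨_, Γ', hΓ', hΓ1⟩ := symbolMem_Γ xi_mem h1 h3
  obtain ⟨_, β', hβ', hβ1⟩ := id hβ
  refine ⟨Γ' + β' * fη + fun d s => 2 * (fβ d s * fη d s),
    (hΓ1.add (hβ1.mul hη)).add ((hβ.succ_le.mul hη).const_mul 2), ?_, hβ⟩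
  have h4 := (((hasEuler_ε hk).mul hZ').congr_left famEq_Z).unique
    (hΓ'.add (hβ'.mul hasEuler_η))
  intro d s hs
  have := h4 d s hs
  simp only [Pi.mul_apply, Pi.add_apply, Pi.sub_apply] at this ⊢
  linarith

theorem symbolMem_Z_zero (hσ : 0 < σ) (hk : 1 ≤ k) : SymbolMem (Bd k σ A) 0 fZ := by
  obtain ⟨_, Z', hZ', hZ1⟩ := (symbolMem_poly (A := A) hσ 1 hk).1
  obtain ⟨F, hF, heq, hβ⟩ := exists_equation_Z hσ hk (symbolMem_η_zero hσ hk) hZ'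
  have hx : SymbolMem (Bd k σ A) 0 fε :=
    SymbolMem.mul (J := 0) xi_mem (γ_mem (k := k) (σ := σ) (A := A) 1 hk)
  have hε' : SymbolMem (Bd k σ A) 0 fε' := (hx.const_mul (-2)).add δ_mem
  refine SymbolMem.of_singular_ode (E := A) (c₀ := 1 / 4) dom_one_le (by norm_num) (J := 0)
    hZ' heq ε_pos (ε_le hk) (hasEuler_ε hk) hε' (hβ.succ_le.sub hε') hF ?_
    (symbolMem_poly hσ 1 hk).1
  intro n hn d s hs
  obtain rfl : n = 0 := by omega
  have := quarter_le_coeff hσ d s hs (a := 2) (b := 1) (by norm_num) (by norm_num)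
    (by linarith [(Nat.cast_nonneg k : (0 : ℝ) ≤ k)])
  simp only [Pi.add_apply, Pi.sub_apply] at this ⊢
  linarith

/-- The derivatives of `g ∘ y` inherit the regularity of `Z`. -/
theorem symbolMem_γ {J : ℕ} (hZ : SymbolMem (Bd k σ A) J fZ) (l : ℕ) (hl : l + (J + 1) ≤ k) :
    SymbolMem (Bd k σ A) (J + 1) (fγ l) :=
  SymbolMem.comp (L := k) (y' := xi * fZ) (fun l hl => hasEuler_γ l (by omega))
    (fun l hl => γ_mem l hl) (fun _ hi => symbolMem_ξ.mul (hZ.mono (Nat.lt_succ_iff.1 hi))) l hl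

theorem symbolMem_Z_succ (hσ : 0 < σ) {J : ℕ} (hJ : J + 4 ≤ k)
    (hZ : SymbolMem (Bd k σ A) J fZ) (hη : SymbolMem (Bd k σ A) (J + 1) fη) :
    SymbolMem (Bd k σ A) (J + 1) fZ := by
  have hk : 1 ≤ k := by omega
  have hpZ := (symbolMem_poly (k := k) (A := A) hσ (J + 2) (by omega)).1
  obtain ⟨_, Z', hZ', hZ1⟩ := id hpZ
  obtain ⟨_, Z'', hZ'', -⟩ := id hZ1
  obtain ⟨F, hF, heq, hβ⟩ := exists_equation_Z hσ hk hη hZ'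
  obtain ⟨_, F', hF', hF1⟩ := hF
  obtain ⟨_, β', hβ', hβ1⟩ := id hβ
  have hγ1 := symbolMem_γ hZ 1 (by omega)
  have hγ2 := symbolMem_γ hZ 2 (by omega)
  have hκ := (symbolMem_ξ.mul symbolMem_ξ).mul hγ2
  obtain ⟨_, κ', hκ', hκ1⟩ := id hκ
  have hx : SymbolMem (Bd k σ A) (J + 1) fε := symbolMem_ξ.mul hγ1
  have hδ : SymbolMem (Bd k σ A) J fδ := hκ.succ_le.mul hZ
  have hε' : SymbolMem (Bd k σ A) J fε' := (hx.succ_le.const_mul (-2)).add hδ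
  have hδ' : HasEuler dom fδ (κ' * fZ + xi * xi * fγ 2 * Z') := hκ'.mul hZ'
  have hε'' : HasEuler dom fε' ((fun d s => -2 * fε' d s) + (κ' * fZ + xi * xi * fγ 2 * Z')) :=
    ((hasEuler_ε hk).const_mul (-2)).add hδ'
  have h4 := (((hasEuler_ε hk).mul hZ'').congr_left heq).unique
    (((hβ'.sub hε'').mul hZ').add hF')
  refine .succ hZ.mem hZ' (SymbolMem.of_singular_ode (E := A) (c₀ := 1 / 4) dom_one_le
    (by norm_num) (c := fβ - (fun d s => 2 * fε' d s) - fδ)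
    (F := (β' + (fun d s => 2 * fε' d s) - κ' * fZ) * fZ + F')
    hZ'' ?_ ε_pos (ε_le hk) (hasEuler_ε hk) hε' ((hβ.succ_le.succ_le.sub (hε'.const_mul 2)).sub hδ)
    ((((hβ1.succ_le.add (hε'.const_mul 2)).sub (hκ1.mul hZ)).mul hZ).add hF1) ?_ hZ1)
  · intro d s hs
    have := h4 d s hs
    simp only [Pi.mul_apply, Pi.add_apply, Pi.sub_apply] at this ⊢
    linarith
  · intro n hn d s hs
    have hnk : (n : ℝ) ≤ k := by exact_mod_cast (by omega : n ≤ k)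
    have := quarter_le_coeff hσ d s hs (a := 4 + 2 * n) (b := 3 + n) (by positivity)
      (by positivity) (by linarith)
    simp only [Pi.add_apply, Pi.sub_apply] at this ⊢
    linarith

theorem symbolMem_η_succ {J : ℕ} (hη : SymbolMem (Bd k σ A) J fη)
    (hZ : SymbolMem (Bd k σ A) J fZ) : SymbolMem (Bd k σ A) (J + 1) fη :=
  .succ hη.mem hasEuler_η (hZ.add (hη.const_mul 2))

/-- Uniform symbol bounds for `Z` and `η`. -/
theorem symbolMem_Z_η (hσ : 0 < σ) {J : ℕ} (hJ : J + 3 ≤ k) :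
    SymbolMem (Bd k σ A) J fZ ∧ SymbolMem (Bd k σ A) (J + 1) fη := by
  induction J with
  | zero =>
    have := symbolMem_Z_zero (k := k) (A := A) hσ (by omega)
    exact ⟨this, symbolMem_η_succ (symbolMem_η_zero hσ (by omega)) this⟩
  | succ J ih =>
    obtain ⟨h1, h2⟩ := ih (by omega)
    have := symbolMem_Z_succ hσ (by omega) h1 h2
    exact ⟨this, symbolMem_η_succ h2 this⟩

/-- The difference quotient `E = s² (g ∘ y - g 0)`. -/
noncomputable def fE (d : RadialSol k σ A) (s : ℝ) : ℝ := s ^ 2 * (d.γ 0 s - d.c)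

/-- `V = s² (W - σ²)`. -/
noncomputable def fV (d : RadialSol k σ A) (s : ℝ) : ℝ := s ^ 2 * (d.W s - σ ^ 2)

/-- `V₂ = s⁴ (W - σ² - 2 c / s²)`. -/
noncomputable def fV₂ (d : RadialSol k σ A) (s : ℝ) : ℝ :=
  s ^ 4 * (d.W s - σ ^ 2 - 2 * d.c / s ^ 2)

theorem symbolMem_E (hσ : 0 < σ) (hk : 3 ≤ k) : SymbolMem (Bd k σ A) (k - 2) fE := by
  obtain ⟨j, rfl⟩ : ∃ j, k = j + 3 := ⟨k - 3, by omega⟩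
  obtain ⟨hZ, hη⟩ := symbolMem_Z_η (k := j + 3) (A := A) hσ (J := j) le_rfl
  have hE0 : (fE : RadialSol (j + 3) σ A → ℝ → ℝ) ∈ (Bd (j + 3) σ A).alg := by
    obtain ⟨C, hC⟩ := hη.mem
    refine ⟨A * C, fun d s hs => ?_⟩
    have hs0 := d.pos_of_lt hs
    have hA : 0 ≤ A := (abs_nonneg _).trans (d.γ_le 0 (by omega) s hs)
    rw [fE, abs_mul, abs_of_nonneg (by positivity)]
    calc s ^ 2 * |d.γ 0 s - d.c| ≤ s ^ 2 * (A * ((s ^ 2)⁻¹ * |d.η s|)) :=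
          mul_le_mul_of_nonneg_left (d.γ_sub_le s hs) (by positivity)
      _ = A * |d.η s| := by field_simp
      _ ≤ A * C := mul_le_mul_of_nonneg_left (hC d s hs) hA
  have hE : HasEuler dom (fE : RadialSol (j + 3) σ A → ℝ → ℝ)
      ((fun d s => 2 * fE d s) + fγ 1 * fZ) := by
    have hc : HasEuler dom (fun (d : RadialSol (j + 3) σ A) _ => d.c) 0 := fun d s _ =>
      ⟨differentiableAt_const _, by simp⟩
    refine ((hasEuler_pow 2).mul ((hasEuler_γ 0 (by omega)).sub hc)).congr_right
      fun d s hs => ?_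
    have hs0 := d.pos_of_lt hs
    simp only [Pi.add_apply, Pi.mul_apply, Pi.sub_apply, fE, xi, Pi.zero_apply]
    field_simp
    push_cast
    ring
  have hγ1 := symbolMem_γ hZ 1 (by omega)
  have aux : ∀ i ≤ j + 1, SymbolMem (Bd (j + 3) σ A) i fE := by
    intro i
    induction i with
    | zero => exact fun _ => hE0
    | succ i ih =>
      intro hi
      exact .succ hE0 hE (((ih (by omega)).const_mul 2).add
        ((hγ1.mono (by omega)).mul (hZ.mono (by omega))))
  exact aux _ le_rfl

theorem W_lim_sub (d : RadialSol k σ A) : Tendsto (fun s => d.W s - σ ^ 2) atTop (𝓝 0) := by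
  have := d.W_lim.sub_const (σ ^ 2)
  rwa [sub_self] at this

theorem symbolMem_V (hσ : 0 < σ) (hk : 3 ≤ k) : SymbolMem (Bd k σ A) k fV := by
  obtain ⟨j, rfl⟩ : ∃ j, k = j + 3 := ⟨k - 3, by omega⟩
  obtain ⟨hZ, hη⟩ := symbolMem_Z_η (k := j + 3) (A := A) hσ (J := j) le_rfl
  have hγ := (symbolMem_γ_zero_W hσ xi_mem W_mem (W_inv_mem hσ) (γ_mem 0 (by omega)) hη).1
  have hV0 : (fV : RadialSol (j + 3) σ A → ℝ → ℝ) ∈ (Bd (j + 3) σ A).alg := by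
    refine ⟨2 * A, fun d s hs => ?_⟩
    have hs0 := d.pos_of_lt hs
    have h1 := abs_le_div_pow_of_abs_deriv_le (C := 2 * A) (a := 2) (by linarith [d.one_le])
      two_ne_zero (fun s hs => (d.hW s hs).differentiableAt.sub_const (σ ^ 2)) (fun s hs => ?_)
      d.W_lim_sub s hs
    · rw [fV, abs_mul, abs_of_nonneg (by positivity : 0 ≤ s ^ 2)]
      calc s ^ 2 * |d.W s - σ ^ 2| ≤ s ^ 2 * (2 * A / s ^ 2) :=
            mul_le_mul_of_nonneg_left h1 (by positivity)
        _ = 2 * A := by field_simp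
    · have hs0 := d.pos_of_lt hs
      rw [((d.hW s hs).sub_const (σ ^ 2)).deriv, abs_div, abs_mul, abs_mul,
        abs_of_pos (by positivity : 0 < (s ^ 2)⁻¹), abs_of_pos hs0]
      have := d.γ_le 0 (by omega) s hs
      calc |(-4 : ℝ)| * ((s ^ 2)⁻¹ * |d.γ 0 s|) / s ≤ |(-4 : ℝ)| * ((s ^ 2)⁻¹ * A) / s := by
            gcongr
        _ = _ := by rw [abs_neg, abs_of_pos (by norm_num : (0 : ℝ) < 4)]; field_simp; push_cast; ring
  have hV : HasEuler dom (fV : RadialSol (j + 3) σ A → ℝ → ℝ)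
      ((fun d s => 2 * fV d s) + fun d s => -4 * fγ 0 d s) := by
    refine ((hasEuler_pow 2).mul (hasEuler_W.sub (.const (σ ^ 2)))).congr_right fun d s hs => ?_
    have hs0 := d.pos_of_lt hs
    simp only [Pi.add_apply, Pi.mul_apply, Pi.sub_apply, fV, xi, Pi.zero_apply]
    field_simp
    push_cast
    ring
  have aux : ∀ i ≤ j + 3, SymbolMem (Bd (j + 3) σ A) i fV := by
    intro i
    induction i with
    | zero => exact fun _ => hV0
    | succ i ih =>
      intro hi
      exact .succ hV0 hV (((ih (by omega)).const_mul 2).add ((hγ.mono (by omega)).const_mul _))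
  exact aux _ le_rfl

theorem symbolMem_V₂ (hσ : 0 < σ) (hk : 3 ≤ k) : SymbolMem (Bd k σ A) (k - 1) fV₂ := by
  have hE := symbolMem_E (k := k) (A := A) hσ hk
  have hV : HasEuler dom (fV₂ : RadialSol k σ A → ℝ → ℝ)
      ((fun d s => 4 * fV₂ d s) + fun d s => -4 * fE d s) := by
    have h1 : HasEuler dom (fun (d : RadialSol k σ A) s => 2 * d.c / s ^ 2)
        (fun d s => -2 * (2 * d.c / s ^ 2)) := by
      refine hasEuler_of_hasDerivAt (fun d s hs => ?_) dom_ne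
      have hs0 := d.pos_of_lt hs
      refine (hasDerivAt_div_pow (2 * d.c) 2 hs0.ne').congr_deriv ?_
      field_simp; push_cast; ring
    refine ((hasEuler_pow 4).mul ((hasEuler_W.sub (.const (σ ^ 2))).sub h1)).congr_right
      fun d s hs => ?_
    have hs0 := d.pos_of_lt hs
    simp only [Pi.add_apply, Pi.mul_apply, Pi.sub_apply, fV₂, fE, xi, Pi.zero_apply]
    field_simp
    push_cast
    ring
  have hV0 : (fV₂ : RadialSol k σ A → ℝ → ℝ) ∈ (Bd k σ A).alg := by
    obtain ⟨C, hC⟩ := hE.mem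
    refine ⟨C, fun d s hs => ?_⟩
    have hs0 := d.pos_of_lt hs
    have hd : ∀ s, d.R < s → HasDerivAt (fun s => d.W s - σ ^ 2 - 2 * d.c / s ^ 2)
        (-4 * fE d s / s ^ 5) s := by
      intro s hs
      have hs0 := d.pos_of_lt hs
      refine (((d.hW s hs).sub_const (σ ^ 2)).sub
        (hasDerivAt_div_pow (2 * d.c) 2 hs0.ne')).congr_deriv ?_
      simp only [fE]
      field_simp; push_cast; ring
    have hl : Tendsto (fun s => d.W s - σ ^ 2 - 2 * d.c / s ^ 2) atTop (𝓝 0) := by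
      simpa using d.W_lim_sub.sub ((tendsto_pow_atTop two_ne_zero).const_div_atTop (2 * d.c))
    have h1 := abs_le_div_pow_of_abs_deriv_le (C := C) (a := 4) (by linarith [d.one_le])
      (by norm_num) (fun s hs => (hd s hs).differentiableAt) (fun s hs => ?_) hl s hs
    · rw [fV₂, abs_mul, abs_of_nonneg (by positivity : 0 ≤ s ^ 4)]
      calc s ^ 4 * |d.W s - σ ^ 2 - 2 * d.c / s ^ 2| ≤ s ^ 4 * (C / s ^ 4) :=
            mul_le_mul_of_nonneg_left h1 (by positivity)
        _ = C := by field_simp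
    · have hs0 := d.pos_of_lt hs
      rw [(hd s hs).deriv, abs_div, abs_mul, abs_of_pos (by positivity : 0 < s ^ 5), abs_neg,
        abs_of_pos (by norm_num : (0 : ℝ) < 4)]
      have := hC d s hs
      push_cast
      gcongr
  have aux : ∀ i ≤ k - 1, SymbolMem (Bd k σ A) i fV₂ := by
    intro i
    induction i with
    | zero => exact fun _ => hV0
    | succ i ih =>
      intro hi
      exact .succ hV0 hV (((ih (by omega)).const_mul 4).add
        ((hE.mono (by omega)).const_mul _))
  exact aux _ le_rfl

end RadialSol

/-! ### From the first-order system to the radius function -/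

/-- Away from the left endpoint of a larger interval of regularity, one-sided derivatives are
ordinary ones. -/
theorem dd_eq_iteratedDeriv {R₁ R : ℝ} (h : R₁ < R) {k : ℕ} {v : ℝ → ℝ}
    (hv : ContDiffOn ℝ k v (Ioi R₁)) {j : ℕ} (hj : j ≤ k) {s : ℝ} (hs : R ≤ s) :
    dd R j v s = iteratedDeriv j v s :=
  iteratedDerivWithin_eq_iteratedDeriv (uniqueDiffOn_Ici R)
    ((hv.contDiffAt (Ioi_mem_nhds (h.trans_le hs))).of_le (by exact_mod_cast hj)) hs

theorem contDiffOn_const_div {R c : ℝ} {k : ℕ} (hR : 0 ≤ R) :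
    ContDiffOn ℝ k (fun s : ℝ => c / s) (Ioi R) :=
  contDiffOn_const.div contDiffOn_id fun _ hs => ne_of_gt (lt_of_le_of_lt hR hs)

namespace RadialSol

variable {k : ℕ} {σ A : ℝ}

/-- The deviation `u = s √W - σ s` of the radius function from the cone. -/
noncomputable def u (d : RadialSol k σ A) (s : ℝ) : ℝ := s * (√(d.W s) - σ)

/-- The remainder of `u` after its leading term. -/
noncomputable def u₀ (d : RadialSol k σ A) (s : ℝ) : ℝ := d.u s - d.c / (σ * s)

theorem symbolMem_sqrt_W (hσ : 0 < σ) {J : ℕ} (hW : SymbolMem (Bd k σ A) J fW) :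
    SymbolMem (Bd k σ A) J (fun d s => √(fW d s)) ∧
      SymbolMem (Bd k σ A) J (fun d s => √(fW d s) + σ)⁻¹ := by
  have h0 : (fun d s => √(fW d s)) ∈ (Bd k σ A).alg := by
    refine ⟨√(2 * σ ^ 2), fun d s hs => ?_⟩
    rw [abs_of_nonneg (Real.sqrt_nonneg _)]
    refine Real.sqrt_le_sqrt ?_
    have := (abs_le.1 (d.W_near s hs)).2
    nlinarith
  have h1 := hW.sqrt (symbolMem_W_inv hσ hW (W_inv_mem hσ)) h0 fun d s hs => d.W_pos hσ hs
  have h2 : ∀ (d : RadialSol k σ A) s, σ ≤ √(d.W s) + σ := fun d s => by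
    linarith [Real.sqrt_nonneg (d.W s)]
  refine ⟨h1, (h1.add (.const σ)).inv ⟨σ⁻¹, fun d s _ => ?_⟩ fun d s _ => ?_⟩
  · simp only [Pi.inv_apply, Pi.add_apply]
    rw [abs_of_pos (inv_pos.2 (hσ.trans_le (h2 d s)))]
    exact inv_anti₀ hσ (h2 d s)
  · exact (hσ.trans_le (h2 d s)).ne'

theorem sqrt_W_mul_self (hσ : 0 < σ) (d : RadialSol k σ A) {s : ℝ} (hs : d.R < s) :
    √(d.W s) * √(d.W s) = d.W s := Real.mul_self_sqrt (d.W_pos hσ hs).le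

theorem symbolMem_W_top (hσ : 0 < σ) (hk : 3 ≤ k) : SymbolMem (Bd k σ A) k fW := by
  obtain ⟨j, rfl⟩ : ∃ j, k = j + 3 := ⟨k - 3, by omega⟩
  obtain ⟨hZ, hη⟩ := symbolMem_Z_η (k := j + 3) (A := A) hσ (J := j) le_rfl
  exact symbolMem_W xi_mem W_mem
    (symbolMem_γ_zero_W hσ xi_mem W_mem (W_inv_mem hσ) (γ_mem 0 (by omega)) hη).1

theorem symbolMem_u (hσ : 0 < σ) (hk : 3 ≤ k) :
    SymbolMem (Bd k σ A) k (fun d s => s ^ 1 * d.u s) := by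
  have h1 := (symbolMem_sqrt_W hσ (symbolMem_W_top (A := A) hσ hk)).2
  refine ((symbolMem_V hσ hk).mul h1).congr fun d s hs => ?_
  have h2 := d.sqrt_W_mul_self hσ hs
  have h3 : 0 < √(d.W s) + σ := by linarith [Real.sqrt_nonneg (d.W s)]
  simp only [Pi.mul_apply, Pi.inv_apply, fV, fW, u]
  generalize √(d.W s) = q at *
  rw [← h2]
  field_simp
  ring

theorem symbolMem_u₀ (hσ : 0 < σ) (hk : 3 ≤ k) :
    SymbolMem (Bd k σ A) (k - 1) (fun d s => s ^ 3 * d.u₀ s) := by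
  have h1 := (symbolMem_sqrt_W hσ (symbolMem_W_top (A := A) hσ hk)).2.mono
    (by omega : k - 1 ≤ k)
  have h2 := ((symbolMem_V (A := A) hσ hk).mono (by omega : k - 1 ≤ k)).mul h1
  refine (((symbolMem_V₂ hσ hk).const_mul (1 / (2 * σ))).sub
    ((h2.mul h2).const_mul (1 / (2 * σ)))).congr fun d s hs => ?_
  have h2 := d.sqrt_W_mul_self hσ hs
  have h3 : 0 < √(d.W s) + σ := by linarith [Real.sqrt_nonneg (d.W s)]
  have hs0 := d.pos_of_lt hs
  simp only [Pi.mul_apply, Pi.sub_apply, Pi.inv_apply, fV, fV₂, fW, u, u₀]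
  generalize √(d.W s) = q at *
  rw [← h2]
  field_simp
  ring

theorem symbolMem_u₀_top (hσ : 0 < σ) (hk : 3 ≤ k) :
    SymbolMem (Bd k σ A) k (fun d s => s ^ 1 * d.u₀ s) := by
  have hc : SymbolMem (Bd k σ A) k (fun d _ => d.c / σ) := by
    -- the number `c` is controlled since `c = g 0` is the limit of `g ∘ y`
    have h0 : (fun d _ => d.c / σ) ∈ (Bd k σ A).alg := by
      obtain ⟨C, hC⟩ := symbolMem_η_zero (k := k) (A := A) hσ (by omega)
      refine ⟨(A + A * C) / σ, fun d s hs => ?_⟩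
      have h1 := d.γ_le 0 (by omega) s hs
      have h2 := d.γ_sub_le s hs
      have hA : 0 ≤ A := (abs_nonneg _).trans h1
      have h3 : A * ((s ^ 2)⁻¹ * |d.η s|) ≤ A * C := by
        have h5 : (s ^ 2)⁻¹ ≤ 1 :=
          inv_le_one_of_one_le₀ (one_le_pow₀ (d.one_le.trans hs.le))
        have h6 := hC d s hs
        have h7 : (s ^ 2)⁻¹ * |d.η s| ≤ 1 * C :=
          mul_le_mul h5 h6 (abs_nonneg _) zero_le_one
        exact mul_le_mul_of_nonneg_left (by linarith) hA
      rw [abs_div, abs_of_pos hσ]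
      gcongr
      have := abs_le.1 h1
      have := abs_le.1 (h2.trans h3)
      exact abs_le.2 ⟨by linarith, by linarith⟩
    have h1 : HasEuler dom (fun (d : RadialSol k σ A) _ => d.c / σ) 0 := fun d s _ =>
      ⟨differentiableAt_const _, by simp⟩
    obtain ⟨j, rfl⟩ : ∃ j, k = j + 1 := ⟨k - 1, by omega⟩
    exact .succ h0 h1 (.const 0)
  refine ((symbolMem_u hσ hk).sub hc).congr fun d s hs => ?_
  have hs0 := d.pos_of_lt hs
  simp only [Pi.sub_apply, u₀]
  field_simp

/-- Uniform weighted bounds for `u` and its remainder. -/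
theorem exists_bound (k : ℕ) (σ A : ℝ) (hσ : 0 < σ) (hk : 3 ≤ k) : ∃ C : ℝ, 0 ≤ C ∧
    ∀ (d : RadialSol k σ A) (s : ℝ), d.R < s →
      (∀ j ≤ k, |s ^ (1 + j) * iteratedDeriv j d.u s| ≤ C) ∧
      (∀ j < k, |s ^ (3 + j) * iteratedDeriv j d.u₀ s| ≤ C) ∧
      |s ^ (1 + k) * iteratedDeriv k d.u₀ s| ≤ C := by
  have hR : ∀ d : RadialSol k σ A, 0 ≤ dom d := fun d => zero_le_one.trans d.one_le
  choose! C₁ h1 using fun j (hj : j ≤ k) =>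
    ((symbolMem_u (A := A) hσ hk).iteratedDeriv hR 1 j hj).mem
  choose! C₂ h2 using fun j (hj : j ≤ k - 1) =>
    ((symbolMem_u₀ (A := A) hσ hk).iteratedDeriv hR 3 j hj).mem
  obtain ⟨C₃, h3⟩ := ((symbolMem_u₀_top (A := A) hσ hk).iteratedDeriv hR 1 k le_rfl).mem
  have hC1 : ∀ j ≤ k, C₁ j ≤ ∑ i ∈ Finset.range (k + 1), |C₁ i| := fun j hj =>
    (le_abs_self _).trans (Finset.single_le_sum (f := fun i => |C₁ i|)
      (fun i _ => abs_nonneg _) (Finset.mem_range.2 (by omega)))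
  have hC2 : ∀ j ≤ k, C₂ j ≤ ∑ i ∈ Finset.range (k + 1), |C₂ i| := fun j hj =>
    (le_abs_self _).trans (Finset.single_le_sum (f := fun i => |C₂ i|)
      (fun i _ => abs_nonneg _) (Finset.mem_range.2 (by omega)))
  have e1 : 0 ≤ ∑ i ∈ Finset.range (k + 1), |C₁ i| := Finset.sum_nonneg fun i _ => abs_nonneg _
  have e2 : 0 ≤ ∑ i ∈ Finset.range (k + 1), |C₂ i| := Finset.sum_nonneg fun i _ => abs_nonneg _
  have e3 := le_abs_self C₃
  have e4 := abs_nonneg C₃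
  refine ⟨∑ i ∈ Finset.range (k + 1), |C₁ i| + ∑ i ∈ Finset.range (k + 1), |C₂ i| + |C₃|,
    by positivity, fun d s hs => ⟨fun j hj => ?_, fun j hj => ?_, ?_⟩⟩
  · linarith [h1 j hj d s hs, hC1 j hj]
  · linarith [h2 j (by omega) d s hs, hC2 j (by omega)]
  · linarith [h3 d s hs]

theorem contDiffOn_W (hσ : 0 < σ) (d : RadialSol k σ A) : ContDiffOn ℝ k d.W (Ioi d.R) := by
  have h := (symbolMem_γ_zero_W (J := k + 1) hσ (bd_le_po xi_mem) (bd_le_po W_mem)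
    (bd_le_po (W_inv_mem hσ)) (bd_le_po (γ_mem 0 (Nat.zero_le _)))
    (symbolMem_poly (k := k) (A := A) hσ k le_rfl).2).2
  exact h.succ_le.contDiffOn (fun d => zero_le_one.trans d.one_le) d

theorem contDiffOn_u (hσ : 0 < σ) (d : RadialSol k σ A) : ContDiffOn ℝ k d.u (Ioi d.R) :=
  contDiffOn_id.mul (((d.contDiffOn_W hσ).sqrt fun _ hs => (d.W_pos hσ hs).ne').sub
    contDiffOn_const)

theorem contDiffOn_u₀ (hσ : 0 < σ) (d : RadialSol k σ A) : ContDiffOn ℝ k d.u₀ (Ioi d.R) := by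
  refine (d.contDiffOn_u hσ).sub ?_
  refine (contDiffOn_const_div (c := d.c / σ) (zero_le_one.trans d.one_le)).congr fun s _ => ?_
  rw [div_div]

/-- The slope `∂ₛr` of the radius function `r = s √W`. -/
noncomputable def slope (d : RadialSol k σ A) (s : ℝ) : ℝ :=
  √(d.W s) - 2 * ((s ^ 2)⁻¹ * d.γ 0 s) / √(d.W s)

theorem hasDerivAt_sqrt_W (hσ : 0 < σ) (d : RadialSol k σ A) {s : ℝ} (hs : d.R < s) :
    HasDerivAt (fun s => √(d.W s)) (-2 * ((s ^ 2)⁻¹ * d.γ 0 s) / √(d.W s) / s) s := by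
  have hs0 := d.pos_of_lt hs
  have hq : 0 < √(d.W s) := Real.sqrt_pos.2 (d.W_pos hσ hs)
  refine ((d.hW s hs).sqrt (d.W_pos hσ hs).ne').congr_deriv ?_
  field_simp; norm_num
  ring

theorem hasDerivAt_u (hσ : 0 < σ) (d : RadialSol k σ A) {s : ℝ} (hs : d.R < s) :
    HasDerivAt d.u (d.slope s - σ) s := by
  have hs0 := d.pos_of_lt hs
  have hq : 0 < √(d.W s) := Real.sqrt_pos.2 (d.W_pos hσ hs)
  refine ((hasDerivAt_id s).mul ((d.hasDerivAt_sqrt_W hσ hs).sub_const σ)).congr_deriv ?_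
  simp only [slope, id]
  field_simp; ring

theorem one_add_slope_sq (hσ : 0 < σ) (d : RadialSol k σ A) {s : ℝ} (hs : d.R < s) :
    1 + d.slope s ^ 2 = 2 * halfSlope (d.γ 0 s) (d.W s) s := by
  have hs0 := d.pos_of_lt hs
  have hq : 0 < √(d.W s) := Real.sqrt_pos.2 (d.W_pos hσ hs)
  have h2 := d.sqrt_W_mul_self hσ hs
  simp only [slope, halfSlope]
  generalize √(d.W s) = q at *
  rw [← h2]
  field_simp

/-- The equation `r ∂ₛ²r = -(1 + (∂ₛr)²) y`. -/
theorem hasDerivAt_slope (hσ : 0 < σ) (d : RadialSol k σ A) {s : ℝ} (hs : d.R < s) :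
    HasDerivAt d.slope (-(1 + d.slope s ^ 2) * (d.η s / s ^ 2) / (s * √(d.W s))) s := by
  have hs0 := d.pos_of_lt hs
  have hq : 0 < √(d.W s) := Real.sqrt_pos.2 (d.W_pos hσ hs)
  have h1 := d.hasDerivAt_sqrt_W hσ hs
  have h3 := d.hγ 0 (Nat.zero_le _) s hs
  have h4 := hasDerivAt_div_pow 1 2 hs0.ne'
  have h5 : HasDerivAt d.slope _ s :=
    h1.sub ((((h4.congr_of_eventuallyEq (f₁ := fun s : ℝ => (s ^ 2)⁻¹)
      (Eventually.of_forall fun t => by simp)).mul h3).const_mul 2).div h1 hq.ne')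
  refine h5.congr_deriv ?_
  have h6 := d.Z_eq s hs
  have h7 := d.sqrt_W_mul_self hσ hs
  rw [d.one_add_slope_sq hσ hs]
  have h8 : (d.γ (0 + 1) s * ((s ^ 2)⁻¹ * d.Z s) / s) =
      (forcing (d.γ 0 s) (d.W s) s + halfSlope (d.γ 0 s) (d.W s) s * d.η s) / s := by
    rw [← h6]; ring
  rw [h8]
  simp only [forcing, Pi.mul_apply]
  generalize halfSlope (d.γ 0 s) (d.W s) s = β
  generalize √(d.W s) = q at *
  rw [← h7]
  field_simp
  push_cast
  ring

theorem dd_u (hσ : 0 < σ) (d : RadialSol k σ A) {R : ℝ} (hR : d.R < R) {j : ℕ} (hj : j ≤ k)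
    {s : ℝ} (hs : R ≤ s) : dd R j d.u s = iteratedDeriv j d.u s :=
  dd_eq_iteratedDeriv hR (d.contDiffOn_u hσ) hj hs

theorem iteratedDeriv_one_u (hσ : 0 < σ) (d : RadialSol k σ A) {s : ℝ} (hs : d.R < s) :
    iteratedDeriv 1 d.u s = d.slope s - σ := by
  rw [iteratedDeriv_one]; exact (d.hasDerivAt_u hσ hs).deriv

theorem iteratedDeriv_two_u (hσ : 0 < σ) (d : RadialSol k σ A) {s : ℝ} (hs : d.R < s) :
    iteratedDeriv 2 d.u s = -(1 + d.slope s ^ 2) * (d.η s / s ^ 2) / (s * √(d.W s)) := by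
  rw [iteratedDeriv_succ, iteratedDeriv_one]
  have h : deriv d.u =ᶠ[𝓝 s] fun s => d.slope s - σ :=
    (eventually_gt_nhds hs).mono fun t ht => (d.hasDerivAt_u hσ ht).deriv
  rw [h.deriv_eq]
  exact ((d.hasDerivAt_slope hσ hs).sub_const σ).deriv

end RadialSol

/-! ### Global solutions of ordinary differential equations and limits of solutions -/

section ODE

variable {E : Type*} [NormedAddCommGroup E] [NormedSpace ℝ E]

/-- A time-dependent vector field on `[R, ∞) × E` that is continuous in time and, on bounded time
intervals, bounded and uniformly Lipschitz. -/
def TameField (R : ℝ) (v : ℝ → E → E) : Prop :=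
  (∀ x, ContinuousOn (fun t => v t x) (Ici R)) ∧
    ∀ b, ∃ K L : ℝ≥0, ∀ t ∈ Icc R b, LipschitzWith K (v t) ∧ ∀ x, ‖v t x‖ ≤ L

variable {R : ℝ} {v : ℝ → E → E}

/-- Tame fields have solutions in both directions of time (Picard–Lindelöf). -/
theorem TameField.exists_solution [CompleteSpace E] (hv : TameField R v) {b t₀ : ℝ}
    (ht₀ : t₀ ∈ Icc R b) (x₀ : E) :
    ∃ X : ℝ → E, X t₀ = x₀ ∧ ∀ t ∈ Icc R b, HasDerivWithinAt X (v t (X t)) (Icc R b) t := by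
  obtain ⟨hc, hb⟩ := hv
  obtain ⟨K, L, h⟩ := hb b
  have hPL : IsPicardLindelof v (⟨t₀, ht₀⟩ : Icc R b) x₀
      (L * (max (b - t₀) (t₀ - R)).toNNReal) 0 L K :=
    { lipschitzOnWith := fun t ht => (h t ht).1.lipschitzOnWith
      continuousOn := fun x _ => (hc x).mono Icc_subset_Ici_self
      norm_le := fun t ht x _ => (h t ht).2 x
      mul_max_le := by
        have : 0 ≤ max (b - t₀) (t₀ - R) := le_max_of_le_left (sub_nonneg.2 ht₀.2)
        simp [Real.coe_toNNReal _ this] }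
  exact hPL.exists_eq_forall_mem_Icc_hasDerivWithinAt₀

/-- Grönwall's inequality for two solutions that may live on different intervals. -/
theorem dist_le_of_solutions {b : ℝ} {K : ℝ≥0}
    (h : ∀ t ∈ Icc R b, LipschitzWith K (v t)) {X Y : ℝ → E} {b₁ b₂ : ℝ}
    (hb₁ : b ≤ b₁) (hb₂ : b ≤ b₂)
    (hX : ∀ t ∈ Icc R b₁, HasDerivWithinAt X (v t (X t)) (Icc R b₁) t)
    (hY : ∀ t ∈ Icc R b₂, HasDerivWithinAt Y (v t (Y t)) (Icc R b₂) t) {t : ℝ}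
    (ht : t ∈ Icc R b) : dist (X t) (Y t) ≤ dist (X R) (Y R) * Real.exp (K * (t - R)) := by
  have aux : ∀ {X : ℝ → E} {b₁ : ℝ}, b ≤ b₁ →
      (∀ t ∈ Icc R b₁, HasDerivWithinAt X (v t (X t)) (Icc R b₁) t) →
      ContinuousOn X (Icc R b) ∧ ∀ t ∈ Ico R b, HasDerivWithinAt X (v t (X t)) (Ici t) t := by
    intro X b₁ hb hX
    refine ⟨fun t ht => ((hX t ⟨ht.1, ht.2.trans hb⟩).continuousWithinAt).mono
      (Icc_subset_Icc_right hb), fun t ht => ?_⟩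
    exact (hX t ⟨ht.1, ht.2.le.trans hb⟩).mono_of_mem_nhdsWithin
      (mem_of_superset (Icc_mem_nhdsGE (ht.2.trans_le hb)) (Icc_subset_Icc_left ht.1))
  exact dist_le_of_trajectories_ODE_of_mem (s := fun _ => univ)
    (fun t ht => (h t (Ico_subset_Icc_self ht)).lipschitzOnWith) (aux hb₁ hX).1 (aux hb₁ hX).2
    (fun _ _ => trivial) (aux hb₂ hY).1 (aux hb₂ hY).2 (fun _ _ => trivial) le_rfl t ht

/-- Solutions on longer and longer intervals with bounded initial values converge, along a
subsequence, to a solution on the half-line. -/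
theorem TameField.exists_limit [ProperSpace E] [CompleteSpace E] (hv : TameField R v)
    {X : ℕ → ℝ → E}
    (hX : ∀ n : ℕ, ∀ t ∈ Icc R (R + n), HasDerivWithinAt (X n) (v t (X n t)) (Icc R (R + n)) t)
    (hbdd : Bornology.IsBounded (range fun n => X n R)) :
    ∃ (φ : ℕ → ℕ) (Y : ℝ → E), StrictMono φ ∧ (∀ t, R < t → HasDerivAt Y (v t (Y t)) t) ∧
      ∀ t, R ≤ t → Tendsto (fun n => X (φ n) t) atTop (𝓝 (Y t)) := by
  obtain ⟨x₀, -, φ, hφ, hlim⟩ := tendsto_subseq_of_bounded hbdd (fun n => mem_range_self n)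
  have hex : ∀ m : ℕ, ∃ Z : ℝ → E, Z R = x₀ ∧
      ∀ t ∈ Icc R (R + m), HasDerivWithinAt Z (v t (Z t)) (Icc R (R + m)) t := fun m =>
    hv.exists_solution (left_mem_Icc.2 (by simp)) x₀
  choose Z hZ0 hZ using hex
  have hconv : ∀ (m : ℕ) t, t ∈ Icc R (R + m) →
      Tendsto (fun n => X (φ n) t) atTop (𝓝 (Z m t)) := by
    intro m t ht
    obtain ⟨K, L, h⟩ := hv.2 (R + m)
    rw [tendsto_iff_dist_tendsto_zero]
    have h1 : Tendsto (fun n => dist (X (φ n) R) x₀ * Real.exp (K * (t - R))) atTop (𝓝 0) := by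
      simpa using (tendsto_iff_dist_tendsto_zero.1 hlim).mul_const (Real.exp (K * (t - R)))
    refine squeeze_zero' (Eventually.of_forall fun n => dist_nonneg) ?_ h1
    filter_upwards [eventually_ge_atTop m] with n hn
    have hmn : (m : ℝ) ≤ φ n := by exact_mod_cast hn.trans (hφ.id_le n)
    have := dist_le_of_solutions (fun t ht => (h t ht).1) (by linarith : R + m ≤ R + φ n)
      le_rfl (hX (φ n)) (hZ m) ht
    rwa [hZ0] at this
  have hmem : ∀ t, R ≤ t → t ∈ Icc R (R + (⌈t - R⌉₊ : ℕ)) := fun t ht =>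
    ⟨ht, by linarith [Nat.le_ceil (t - R)]⟩
  refine ⟨φ, fun t => Z ⌈t - R⌉₊ t, hφ, fun t ht => ?_, fun t ht => hconv _ _ (hmem t ht)⟩
  have heq : ∀ (m : ℕ) t, t ∈ Icc R (R + m) → Z ⌈t - R⌉₊ t = Z m t := fun m t ht =>
    tendsto_nhds_unique (hconv _ _ (hmem t ht.1)) (hconv m t ht)
  set m := ⌈t - R⌉₊ + 1 with hm
  have ht' : t < R + m := by
    have := Nat.le_ceil (t - R); push_cast [hm]; linarith
  have h1 := (hZ m t ⟨ht.le, ht'.le⟩).hasDerivAt (Icc_mem_nhds ht ht')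
  rw [← heq m t ⟨ht.le, ht'.le⟩] at h1
  exact h1.congr_of_eventuallyEq
    (mem_of_superset (Icc_mem_nhds ht ht') fun τ hτ => heq m τ hτ)

/-- The vector field obtained from a `C¹` field on a compact box by clamping the space variables
to the box is tame. -/
theorem tameField_clamp {R : ℝ} {V : ℝ × ℝ × ℝ → ℝ × ℝ} {l₁ u₁ l₂ u₂ : ℝ} (h₁ : l₁ ≤ u₁)
    (h₂ : l₂ ≤ u₂) (hV : ContDiffOn ℝ 1 V (Ici R ×ˢ Icc l₁ u₁ ×ˢ Icc l₂ u₂)) :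
    TameField R (fun t x => V (t, max l₁ (min u₁ x.1), max l₂ (min u₂ x.2))) := by
  have hcl : ∀ {l u : ℝ}, l ≤ u → ∀ x, max l (min u x) ∈ Icc l u := fun h x =>
    ⟨le_max_left _ _, max_le h (min_le_left _ _)⟩
  refine ⟨fun x => hV.continuousOn.comp (by fun_prop) fun t ht =>
    ⟨ht, hcl h₁ _, hcl h₂ _⟩, fun b => ?_⟩
  set S : Set (ℝ × ℝ × ℝ) := Icc R b ×ˢ Icc l₁ u₁ ×ˢ Icc l₂ u₂
  have hS : IsCompact S := isCompact_Icc.prod (isCompact_Icc.prod isCompact_Icc)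
  have hVS : ContDiffOn ℝ 1 V S := hV.mono (prod_mono_left Icc_subset_Ici_self)
  obtain ⟨K, hK⟩ := hVS.exists_lipschitzOnWith one_ne_zero
    ((convex_Icc _ _).prod ((convex_Icc _ _).prod (convex_Icc _ _))) hS
  obtain ⟨L, hL⟩ := hS.exists_bound_of_continuousOn hVS.continuousOn
  refine ⟨K, L.toNNReal, fun t ht => ⟨?_, fun x => (hL _ ⟨ht, hcl h₁ _, hcl h₂ _⟩).trans
    (Real.le_coe_toNNReal L)⟩⟩
  have hclL : LipschitzWith 1 fun x : ℝ × ℝ =>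
      ((t, max l₁ (min u₁ x.1), max l₂ (min u₂ x.2)) : ℝ × ℝ × ℝ) := by
    have e1 : LipschitzWith 1 fun x : ℝ × ℝ => max l₁ (min u₁ x.1) :=
      (LipschitzWith.prod_fst.const_min u₁).const_max l₁
    have e2 : LipschitzWith 1 fun x : ℝ × ℝ => max l₂ (min u₂ x.2) :=
      (LipschitzWith.prod_snd.const_min u₂).const_max l₂
    simpa using (LipschitzWith.const t).prodMk (e1.prodMk e2)
  have := hK.comp (hclL.lipschitzOnWith (s := univ)) fun x _ => ⟨ht, hcl h₁ _, hcl h₂ _⟩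
  rw [mul_one] at this
  exact lipschitzOnWith_univ.1 this

end ODE

/-! ### Existence for the first-order system -/

/-- A function that can leave the interval `(-M, M)` but not enter it, and that ends inside,
starts inside. -/
theorem abs_lt_of_deriv_at_level {a b M : ℝ} {f : ℝ → ℝ} (hab : a ≤ b)
    (hf : ContinuousOn f (Icc a b)) (hb : |f b| < M)
    (hM : ∀ s ∈ Ico a b, |f s| = M → ∃ f', 0 < f s * f' ∧ HasDerivWithinAt f f' (Ici s) s) :
    |f a| < M := by
  have hM0 : 0 < M := (abs_nonneg _).trans_lt hb
  refine abs_lt.2 ⟨?_, ?_⟩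
  · have := lt_of_deriv_pos_at_level (f := fun s => -f s) hab hf.neg
      (by linarith [(abs_lt.1 hb).1]) fun s hs hs2 => ?_
    · linarith
    · obtain ⟨f', h1, h2⟩ := hM s hs (by rw [abs_of_neg (by linarith)]; exact hs2)
      exact ⟨-f', by nlinarith, h2.neg⟩
  · refine lt_of_deriv_pos_at_level hab hf (abs_lt.1 hb).2 fun s hs hs2 => ?_
    obtain ⟨f', h1, h2⟩ := hM s hs (by rw [hs2, abs_of_pos hM0])
    rw [hs2] at h1
    exact ⟨f', (pos_iff_pos_of_mul_pos h1).1 hM0, h2⟩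

theorem abs_forcing_le {g W s B w : ℝ} (hw : 0 < w) (hW : w ≤ W) (hg : |g| ≤ B)
    (hs : (s ^ 2)⁻¹ * (2 * B) ≤ w) : |forcing g W s| ≤ 2 * B := by
  have hW0 : 0 < W := hw.trans_le hW
  have h0 : 0 ≤ (s ^ 2)⁻¹ := by positivity
  have h1 : |2 * (s ^ 2)⁻¹ * g * W⁻¹| ≤ 1 := by
    rw [abs_mul, abs_mul, abs_mul, abs_of_pos (inv_pos.2 hW0), abs_of_nonneg h0, abs_two,
      ← div_eq_mul_inv, div_le_one hW0]
    nlinarith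
  have h2 : |1 - 2 * (s ^ 2)⁻¹ * g * W⁻¹| ≤ 2 := by
    have := abs_le.1 h1
    exact abs_le.2 ⟨by linarith, by linarith⟩
  have hB : 0 ≤ B := (abs_nonneg _).trans hg
  rw [forcing, abs_mul, mul_comm 2 B]
  exact mul_le_mul hg h2 (abs_nonneg _) hB

/-- The right-hand side of the first-order system for `(W, y)`; `G 0` and `G 1` are `g` and
`g'`. -/
noncomputable def radialField (G : ℕ → ℝ → ℝ) (x : ℝ × ℝ × ℝ) : ℝ × ℝ :=
  (-4 * ((x.1 ^ 2)⁻¹ * G 0 x.2.2) / x.1,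
    (forcing (G 0 x.2.2) x.2.1 x.1 + halfSlope (G 0 x.2.2) x.2.1 x.1 * (x.1 ^ 2 * x.2.2))
      / (x.1 * G 1 x.2.2))

theorem contDiffOn_of_hasDerivAt {G : ℕ → ℝ → ℝ} {δ : ℝ} {l : ℕ}
    (hG : ∀ i ≤ l + 1, ∀ y ∈ Ioo (-δ) δ, HasDerivAt (G i) (G (i + 1) y) y) :
    ContDiffOn ℝ 1 (G l) (Ioo (-δ) δ) := by
  have : (1 : WithTop ℕ∞) = 0 + 1 := by norm_num
  rw [this, contDiffOn_succ_iff_deriv_of_isOpen isOpen_Ioo]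
  refine ⟨fun y hy => (hG l (by omega) y hy).differentiableAt.differentiableWithinAt, by simp, ?_⟩
  refine contDiffOn_zero.2 (ContinuousOn.congr (f := G (l + 1)) (fun y hy =>
    (hG (l + 1) le_rfl y hy).continuousAt.continuousWithinAt) fun y hy => ?_)
  exact (hG l (by omega) y hy).deriv

theorem contDiffOn_radialField {G : ℕ → ℝ → ℝ} {δ R l₁ u₁ : ℝ} (hδ : 0 < δ) (hR : 0 < R)
    (hl : 0 < l₁) (hG : ∀ i ≤ 2, ∀ y ∈ Ioo (-δ) δ, HasDerivAt (G i) (G (i + 1) y) y)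
    (hpos : ∀ y ∈ Ioo (-δ) δ, 0 < G 1 y) :
    ContDiffOn ℝ 1 (radialField G) (Ici R ×ˢ Icc l₁ u₁ ×ˢ Icc (-(δ / 2)) (δ / 2)) := by
  have hsub : ∀ x ∈ Ici R ×ˢ Icc l₁ u₁ ×ˢ Icc (-(δ / 2)) (δ / 2), x.2.2 ∈ Ioo (-δ) δ := by
    rintro x ⟨-, -, h⟩
    exact ⟨by linarith [h.1], by linarith [h.2]⟩
  have h0 : ContDiffOn ℝ 1 (fun x : ℝ × ℝ × ℝ => G 0 x.2.2)
      (Ici R ×ˢ Icc l₁ u₁ ×ˢ Icc (-(δ / 2)) (δ / 2)) :=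
    (contDiffOn_of_hasDerivAt fun i hi => hG i (by omega)).comp (by fun_prop) hsub
  have h1 : ContDiffOn ℝ 1 (fun x : ℝ × ℝ × ℝ => G 1 x.2.2)
      (Ici R ×ˢ Icc l₁ u₁ ×ˢ Icc (-(δ / 2)) (δ / 2)) :=
    (contDiffOn_of_hasDerivAt fun i hi => hG i (by omega)).comp (by fun_prop) hsub
  have hs : ContDiffOn ℝ 1 (fun x : ℝ × ℝ × ℝ => x.1)
      (Ici R ×ˢ Icc l₁ u₁ ×ˢ Icc (-(δ / 2)) (δ / 2)) := by fun_prop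
  have hW : ContDiffOn ℝ 1 (fun x : ℝ × ℝ × ℝ => x.2.1)
      (Ici R ×ˢ Icc l₁ u₁ ×ˢ Icc (-(δ / 2)) (δ / 2)) := by fun_prop
  have hy : ContDiffOn ℝ 1 (fun x : ℝ × ℝ × ℝ => x.2.2)
      (Ici R ×ˢ Icc l₁ u₁ ×ˢ Icc (-(δ / 2)) (δ / 2)) := by fun_prop
  have hs0 : ∀ x ∈ Ici R ×ˢ Icc l₁ u₁ ×ˢ Icc (-(δ / 2)) (δ / 2), x.1 ≠ 0 := fun x hx =>
    (hR.trans_le hx.1).ne'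
  have hξ := (hs.pow 2).inv fun x hx => pow_ne_zero 2 (hs0 x hx)
  have hWi := hW.inv fun x hx => (hl.trans_le hx.2.1.1).ne'
  refine ContDiffOn.prodMk ((contDiffOn_const.mul (hξ.mul h0)).div hs hs0) ?_
  refine ContDiffOn.div (ContDiffOn.add ?_ (ContDiffOn.mul ?_ ((hs.pow 2).mul hy))) (hs.mul h1)
    fun x hx => mul_ne_zero (hs0 x hx) (hpos _ (hsub x hx)).ne'
  · exact h0.mul (contDiffOn_const.sub (((contDiffOn_const.mul hξ).mul h0).mul hWi))
  · exact (contDiffOn_const.add (((hW.sub ((contDiffOn_const.mul hξ).mul h0)).pow 2).mul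
      hWi)).div_const 2

/-- Existence for the first-order system with a priori bounds. Solutions that start at `s = N` on
the cone are continued towards smaller `s`, in which direction the region `|s² y| < M` cannot be
left, for `M = 4 B + 1`, since `|Γ| ≤ 2 B` and `β ≥ 1/2`; then `N → ∞`. The radius `R`
is only subject to explicit lower bounds, and a lower bound of `g'` does not enter. -/
theorem exists_solution_W_y {σ B δ R : ℝ} (hσ : 0 < σ) (hB : 0 ≤ B) (hδ : 0 < δ) (hR : 1 ≤ R)
    (hRδ : (R ^ 2)⁻¹ * (4 * B + 1) ≤ δ / 2) (hRσ : (R ^ 2)⁻¹ * (2 * (B + 1)) ≤ σ ^ 2 / 2)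
    {G : ℕ → ℝ → ℝ} (hG : ∀ i ≤ 2, ∀ y ∈ Ioo (-δ) δ, HasDerivAt (G i) (G (i + 1) y) y)
    (hpos : ∀ y ∈ Ioo (-δ) δ, 0 < G 1 y) (hGB : ∀ y ∈ Ioo (-δ) δ, |G 0 y| ≤ B) :
    ∃ X : ℝ → ℝ × ℝ, ∀ s, R < s → HasDerivAt X (radialField G (s, X s)) s ∧
      |(X s).1 - σ ^ 2| ≤ 2 * (B + 1) / s ^ 2 ∧ |s ^ 2 * (X s).2| ≤ 4 * B + 1 := by
  have hR0 : 0 < R := by linarith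
  have hσ2 : 0 < σ ^ 2 := by positivity
  set cW : ℝ → ℝ := fun w => max (σ ^ 2 / 2) (min (3 * σ ^ 2 / 2) w) with hcW
  set cy : ℝ → ℝ := fun y => max (-(δ / 2)) (min (δ / 2) y) with hcy
  have hcWm : ∀ w, cW w ∈ Icc (σ ^ 2 / 2) (3 * σ ^ 2 / 2) := fun w =>
    ⟨le_max_left _ _, max_le (by linarith) (min_le_left _ _)⟩
  have hcym : ∀ y, cy y ∈ Ioo (-δ) δ := fun y =>
    ⟨lt_of_lt_of_le (by linarith) (le_max_left _ _),
      max_lt (by linarith) (lt_of_le_of_lt (min_le_left _ _) (by linarith))⟩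
  have hcW_id : ∀ w, |w - σ ^ 2| ≤ σ ^ 2 / 2 → cW w = w := fun w hw => by
    have := abs_le.1 hw
    simp only [hcW]
    rw [min_eq_right (by linarith), max_eq_right (by linarith)]
  have hcy_id : ∀ y, |y| ≤ δ / 2 → cy y = y := fun y hy => by
    have := abs_le.1 hy
    simp only [hcy]
    rw [min_eq_right (by linarith), max_eq_right (by linarith)]
  have hξ : ∀ s, R ≤ s → (s ^ 2)⁻¹ ≤ (R ^ 2)⁻¹ := fun s hs =>
    inv_anti₀ (by positivity) (by gcongr)
  -- the clamped field is globally defined and Lipschitz; the bounds below make the clamping void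
  set v : ℝ → ℝ × ℝ → ℝ × ℝ := fun t x => radialField G (t, cW x.1, cy x.2) with hv
  have htame : TameField R v :=
    tameField_clamp (by linarith) (by linarith)
      (contDiffOn_radialField hδ hR0 (by linarith) hG hpos)
  have hex : ∀ n : ℕ, ∃ X : ℝ → ℝ × ℝ, X (R + n) = (σ ^ 2, 0) ∧
      ∀ t ∈ Icc R (R + n), HasDerivWithinAt X (v t (X t)) (Icc R (R + n)) t := fun n =>
    htame.exists_solution (right_mem_Icc.2 (by simp)) _
  choose X hX0 hX using hex
  have hXd : ∀ n : ℕ, ∀ t ∈ Ico R (R + n), HasDerivWithinAt (X n) (v t (X n t)) (Ici t) t :=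
    fun n t ht => (hX n t ⟨ht.1, ht.2.le⟩).mono_of_mem_nhdsWithin
      (mem_of_superset (Icc_mem_nhdsGE ht.2) (Icc_subset_Icc_left ht.1))
  have hXc : ∀ n : ℕ, ContinuousOn (X n) (Icc R (R + n)) :=
    fun n t ht => (hX n t ht).continuousWithinAt
  -- the a priori bounds on `[R, N]`
  have hW : ∀ n : ℕ, ∀ t ∈ Icc R (R + n), |(X n t).1 - σ ^ 2| ≤ 2 * (B + 1) / t ^ 2 := by
    intro n t ht
    have hsub : Icc t (R + n) ⊆ Icc R (R + n) := Icc_subset_Icc_left ht.1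
    have key : ∀ ε : ℝ, |ε| = 1 → ε * ((X n t).1 - σ ^ 2) - 2 * (B + 1) / t ^ 2 < 0 := by
      intro ε hε
      have hN : 0 < R + n := by positivity
      refine lt_of_deriv_pos_at_level
        (f := fun t => ε * ((X n t).1 - σ ^ 2) - 2 * (B + 1) / t ^ 2) ht.2 ?_ ?_ ?_
      · refine ContinuousOn.sub (continuousOn_const.mul
          ((continuous_fst.comp_continuousOn ((hXc n).mono hsub)).sub continuousOn_const)) ?_
        exact continuousOn_const.div (by fun_prop) fun s hs =>
          pow_ne_zero 2 (hR0.trans_le (ht.1.trans hs.1)).ne'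
      · simp only [hX0, sub_self, mul_zero, zero_sub, neg_lt_zero]; positivity
      · intro s hs _
        have hs0 : 0 < s := hR0.trans_le (ht.1.trans hs.1)
        have h1 : HasDerivWithinAt (fun t => (X n t).1) (v s (X n s)).1 (Ici s) s := by
          simpa using (hXd n s ⟨ht.1.trans hs.1, hs.2⟩).hasFDerivWithinAt.fst.hasDerivWithinAt
        have h2 := (((h1.sub_const (σ ^ 2)).const_mul ε).sub
          (hasDerivAt_div_pow (2 * (B + 1)) 2 hs0.ne').hasDerivWithinAt)
        refine ⟨_, ?_, h2⟩
        simp only [hv, radialField]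
        set q := G 0 (cy (X n s).2)
        have hq : |ε * q| ≤ B := by rw [abs_mul, hε, one_mul]; exact hGB _ (hcym _)
        have h3 : ε * (-4 * ((s ^ 2)⁻¹ * q) / s)
            - -((2 : ℕ) * (2 * (B + 1)) / s ^ (2 + 1)) = 4 * (B + 1 - ε * q) / s ^ 3 := by
          field_simp; push_cast; ring
        rw [h3]
        have := (abs_le.1 hq).2
        have : 0 < B + 1 - ε * q := by linarith
        positivity
    have h1 := key 1 (by simp)
    have h2 := key (-1) (by simp)
    exact abs_le.2 ⟨by linarith, by linarith⟩
  have hy : ∀ n : ℕ, ∀ t ∈ Icc R (R + n), |t ^ 2 * (X n t).2| < 4 * B + 1 := by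
    intro n t ht
    have hsub : Icc t (R + n) ⊆ Icc R (R + n) := Icc_subset_Icc_left ht.1
    refine abs_lt_of_deriv_at_level (f := fun t => t ^ 2 * (X n t).2) ht.2 ?_ ?_ ?_
    · exact (by fun_prop : ContinuousOn (fun t : ℝ => t ^ 2) _).mul
        (continuous_snd.comp_continuousOn ((hXc n).mono hsub))
    · simp only [hX0, mul_zero, abs_zero]; linarith
    · intro s hs hs2
      have hRs : R ≤ s := ht.1.trans hs.1
      have hs0 : 0 < s := hR0.trans_le hRs
      have h1 : HasDerivWithinAt (fun t => (X n t).2) (v s (X n s)).2 (Ici s) s := by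
        simpa using (hXd n s ⟨hRs, hs.2⟩).hasFDerivWithinAt.snd.hasDerivWithinAt
      refine ⟨_, ?_, (hasDerivAt_pow 2 s).hasDerivWithinAt.mul h1⟩
      set y := (X n s).2 with hydef
      have hyle : |y| ≤ δ / 2 := by
        have : |y| = (s ^ 2)⁻¹ * (4 * B + 1) := by
          rw [← hs2, abs_mul, abs_of_pos (by positivity : 0 < s ^ 2)]; field_simp
        rw [this]
        exact (mul_le_mul_of_nonneg_right (hξ s hRs) (by linarith)).trans hRδ
      have hyc := hcy_id y hyle
      have hym : y ∈ Ioo (-δ) δ := hyc ▸ hcym y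
      simp only [hv, radialField, ← hydef, hyc]
      set w := cW (X n s).1
      have hw := hcWm (X n s).1
      have hf := abs_forcing_le (g := G 0 y) (W := w) (s := s) (by linarith : 0 < σ ^ 2 / 2) hw.1
        (hGB y hym)
        (by
          have := mul_le_mul_of_nonneg_right (hξ s hRs) (by linarith : 0 ≤ 2 * (B + 1))
          have h0 : 0 ≤ (s ^ 2)⁻¹ := by positivity
          nlinarith)
      have hβ := half_le_halfSlope (g := G 0 y) (W := w) (s := s) (by linarith [hw.1])
      set Γ := forcing (G 0 y) w s
      set β := halfSlope (G 0 y) w s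
      have hg1 := hpos y hym
      have hη2 : (s ^ 2 * y) ^ 2 = (4 * B + 1) ^ 2 := by rw [← sq_abs, hs2]
      have hηΓ : -((4 * B + 1) * (2 * B)) ≤ (s ^ 2 * y) * Γ := by
        have : |(s ^ 2 * y) * Γ| ≤ (4 * B + 1) * (2 * B) := by
          rw [abs_mul, hs2]; exact mul_le_mul_of_nonneg_left hf (by linarith)
        exact (abs_le.1 this).1
      have hnum : 0 < (s ^ 2 * y) * (Γ + β * (s ^ 2 * y)) := by nlinarith
      have h2 : s ^ 2 * y * ((2 : ℕ) * s ^ (2 - 1) * y + s ^ 2 * ((Γ + β * (s ^ 2 * y)) / (s * G 1 y)))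
          = 2 * s ^ 3 * y ^ 2 + s * ((s ^ 2 * y) * (Γ + β * (s ^ 2 * y))) / G 1 y := by
        field_simp; push_cast; ring
      rw [h2]
      have : 0 < s * ((s ^ 2 * y) * (Γ + β * (s ^ 2 * y))) / G 1 y := by positivity
      positivity
  obtain ⟨φ, Y, hφ, hYd, hYl⟩ := htame.exists_limit hX (by
    refine Metric.isBounded_closedBall (x := (0 : ℝ × ℝ)) (r := σ ^ 2 + 2 * (B + 1) + (4 * B + 1))
      |>.subset ?_
    rintro _ ⟨n, rfl⟩
    have hm : R ∈ Icc R (R + (n : ℝ)) := left_mem_Icc.2 (by simp)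
    have h1 := hW n R hm
    have h2 := hy n R hm
    have hR2 : 1 ≤ R ^ 2 := one_le_pow₀ hR
    have h3 : 2 * (B + 1) / R ^ 2 ≤ 2 * (B + 1) := div_le_self (by linarith) hR2
    have h4 : |(X n R).2| ≤ |R ^ 2 * (X n R).2| := by
      rw [abs_mul, abs_of_pos (by positivity : 0 < R ^ 2)]
      exact le_mul_of_one_le_left (abs_nonneg _) hR2
    rw [mem_closedBall_zero_iff, Prod.norm_def, Real.norm_eq_abs, Real.norm_eq_abs]
    have h5 := abs_le.1 (h1.trans h3)
    exact max_le (abs_le.2 ⟨by linarith, by linarith⟩) (by linarith))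
  have hWl : ∀ s, R < s → |(Y s).1 - σ ^ 2| ≤ 2 * (B + 1) / s ^ 2 := by
    intro s hs
    refine le_of_tendsto (((continuous_fst.tendsto _).comp (hYl s hs.le)).sub_const _).abs ?_
    obtain ⟨n₀, hn₀⟩ := exists_nat_ge (s - R)
    filter_upwards [eventually_ge_atTop n₀] with n hn
    have : (n₀ : ℝ) ≤ φ n := by exact_mod_cast hn.trans (hφ.id_le n)
    exact hW (φ n) s ⟨hs.le, by linarith⟩
  have hyl : ∀ s, R < s → |s ^ 2 * (Y s).2| ≤ 4 * B + 1 := by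
    intro s hs
    refine le_of_tendsto (((continuous_snd.tendsto _).comp (hYl s hs.le)).const_mul _).abs ?_
    obtain ⟨n₀, hn₀⟩ := exists_nat_ge (s - R)
    filter_upwards [eventually_ge_atTop n₀] with n hn
    have : (n₀ : ℝ) ≤ φ n := by exact_mod_cast hn.trans (hφ.id_le n)
    exact (hy (φ n) s ⟨hs.le, by linarith⟩).le
  refine ⟨Y, fun s hs => ⟨?_, hWl s hs, hyl s hs⟩⟩
  have hs0 : 0 < s := hR0.trans hs
  have h1 := hYd s hs
  simp only [hv] at h1
  rw [hcW_id, hcy_id] at h1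
  · exact h1
  · have h2 := hyl s hs
    rw [abs_mul, abs_of_pos (by positivity : 0 < s ^ 2)] at h2
    have h3 : |(Y s).2| ≤ (s ^ 2)⁻¹ * (4 * B + 1) := by
      rw [inv_mul_eq_div, le_div_iff₀ (by positivity)]; linarith
    exact h3.trans ((mul_le_mul_of_nonneg_right (hξ s hs.le) (by linarith)).trans hRδ)
  · refine (hWl s hs).trans ?_
    rw [div_eq_inv_mul]
    exact (mul_le_mul_of_nonneg_right (hξ s hs.le) (by linarith)).trans hRσ

/-- The coefficient `β` as a function of `x = s⁻²`, `w = W`, `g` and `η`. -/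
noncomputable def slopeFun (p : ℝ × ℝ × ℝ × ℝ) : ℝ :=
  (1 + (p.2.1 - 2 * p.1 * p.2.2.1) ^ 2 * p.2.1⁻¹) / 2

/-- The value of `Γ + β η` as a function of `x = s⁻²`, `w = W`, `g` and `η`. -/
noncomputable def totalFun (p : ℝ × ℝ × ℝ × ℝ) : ℝ :=
  p.2.2.1 * (1 - 2 * p.1 * p.2.2.1 * p.2.1⁻¹) + slopeFun p * p.2.2.2

/-- The value of `s ∂ₛΓ + (s ∂ₛβ) η + 2 β η` along a solution, as a function of `x = s⁻²`, `w = W`,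
`g` and `η`. -/
noncomputable def residual (p : ℝ × ℝ × ℝ × ℝ) : ℝ :=
  (totalFun p - 2 * (-2 * p.1 * p.2.2.1 ^ 2 * p.2.1⁻¹ + 2 * p.1 * p.2.2.1 * totalFun p * p.2.1⁻¹
      + 4 * p.1 ^ 2 * p.2.2.1 ^ 3 * p.2.1⁻¹ ^ 2))
    + (-2 * p.1 * totalFun p * (p.2.1 - 2 * p.1 * p.2.2.1) * p.2.1⁻¹
      + 2 * p.1 * p.2.2.1 * (p.2.1 - 2 * p.1 * p.2.2.1) ^ 2 * p.2.1⁻¹ ^ 2) * p.2.2.2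
    + 2 * slopeFun p * p.2.2.2

/-- Bounds on compact sets of `(s⁻², W, g, η)`. The derivatives of `g`, and with them the degeneracy
of the equation, do not enter. -/
theorem exists_residual_bound {w₁ w₂ : ℝ} (hw : 0 < w₁) (B M : ℝ) :
    ∃ K, 0 ≤ K ∧ ∀ x ∈ Icc (0 : ℝ) 1, ∀ w ∈ Icc w₁ w₂, ∀ g, |g| ≤ B → ∀ η, |η| ≤ M →
      |totalFun (x, w, g, η)| ≤ K ∧ |residual (x, w, g, η)| ≤ K := by
  set S : Set (ℝ × ℝ × ℝ × ℝ) := Icc 0 1 ×ˢ Icc w₁ w₂ ×ˢ Icc (-B) B ×ˢ Icc (-M) M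
  have hS : IsCompact S :=
    isCompact_Icc.prod (isCompact_Icc.prod (isCompact_Icc.prod isCompact_Icc))
  have hinv : ContinuousOn (fun p : ℝ × ℝ × ℝ × ℝ => p.2.1⁻¹) S :=
    ContinuousOn.inv₀ (by fun_prop) fun p hp => (hw.trans_le hp.2.1.1).ne'
  have hd : ContinuousOn (fun p : ℝ × ℝ × ℝ × ℝ => p.2.1 - 2 * p.1 * p.2.2.1) S := by fun_prop
  have hβ : ContinuousOn slopeFun S :=
    (continuousOn_const.add ((hd.pow 2).mul hinv)).div_const 2
  have hx : ContinuousOn (fun p : ℝ × ℝ × ℝ × ℝ => p.1) S := by fun_prop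
  have hg : ContinuousOn (fun p : ℝ × ℝ × ℝ × ℝ => p.2.2.1) S := by fun_prop
  have hη : ContinuousOn (fun p : ℝ × ℝ × ℝ × ℝ => p.2.2.2) S := by fun_prop
  have hΦ : ContinuousOn totalFun S :=
    (hg.mul (continuousOn_const.sub (((continuousOn_const.mul hx).mul hg).mul hinv))).add
      (hβ.mul hη)
  have hc : ContinuousOn residual S := by
    refine ((hΦ.sub (continuousOn_const.mul ((ContinuousOn.add ?_ ?_).add ?_))).add
      ((ContinuousOn.add ?_ ?_).mul hη)).add ((continuousOn_const.mul hβ).mul hη)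
    · exact ((continuousOn_const.mul hx).mul (hg.pow 2)).mul hinv
    · exact (((continuousOn_const.mul hx).mul hg).mul hΦ).mul hinv
    · exact ((continuousOn_const.mul (hx.pow 2)).mul (hg.pow 3)).mul (hinv.pow 2)
    · exact (((continuousOn_const.mul hx).mul hΦ).mul hd).mul hinv
    · exact (((continuousOn_const.mul hx).mul hg).mul (hd.pow 2)).mul (hinv.pow 2)
  obtain ⟨K, hK⟩ := hS.exists_bound_of_continuousOn hc
  obtain ⟨K', hK'⟩ := hS.exists_bound_of_continuousOn hΦ
  refine ⟨max (max K K') 0, le_max_right _ _, fun x hx w hw g hg η hη => ?_⟩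
  have hm : (x, w, g, η) ∈ S := ⟨hx, hw, abs_le.1 hg, abs_le.1 hη⟩
  exact ⟨(hK' _ hm).trans ((le_max_right _ _).trans (le_max_left _ _)),
    (hK _ hm).trans ((le_max_left _ _).trans (le_max_left _ _))⟩

theorem hasDerivAt_inv_sq {s : ℝ} (hs : s ≠ 0) :
    HasDerivAt (fun s : ℝ => (s ^ 2)⁻¹) (-2 * (s ^ 2)⁻¹ / s) s := by
  refine ((hasDerivAt_div_pow 1 2 hs).congr_of_eventuallyEq
    (f₁ := fun s : ℝ => (s ^ 2)⁻¹) (Eventually.of_forall fun t => by simp)).congr_deriv ?_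
  field_simp; push_cast; ring

/-- The differentiated equation for `Z`. -/
theorem hasDerivAt_Z {R : ℝ} {γ₀ γ₁ γ₂ W η Z : ℝ → ℝ} (hR : 0 ≤ R)
    (hη : ∀ s, R < s → HasDerivAt η ((Z s + 2 * η s) / s) s)
    (hW : ∀ s, R < s → HasDerivAt W ((-4 * ((s ^ 2)⁻¹ * γ₀ s)) / s) s)
    (hγ₀ : ∀ s, R < s → HasDerivAt γ₀ (γ₁ s * ((s ^ 2)⁻¹ * Z s) / s) s)
    (hγ₁ : ∀ s, R < s → HasDerivAt γ₁ (γ₂ s * ((s ^ 2)⁻¹ * Z s) / s) s)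
    (hZ : ∀ s, R < s → (s ^ 2)⁻¹ * γ₁ s * Z s = forcing (γ₀ s) (W s) s
      + halfSlope (γ₀ s) (W s) s * η s)
    (hpos : ∀ s, R < s → 0 < γ₁ s) (hWpos : ∀ s, R < s → 0 < W s) {s : ℝ} (hs : R < s) :
    DifferentiableAt ℝ Z s ∧ (s ^ 2)⁻¹ * γ₁ s * (s * deriv Z s) =
      (halfSlope (γ₀ s) (W s) s + 2 * ((s ^ 2)⁻¹ * γ₁ s) - ((s ^ 2)⁻¹) ^ 2 * γ₂ s * Z s) * Z s
        + residual ((s ^ 2)⁻¹, W s, γ₀ s, η s) := by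
  have hs0 : 0 < s := hR.trans_lt hs
  have hW0 := hWpos s hs
  have hξ := hasDerivAt_inv_sq hs0.ne'
  have hWi : HasDerivAt (fun s => (W s)⁻¹) _ s := (hW s hs).inv hW0.ne'
  have hΓ : HasDerivAt (fun s => forcing (γ₀ s) (W s) s) _ s :=
    (hγ₀ s hs).mul ((((hξ.const_mul 2).mul (hγ₀ s hs)).mul hWi).const_sub 1)
  have hβ : HasDerivAt (fun s => halfSlope (γ₀ s) (W s) s) _ s :=
    (((((hW s hs).sub ((hξ.const_mul 2).mul (hγ₀ s hs))).pow 2).mul hWi).const_add 1).div_const 2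
  have hε := hξ.mul (hγ₁ s hs)
  have hε0 : ∀ t, R < t → (t ^ 2)⁻¹ * γ₁ t ≠ 0 := fun t ht =>
    mul_ne_zero (inv_ne_zero (pow_ne_zero 2 (hR.trans_lt ht).ne')) (hpos t ht).ne'
  have hnum := hΓ.add (hβ.mul (hη s hs))
  have hd : DifferentiableAt ℝ Z s := by
    refine (hnum.div hε (hε0 s hs)).differentiableAt.congr_of_eventuallyEq ?_
    filter_upwards [eventually_gt_nhds hs] with t ht
    simp only [Pi.mul_apply, Pi.div_apply, Pi.add_apply, ← hZ t ht]
    rw [mul_div_cancel_left₀ _ (hε0 t ht)]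
  refine ⟨hd, ?_⟩
  have hev : (fun t => forcing (γ₀ t) (W t) t) + (fun t => halfSlope (γ₀ t) (W t) t) * η
      =ᶠ[𝓝 s] ((fun t => (t ^ 2)⁻¹) * γ₁) * Z :=
    (eventually_gt_nhds hs).mono fun t ht => (hZ t ht).symm
  have h1 := (hε.mul hd.hasDerivAt).unique (hnum.congr_of_eventuallyEq hev.symm)
  simp only [Pi.mul_apply, Pi.sub_apply, Pi.pow_apply] at h1
  have h2 := hZ s hs
  have h3 : γ₁ s * ((s ^ 2)⁻¹ * Z s) = forcing (γ₀ s) (W s) s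
      + halfSlope (γ₀ s) (W s) s * η s := by rw [← h2]; ring
  rw [h3] at h1
  have h4 : (s ^ 2)⁻¹ * γ₁ s * (s * deriv Z s) = s * ((s ^ 2)⁻¹ * γ₁ s * deriv Z s) := by ring
  have h5 := eq_sub_of_add_eq' h1
  rw [h4, h5]
  simp only [residual, totalFun, slopeFun, forcing, halfSlope]
  generalize Z s = z
  generalize deriv Z s = z'
  generalize (s ^ 2)⁻¹ = x
  generalize γ₀ s = g
  generalize η s = h
  generalize W s = w at *
  field_simp
  ring

/-- Existence for the first-order system with smallness: for every `κ > 0` the solution is within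
`κ` of the cone in the sense below, on a half-line that depends on `g` only through the bound `B`
of its derivatives of order at most two. -/
theorem exists_small_solution {σ B δ κ : ℝ} (hσ : 0 < σ) (hB : 0 ≤ B) (hδ : 0 < δ) (hκ : 0 < κ) :
    ∃ R : ℝ, 1 ≤ R ∧ ∀ G : ℕ → ℝ → ℝ,
      (∀ i ≤ 2, ∀ y ∈ Ioo (-δ) δ, HasDerivAt (G i) (G (i + 1) y) y) →
      (∀ y ∈ Ioo (-δ) δ, 0 < G 1 y) → (∀ i ≤ 2, ∀ y ∈ Ioo (-δ) δ, |G i y| ≤ B) →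
      ∃ W y Z : ℝ → ℝ, Tendsto W atTop (𝓝 (σ ^ 2)) ∧ (∃ M, ∀ s, R < s → |s ^ 2 * y s| ≤ M) ∧
        ∀ s, R < s → |y s| ≤ δ / 2 ∧ |y s| ≤ κ ∧ |W s - σ ^ 2| ≤ κ ∧ |W s - σ ^ 2| ≤ σ ^ 2 / 2 ∧
          |(s ^ 2)⁻¹ * G 0 (y s)| ≤ κ ∧
          (s ^ 2)⁻¹ * G 1 (y s) * Z s = forcing (G 0 (y s)) (W s) s
            + halfSlope (G 0 (y s)) (W s) s * (s ^ 2 * y s) ∧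
          HasDerivAt W ((-4 * ((s ^ 2)⁻¹ * G 0 (y s))) / s) s ∧
          HasDerivAt y ((s ^ 2)⁻¹ * Z s / s) s ∧
          |((s ^ 2)⁻¹) ^ 2 * G 2 (y s) * Z s| ≤ κ := by
  have hσ2 : 0 < σ ^ 2 := by positivity
  obtain ⟨K, hK0, hK⟩ := exists_residual_bound (w₁ := σ ^ 2 / 2) (w₂ := 3 * σ ^ 2 / 2)
    (by linarith) B (4 * B + 1)
  -- the coefficient of `Z` in its equation will be at least `1 / 4`, and the forcing at most `K`
  set M₁ := 4 * K + 1 with hM₁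
  have hev : ∀ c d : ℝ, 0 < d → ∀ᶠ R : ℝ in atTop, (R ^ 2)⁻¹ * c ≤ d := fun c d hd => by
    have : Tendsto (fun R : ℝ => (R ^ 2)⁻¹ * c) atTop (𝓝 0) := by
      simpa using ((tendsto_pow_atTop (α := ℝ) two_ne_zero).inv_tendsto_atTop).mul_const c
    exact this.eventually_le_const hd
  obtain ⟨R, hR1, hRδ, hRκ, hRσ, hRWκ, hRB, hRZ, hRZ4⟩ :=
    ((eventually_ge_atTop (1 : ℝ)).and <| (hev (4 * B + 1) (δ / 2) (by linarith)).and <|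
      (hev (4 * B + 1) κ hκ).and <| (hev (2 * (B + 1)) (σ ^ 2 / 2) (by linarith)).and <|
      (hev (2 * (B + 1)) κ hκ).and <| (hev B κ hκ).and <| (hev (B * M₁) κ hκ).and
      (hev (B * M₁) (1 / 4) (by norm_num))).exists
  refine ⟨R, hR1, fun G hG hpos hGB => ?_⟩
  have hR0 : 0 < R := by linarith
  have hξ : ∀ s, R ≤ s → (s ^ 2)⁻¹ ≤ (R ^ 2)⁻¹ := fun s hs =>
    inv_anti₀ (by positivity) (by gcongr)
  obtain ⟨X, hX⟩ := exists_solution_W_y hσ hB hδ hR1 hRδ hRσ hG hpos (hGB 0 (by norm_num))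
  set W : ℝ → ℝ := fun s => (X s).1 with hWdef
  set y : ℝ → ℝ := fun s => (X s).2 with hydef
  set Z : ℝ → ℝ := fun s => s ^ 2 * ((forcing (G 0 (y s)) (W s) s
    + halfSlope (G 0 (y s)) (W s) s * (s ^ 2 * y s)) / G 1 (y s)) with hZdef
  have hWn : ∀ s, R < s → |W s - σ ^ 2| ≤ (R ^ 2)⁻¹ * (2 * (B + 1)) := fun s hs => by
    refine (hX s hs).2.1.trans ?_
    rw [div_eq_inv_mul]
    exact mul_le_mul_of_nonneg_right (hξ s hs.le) (by linarith)
  have hηM : ∀ s, R < s → |s ^ 2 * y s| ≤ 4 * B + 1 := fun s hs => (hX s hs).2.2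
  have hyn : ∀ s, R < s → |y s| ≤ (R ^ 2)⁻¹ * (4 * B + 1) := fun s hs => by
    have hs0 : 0 < s := hR0.trans hs
    have h2 := hηM s hs
    rw [abs_mul, abs_of_pos (by positivity : 0 < s ^ 2)] at h2
    have h3 : |y s| ≤ (s ^ 2)⁻¹ * (4 * B + 1) := by
      rw [inv_mul_eq_div, le_div_iff₀ (by positivity)]; linarith
    exact h3.trans (mul_le_mul_of_nonneg_right (hξ s hs.le) (by linarith))
  have hyδ : ∀ s, R < s → y s ∈ Icc (-(δ / 2)) (δ / 2) := fun s hs =>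
    abs_le.1 ((hyn s hs).trans hRδ)
  have hym : ∀ s, R < s → y s ∈ Ioo (-δ) δ := fun s hs =>
    ⟨by linarith [(hyδ s hs).1], by linarith [(hyδ s hs).2]⟩
  have hWI : ∀ s, R < s → W s ∈ Icc (σ ^ 2 / 2) (3 * σ ^ 2 / 2) := fun s hs => by
    have := abs_le.1 ((hWn s hs).trans hRσ)
    exact ⟨by linarith, by linarith⟩
  have hWpos : ∀ s, R < s → 0 < W s := fun s hs => by linarith [(hWI s hs).1]
  have hg1 : ∀ s, R < s → 0 < G 1 (y s) := fun s hs => hpos _ (hym s hs)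
  have hZeq : ∀ s, R < s → (s ^ 2)⁻¹ * G 1 (y s) * Z s = forcing (G 0 (y s)) (W s) s
      + halfSlope (G 0 (y s)) (W s) s * (s ^ 2 * y s) := fun s hs => by
    have hs0 : 0 < s := hR0.trans hs
    have := hg1 s hs
    simp only [hZdef]
    field_simp
  have hdW : ∀ s, R < s → HasDerivAt W ((-4 * ((s ^ 2)⁻¹ * G 0 (y s))) / s) s := fun s hs => by
    have h1 : HasDerivAt W (radialField G (s, X s)).1 s := by
      simpa using (hX s hs).1.hasFDerivAt.fst.hasDerivAt
    exact h1
  have hdy : ∀ s, R < s → HasDerivAt y ((s ^ 2)⁻¹ * Z s / s) s := fun s hs => by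
    have hs0 : 0 < s := hR0.trans hs
    have h1 : HasDerivAt y (radialField G (s, X s)).2 s := by
      simpa using (hX s hs).1.hasFDerivAt.snd.hasDerivAt
    refine h1.congr_deriv ?_
    have := hg1 s hs
    simp only [hZdef, radialField, hWdef, hydef] at this ⊢
    field_simp
  have hdη : ∀ s, R < s → HasDerivAt (fun s => s ^ 2 * y s) ((Z s + 2 * (s ^ 2 * y s)) / s) s :=
    fun s hs => by
      have hs0 : 0 < s := hR0.trans hs
      refine ((hasDerivAt_pow 2 s).mul (hdy s hs)).congr_deriv ?_
      field_simp; push_cast; ring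
  have hdG : ∀ i ≤ 2, ∀ s, R < s →
      HasDerivAt (fun s => G i (y s)) (G (i + 1) (y s) * ((s ^ 2)⁻¹ * Z s) / s) s := by
    intro i hi s hs
    have := (hG i hi _ (hym s hs)).comp s (hdy s hs)
    rwa [← mul_div_assoc] at this
  have hDZ := fun s (hs : R < s) => hasDerivAt_Z hR0.le hdη hdW (hdG 0 (by norm_num))
    (hdG 1 (by norm_num)) hZeq hg1 hWpos hs
  have hres : ∀ s, R < s → |residual ((s ^ 2)⁻¹, W s, G 0 (y s), s ^ 2 * y s)| ≤ K := fun s hs => by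
    have hs1 : 1 ≤ s := hR1.trans hs.le
    exact (hK _ ⟨by positivity, inv_le_one_of_one_le₀ (one_le_pow₀ hs1)⟩ _ (hWI s hs) _
      (hGB 0 (by norm_num) _ (hym s hs)) _ (hηM s hs)).2
  have hβ : ∀ s, R < s → 1 / 2 ≤ halfSlope (G 0 (y s)) (W s) s := fun s hs =>
    half_le_halfSlope (hWpos s hs)
  -- a bound of `Z` that depends on the solution
  obtain ⟨Ci, hCi⟩ : ∃ C, ∀ s, R < s → |Z s| ≤ C * s ^ 2 := by
    have hc1 : ContinuousOn (fun y => (G 1 y)⁻¹) (Icc (-(δ / 2)) (δ / 2)) := fun t ht =>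
      have ht' : t ∈ Ioo (-δ) δ := ⟨by linarith [ht.1], by linarith [ht.2]⟩
      ((hG 1 (by norm_num) t ht').continuousAt.inv₀ (hpos t ht').ne').continuousWithinAt
    obtain ⟨C₁, hC₁⟩ := isCompact_Icc.exists_bound_of_continuousOn hc1
    refine ⟨K * C₁, fun s hs => ?_⟩
    have hs1 : 1 ≤ s := hR1.trans hs.le
    have h1 : |forcing (G 0 (y s)) (W s) s + halfSlope (G 0 (y s)) (W s) s * (s ^ 2 * y s)| ≤ K :=
      (hK _ ⟨by positivity, inv_le_one_of_one_le₀ (one_le_pow₀ hs1)⟩ _ (hWI s hs) _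
        (hGB 0 (by norm_num) _ (hym s hs)) _ (hηM s hs)).1
    have h2 := hC₁ _ (hyδ s hs)
    rw [Real.norm_eq_abs] at h2
    simp only [hZdef, div_eq_mul_inv (_ + _), abs_mul, abs_of_nonneg (sq_nonneg s)]
    rw [mul_comm (s ^ 2)]
    refine mul_le_mul_of_nonneg_right ?_ (sq_nonneg s)
    exact mul_le_mul h1 h2 (abs_nonneg _) hK0
  have hδZ : ∀ s, R < s → ∀ m, |Z s| ≤ m → |((s ^ 2)⁻¹) ^ 2 * G 2 (y s) * Z s|
      ≤ ((s ^ 2)⁻¹) ^ 2 * (B * m) := fun s hs m hm => by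
    have h2 := hGB 2 le_rfl _ (hym s hs)
    rw [abs_mul, abs_mul, abs_of_nonneg (by positivity : 0 ≤ ((s ^ 2)⁻¹) ^ 2), mul_assoc]
    refine mul_le_mul_of_nonneg_left ?_ (by positivity)
    exact mul_le_mul h2 hm (abs_nonneg _) hB
  -- the uniform bound of `Z` near infinity
  have hZinf : ∃ S, R ≤ S ∧ ∀ s, S < s → |Z s| < M₁ := by
    obtain ⟨S, hS⟩ := ((hev (B * Ci) (1 / 4) (by norm_num)).and
      (eventually_ge_atTop R)).exists_forall_of_atTop
    refine ⟨max S R, le_max_right _ _, fun s hs => ?_⟩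
    have hlt : ∀ {s}, max S R < s → R < s := fun h => (le_max_right _ _).trans_lt h
    have := abs_le_of_singular_ode (R := max S R) (E := B) (c₀ := 1 / 4) (K := K) (X := Z)
      (e := fun s => (s ^ 2)⁻¹ * G 1 (y s))
      (c := fun s => halfSlope (G 0 (y s)) (W s) s + 2 * ((s ^ 2)⁻¹ * G 1 (y s))
        - ((s ^ 2)⁻¹) ^ 2 * G 2 (y s) * Z s)
      (F := fun s => residual ((s ^ 2)⁻¹, W s, G 0 (y s), s ^ 2 * y s))
      (hR1.trans (le_max_right _ _)) (by norm_num) (fun s hs => (hDZ s (hlt hs)).1)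
      (fun s hs => (hDZ s (hlt hs)).2) (fun s hs => ?_) (fun s hs => ?_) (fun s hs => ?_)
      (fun s hs => hres s (hlt hs)) ⟨Ci, 2, fun s hs => hCi s (hlt hs)⟩ s hs
    · linarith
    · have := hg1 s (hlt hs)
      have : 0 < s := hR0.trans (hlt hs)
      positivity
    · have := (le_abs_self _).trans (hGB 1 (by norm_num) _ (hym s (hlt hs)))
      have h0 : 0 ≤ (s ^ 2)⁻¹ := by positivity
      linarith [mul_le_mul_of_nonneg_right this h0]
    · have h0 : 0 < s := hR0.trans (hlt hs)
      have h1 := hβ s (hlt hs)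
      have h2 := hδZ s (hlt hs) _ (hCi s (hlt hs))
      have h3 : ((s ^ 2)⁻¹) ^ 2 * (B * (Ci * s ^ 2)) = (s ^ 2)⁻¹ * (B * Ci) := by field_simp
      have h4 := (hS s ((le_max_left _ _).trans hs.le)).1
      have h5 := (le_abs_self _).trans h2
      have h6 : 0 < (s ^ 2)⁻¹ * G 1 (y s) := mul_pos (by positivity) (hg1 s (hlt hs))
      linarith
  -- and its continuation to the whole half-line
  have hZb : ∀ s, R < s → |Z s| ≤ M₁ := by
    intro s hs
    obtain ⟨S, hRS, hS⟩ := hZinf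
    have hlt : ∀ t ∈ Icc s (max s (S + 1)), R < t := fun t ht => hs.trans_le ht.1
    refine (abs_lt_of_deriv_at_level (le_max_left s (S + 1))
      (fun t ht => ((hDZ t (hlt t ht)).1.continuousAt.continuousWithinAt))
      (hS _ (lt_of_lt_of_le (by linarith) (le_max_right _ _))) fun t ht htM => ?_).le
    have hRt := hlt t ⟨ht.1, ht.2.le⟩
    have ht0 : 0 < t := hR0.trans hRt
    obtain ⟨hd, he⟩ := hDZ t hRt
    refine ⟨_, ?_, hd.hasDerivAt.hasDerivWithinAt⟩
    have h0 : 0 < (t ^ 2)⁻¹ * G 1 (y t) := mul_pos (by positivity) (hg1 t hRt)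
    have h1 := hδZ t hRt M₁ htM.le
    have h2 : ((t ^ 2)⁻¹) ^ 2 * (B * M₁) ≤ 1 / 4 := by
      have hx := hξ t hRt.le
      have hx1 : (t ^ 2)⁻¹ ≤ 1 := inv_le_one_of_one_le₀ (one_le_pow₀ (hR1.trans hRt.le))
      have hx0 : 0 ≤ (t ^ 2)⁻¹ := by positivity
      have hBM : 0 ≤ B * M₁ := by positivity
      calc ((t ^ 2)⁻¹) ^ 2 * (B * M₁) ≤ (R ^ 2)⁻¹ * (B * M₁) := by
            refine mul_le_mul_of_nonneg_right ?_ hBM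
            nlinarith
        _ ≤ 1 / 4 := hRZ4
    have h3 := (le_abs_self _).trans (h1.trans h2)
    have h4 := hβ t hRt
    have h5 : |Z t * residual ((t ^ 2)⁻¹, W t, G 0 (y t), t ^ 2 * y t)| ≤ M₁ * K := by
      rw [abs_mul, htM]
      exact mul_le_mul_of_nonneg_left (hres t hRt) (by linarith)
    have h6 := (abs_le.1 h5).1
    have h7 : Z t ^ 2 = M₁ ^ 2 := by rw [← sq_abs, htM]
    set c := halfSlope (G 0 (y t)) (W t) t + 2 * ((t ^ 2)⁻¹ * G 1 (y t))
      - ((t ^ 2)⁻¹) ^ 2 * G 2 (y t) * Z t with hc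
    have hc4 : 1 / 4 ≤ c := by linarith
    have h8 : ((t ^ 2)⁻¹ * G 1 (y t) * t) * (Z t * deriv Z t)
        = c * Z t ^ 2 + Z t * residual ((t ^ 2)⁻¹, W t, G 0 (y t), t ^ 2 * y t) := by
      have : ((t ^ 2)⁻¹ * G 1 (y t) * t) * (Z t * deriv Z t)
        = Z t * ((t ^ 2)⁻¹ * G 1 (y t) * (t * deriv Z t)) := by ring
      rw [this, he]; ring
    have h9 : 0 < c * Z t ^ 2 + Z t * residual ((t ^ 2)⁻¹, W t, G 0 (y t), t ^ 2 * y t) := by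
      rw [h7]
      have : 1 / 4 * M₁ ^ 2 ≤ c * M₁ ^ 2 := mul_le_mul_of_nonneg_right hc4 (sq_nonneg _)
      nlinarith
    rw [← h8] at h9
    exact (pos_iff_pos_of_mul_pos h9).1 (mul_pos h0 ht0)
  refine ⟨W, y, Z, ?_, ⟨_, hηM⟩, fun s hs => ⟨(hyn s hs).trans hRδ, (hyn s hs).trans hRκ,
    (hWn s hs).trans hRWκ, (hWn s hs).trans hRσ, ?_, hZeq s hs, hdW s hs, hdy s hs, ?_⟩⟩
  · rw [tendsto_iff_dist_tendsto_zero]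
    have h1 : Tendsto (fun s : ℝ => 2 * (B + 1) / s ^ 2) atTop (𝓝 0) :=
      (tendsto_pow_atTop two_ne_zero).const_div_atTop _
    refine squeeze_zero' (Eventually.of_forall fun s => dist_nonneg) ?_ h1
    filter_upwards [eventually_gt_atTop R] with s hs
    rw [Real.dist_eq]
    exact (hX s hs).2.1
  · rw [abs_mul, abs_of_nonneg (by positivity)]
    exact (mul_le_mul (hξ s hs.le) (hGB 0 (by norm_num) _ (hym s hs)) (abs_nonneg _)
      (by positivity)).trans hRB
  · refine (hδZ s hs M₁ (hZb s hs)).trans (le_trans ?_ hRZ)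
    have hx := hξ s hs.le
    have hx1 : (s ^ 2)⁻¹ ≤ 1 := inv_le_one_of_one_le₀ (one_le_pow₀ (hR1.trans hs.le))
    have hx0 : 0 ≤ (s ^ 2)⁻¹ := by positivity
    have hBM : 0 ≤ B * M₁ := by positivity
    refine mul_le_mul_of_nonneg_right ?_ hBM
    nlinarith

/-! ### The profile `g = f(1, …, 1, ·)` -/

section Profile

variable {m : ℕ}

theorem vec_eq (a b : ℝ) : vec m a b =
    a • ∑ i : Fin m, Pi.single i.castSucc (1 : ℝ) + b • Pi.single (Fin.last m) (1 : ℝ) := by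
  ext j
  refine Fin.lastCases ?_ (fun i => ?_) j
  · simp [vec, Finset.sum_apply, (Fin.castSucc_lt_last _).ne']
  · simp [vec, Finset.sum_apply, Pi.single_apply, (Fin.castSucc_lt_last _).ne]

theorem vec_apply_castSucc (a b : ℝ) (i : Fin m) : vec m a b i.castSucc = a := by simp [vec]

theorem vec_apply_last (a b : ℝ) : vec m a b (Fin.last m) = b := by simp [vec]

theorem smul_vec (ρ a b : ℝ) : ρ • vec m a b = vec m (ρ * a) (ρ * b) := by
  rw [vec_eq, vec_eq, smul_add, smul_smul, smul_smul]

theorem vec_mem_of_close {K : Set (Fin (m + 1) → ℝ)} {δ : ℝ} (hδ : 0 < δ)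
    (hK : Metric.ball (vec m 1 0) δ ⊆ K) {a b : ℝ} (ha : |a - 1| < δ) (hb : |b| < δ) :
    vec m a b ∈ K := by
  refine hK ?_
  rw [Metric.mem_ball, dist_pi_lt_iff hδ]
  intro j
  refine Fin.lastCases ?_ (fun i => ?_) j
  · rw [vec_apply_last, vec_apply_last, Real.dist_eq, sub_zero]; exact hb
  · rw [vec_apply_castSucc, vec_apply_castSucc, Real.dist_eq]; exact ha

/-- The function `g y = f (1, …, 1, y)`. By homogeneity the equation only involves `f` through
`g`. -/
def profile (m : ℕ) (f : (Fin (m + 1) → ℝ) → ℝ) (y : ℝ) : ℝ := f (vec m 1 y)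

theorem hasDerivAt_vec (a y : ℝ) :
    HasDerivAt (fun y => vec m a y) (Pi.single (Fin.last m) (1 : ℝ)) y := by
  have h : (fun y => vec m a y) = fun y => a • ∑ i : Fin m, Pi.single i.castSucc (1 : ℝ)
      + y • Pi.single (Fin.last m) (1 : ℝ) := funext fun y => vec_eq a y
  rw [h]
  simpa using ((hasDerivAt_id y).smul_const (Pi.single (Fin.last m) (1 : ℝ))).const_add
    (a • ∑ i : Fin m, Pi.single i.castSucc (1 : ℝ))

variable {f : (Fin (m + 1) → ℝ) → ℝ} {K : Set (Fin (m + 1) → ℝ)} {δ : ℝ} {k : ℕ}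

theorem iteratedDeriv_profile (hKo : IsOpen K) (hf : ContDiffOn ℝ (k + 1 : ℕ) f K)
    (hy : ∀ y ∈ Ioo (-δ) δ, vec m 1 y ∈ K) :
    ∀ l ≤ k + 1, ∀ y ∈ Ioo (-δ) δ, iteratedDeriv l (profile m f) y =
      iteratedFDeriv ℝ l f (vec m 1 y) (fun _ => Pi.single (Fin.last m) (1 : ℝ)) ∧
      (l ≤ k → HasDerivAt (iteratedDeriv l (profile m f))
        (iteratedDeriv (l + 1) (profile m f) y) y) := by
  have hd : ∀ l ≤ k, ∀ y ∈ Ioo (-δ) δ, HasDerivAt (fun y => iteratedFDeriv ℝ l f (vec m 1 y)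
      (fun _ => Pi.single (Fin.last m) (1 : ℝ))) (iteratedFDeriv ℝ (l + 1) f (vec m 1 y)
      (fun _ => Pi.single (Fin.last m) (1 : ℝ))) y := by
    intro l hl y hyδ
    have h1 : DifferentiableAt ℝ (iteratedFDeriv ℝ l f) (vec m 1 y) :=
      (hf.contDiffAt (hKo.mem_nhds (hy y hyδ))).differentiableAt_iteratedFDeriv
        (by exact_mod_cast Nat.lt_succ_of_le hl)
    have h2 := h1.hasFDerivAt.comp_hasDerivAt y (hasDerivAt_vec 1 y)
    have h3 := ((ContinuousMultilinearMap.apply ℝ (fun _ : Fin l => Fin (m + 1) → ℝ) ℝ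
      (fun _ => Pi.single (Fin.last m) (1 : ℝ))).hasFDerivAt).comp_hasDerivAt y h2
    exact h3
  have key : ∀ l, l ≤ k + 1 → ∀ y ∈ Ioo (-δ) δ, iteratedDeriv l (profile m f) y =
      iteratedFDeriv ℝ l f (vec m 1 y) (fun _ => Pi.single (Fin.last m) (1 : ℝ)) := by
    intro l
    induction l with
    | zero => intro _ y _; simp [profile]
    | succ l ih =>
      intro hl y hyδ
      rw [iteratedDeriv_succ]
      have h1 : iteratedDeriv l (profile m f) =ᶠ[𝓝 y] fun y => iteratedFDeriv ℝ l f (vec m 1 y)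
          (fun _ => Pi.single (Fin.last m) (1 : ℝ)) :=
        mem_of_superset (isOpen_Ioo.mem_nhds hyδ) fun t ht => ih (by omega) t ht
      rw [h1.deriv_eq]
      exact (hd l (by omega) y hyδ).deriv
  intro l hl y hyδ
  refine ⟨key l hl y hyδ, fun hl' => ?_⟩
  rw [key (l + 1) (by omega) y hyδ]
  refine (hd l hl' y hyδ).congr_of_eventuallyEq ?_
  exact mem_of_superset (isOpen_Ioo.mem_nhds hyδ) fun t ht => key l hl t ht

theorem norm_iteratedFDeriv_le_of_cNorm_le {A : ℝ≥0} {j : ℕ} (h : cNorm j K f ≤ A) {l : ℕ}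
    (hl : l ≤ j) {x : Fin (m + 1) → ℝ} (hx : x ∈ K) : ‖iteratedFDeriv ℝ l f x‖ ≤ A := by
  have h1 : ‖iteratedFDeriv ℝ l f x‖ₑ ≤ A := by
    refine le_trans ?_ h
    exact le_iSup₂_of_le l (Finset.mem_range.2 (by omega)) (le_iSup₂_of_le x hx le_rfl)
  rw [enorm_le_coe] at h1
  exact_mod_cast h1

theorem abs_iteratedDeriv_profile_le (hKo : IsOpen K) (hf : ContDiffOn ℝ (k + 1 : ℕ) f K)
    (hy : ∀ y ∈ Ioo (-δ) δ, vec m 1 y ∈ K) {A : ℝ≥0} {j : ℕ} (h : cNorm j K f ≤ A) {l : ℕ}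
    (hl : l ≤ j) (hlk : l ≤ k + 1) {y : ℝ} (hyδ : y ∈ Ioo (-δ) δ) :
    |iteratedDeriv l (profile m f) y| ≤ A := by
  rw [(iteratedDeriv_profile hKo hf hy l hlk y hyδ).1, ← Real.norm_eq_abs]
  refine (ContinuousMultilinearMap.le_opNorm _ _).trans ?_
  have he : ‖(Pi.single (Fin.last m) (1 : ℝ) : Fin (m + 1) → ℝ)‖ ≤ 1 := by
    rw [pi_norm_le_iff_of_nonneg zero_le_one]
    intro j
    by_cases hj : j = Fin.last m <;> simp [hj]
  have h2 : ∏ _i : Fin l, ‖(Pi.single (Fin.last m) (1 : ℝ) : Fin (m + 1) → ℝ)‖ ≤ 1 :=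
    Finset.prod_le_one (fun _ _ => norm_nonneg _) fun _ _ => he
  calc _ ≤ ‖iteratedFDeriv ℝ l f (vec m 1 y)‖ * 1 :=
        mul_le_mul_of_nonneg_left h2 (norm_nonneg _)
    _ ≤ A := by
      rw [mul_one]; exact norm_iteratedFDeriv_le_of_cNorm_le h hl (hy y hyδ)

theorem pd_eq_fderiv {x : Fin (m + 1) → ℝ} (h : DifferentiableAt ℝ f x) (i : Fin (m + 1)) :
    pd i f x = fderiv ℝ f x (Pi.single i 1) := h.lineDeriv_eq_fderiv

theorem iteratedDeriv_one_profile (hKo : IsOpen K) (hf : ContDiffOn ℝ (k + 1 : ℕ) f K)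
    (hy : ∀ y ∈ Ioo (-δ) δ, vec m 1 y ∈ K) {y : ℝ} (hyδ : y ∈ Ioo (-δ) δ) :
    iteratedDeriv 1 (profile m f) y = pd (Fin.last m) f (vec m 1 y) := by
  rw [(iteratedDeriv_profile hKo hf hy 1 (by omega) y hyδ).1, iteratedFDeriv_one_apply,
    pd_eq_fderiv]
  exact (hf.contDiffAt (hKo.mem_nhds (hy y hyδ))).differentiableAt (by simp)

/-- Homogeneity in terms of the profile. -/
theorem IsSymmHomogeneous.apply_vec {Ω : Set (Fin (m + 1) → ℝ)} (hf : IsSymmHomogeneous Ω f)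
    {a b : ℝ} (ha : 0 < a) (h : vec m 1 (b / a) ∈ Ω) :
    vec m a b ∈ Ω ∧ f (vec m a b) = a * profile m f (b / a) := by
  have h1 : vec m a b = a • vec m 1 (b / a) := by
    rw [smul_vec, mul_one, mul_div_cancel₀ _ ha.ne']
  rw [h1]
  exact ⟨hf.smul_mem _ h a ha, hf.map_smul _ h a ha⟩

/-! ### Taylor expansion of the equation -/

theorem fderiv_vec {x : Fin (m + 1) → ℝ} (h : DifferentiableAt ℝ f x) (a b : ℝ) :
    fderiv ℝ f x (vec m a b) =
      a * ∑ i : Fin m, pd i.castSucc f x + b * pd (Fin.last m) f x := by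
  rw [vec_eq, map_add, map_smul, map_smul, map_sum, pd_eq_fderiv h, smul_eq_mul, smul_eq_mul]
  simp_rw [pd_eq_fderiv h]

theorem contDiffOn_pd (hKo : IsOpen K) {n : ℕ} (hf : ContDiffOn ℝ (n + 1 : ℕ) f K)
    (i : Fin (m + 1)) : ContDiffOn ℝ n (pd i f) K := by
  have h1 : ContDiffOn ℝ n (fun x => fderiv ℝ f x (Pi.single i 1)) K :=
    (hf.fderiv_of_isOpen hKo (by norm_cast)).clm_apply contDiffOn_const
  refine h1.congr fun x hx => pd_eq_fderiv ?_ i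
  exact (hf.contDiffAt (hKo.mem_nhds hx)).differentiableAt (by simp)

theorem pd_pd_comm (hKo : IsOpen K) (hf : ContDiffOn ℝ (2 : ℕ) f K) {x : Fin (m + 1) → ℝ}
    (hx : x ∈ K) (i j : Fin (m + 1)) : pd i (pd j f) x = pd j (pd i f) x := by
  have hc : ContDiffAt ℝ (2 : ℕ) f x := hf.contDiffAt (hKo.mem_nhds hx)
  have hd : DifferentiableAt ℝ (fderiv ℝ f) x :=
    (hc.fderiv_right (m := 1) (by norm_num)).differentiableAt one_ne_zero
  have key : ∀ i j, pd i (pd j f) x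
      = fderiv ℝ (fderiv ℝ f) x (Pi.single i 1) (Pi.single j 1) := by
    intro i j
    have h1 : pd j f =ᶠ[𝓝 x] fun x => fderiv ℝ f x (Pi.single j 1) :=
      mem_of_superset (hKo.mem_nhds hx) fun z hz => pd_eq_fderiv
        ((hf.contDiffAt (hKo.mem_nhds hz)).differentiableAt (by simp)) j
    have h2 : HasFDerivAt (fun x => fderiv ℝ f x (Pi.single j 1))
        ((fderiv ℝ (fderiv ℝ f) x).flip (Pi.single j 1)) x := by
      simpa using hd.hasFDerivAt.clm_apply (hasFDerivAt_const (Pi.single j (1 : ℝ)) x)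
    have h3 := h2.congr_of_eventuallyEq h1
    rw [pd_eq_fderiv h3.differentiableAt, h3.fderiv, ContinuousLinearMap.flip_apply]
  rw [key, key]
  exact hc.isSymmSndFDerivAt (by simp) _ _

end Profile

/-- Taylor's formula with integral remainder along `θ ↦ L (1 / z, …, 1 / z, -q / (1 + p²))`, for
`z = L + θ u`, `p = σ + θ u₁`, `q = θ u₂`. -/
theorem taylor_remainder {σ L u u₁ u₂ : ℝ} (hL : 0 < L) {F fn fi fnn fni fij : ℝ → ℝ}
    (hz : ∀ θ ∈ Icc (0 : ℝ) 1, 0 < L + θ * u)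
    (hF : ∀ θ ∈ Icc (0 : ℝ) 1, ∀ α β, α = -(L * u / (L + θ * u) ^ 2) →
      β = L * (-u₂ / (1 + (σ + θ * u₁) ^ 2)
        + 2 * (θ * u₂) * (σ + θ * u₁) * u₁ / (1 + (σ + θ * u₁) ^ 2) ^ 2) →
      HasDerivAt F (α * fi θ + β * fn θ) θ ∧ HasDerivAt fi (α * fij θ + β * fni θ) θ ∧
      HasDerivAt fn (α * fni θ + β * fnn θ) θ)
    (hnn : ContinuousOn fnn (Icc 0 1)) (hni : ContinuousOn fni (Icc 0 1))
    (hij : ContinuousOn fij (Icc 0 1)) :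
    F 1 = F 0 - u / L * fi 0 - L * u₂ / (1 + σ ^ 2) * fn 0
      + L * ((∫ θ in (0 : ℝ)..1, L * fnn θ / (1 + (σ + θ * u₁) ^ 2) ^ 2 * (1 - θ)) * u₂ ^ 2
        + (∫ θ in (0 : ℝ)..1, (L * fnn θ * (4 * (θ * u₂) ^ 2 * (σ + θ * u₁) ^ 2
            / (1 + (σ + θ * u₁) ^ 2) ^ 4)
          + fn θ * (2 * (θ * u₂) * (1 - 3 * (σ + θ * u₁) ^ 2)
            / (1 + (σ + θ * u₁) ^ 2) ^ 3)) * (1 - θ)) * u₁ ^ 2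
        + (∫ θ in (0 : ℝ)..1, (L * fij θ + 2 * (L + θ * u) * fi θ) / (L + θ * u) ^ 4 * (1 - θ))
          * u ^ 2
        + 2 * (∫ θ in (0 : ℝ)..1, (L * fnn θ * (-2 * (θ * u₂) * (σ + θ * u₁)
            / (1 + (σ + θ * u₁) ^ 2) ^ 3)
          + fn θ * (2 * (σ + θ * u₁) / (1 + (σ + θ * u₁) ^ 2) ^ 2)) * (1 - θ)) * u₂ * u₁
        + 2 * (∫ θ in (0 : ℝ)..1, L * fni θ / ((1 + (σ + θ * u₁) ^ 2) * (L + θ * u) ^ 2)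
          * (1 - θ)) * u * u₂
        - 2 * (∫ θ in (0 : ℝ)..1, L * fni θ * (2 * (θ * u₂) * (σ + θ * u₁)
            / ((1 + (σ + θ * u₁) ^ 2) ^ 2 * (L + θ * u) ^ 2)) * (1 - θ)) * u * u₁) := by
  have hn : ContinuousOn fn (Icc 0 1) := fun θ hθ =>
    (hF θ hθ _ _ rfl rfl).2.2.continuousAt.continuousWithinAt
  have hi : ContinuousOn fi (Icc 0 1) := fun θ hθ =>
    (hF θ hθ _ _ rfl rfl).2.1.continuousAt.continuousWithinAt
  have hp : ∀ θ : ℝ, 0 < 1 + (σ + θ * u₁) ^ 2 := fun θ => by positivity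
  have hII : ∀ {g : ℝ → ℝ}, ContinuousOn g (Icc 0 1) →
      IntervalIntegrable g MeasureTheory.volume 0 1 := fun h => by
    refine ContinuousOn.intervalIntegrable ?_
    rwa [uIcc_of_le zero_le_one]
  set I₁ : ℝ → ℝ := fun θ => L * fnn θ / (1 + (σ + θ * u₁) ^ 2) ^ 2 * (1 - θ) with hI₁
  set I₂ : ℝ → ℝ := fun θ => (L * fnn θ * (4 * (θ * u₂) ^ 2 * (σ + θ * u₁) ^ 2
            / (1 + (σ + θ * u₁) ^ 2) ^ 4)
          + fn θ * (2 * (θ * u₂) * (1 - 3 * (σ + θ * u₁) ^ 2)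
            / (1 + (σ + θ * u₁) ^ 2) ^ 3)) * (1 - θ) with hI₂
  set I₃ : ℝ → ℝ := fun θ => (L * fij θ + 2 * (L + θ * u) * fi θ) / (L + θ * u) ^ 4 * (1 - θ)
    with hI₃
  set I₄ : ℝ → ℝ := fun θ => (L * fnn θ * (-2 * (θ * u₂) * (σ + θ * u₁)
            / (1 + (σ + θ * u₁) ^ 2) ^ 3)
          + fn θ * (2 * (σ + θ * u₁) / (1 + (σ + θ * u₁) ^ 2) ^ 2)) * (1 - θ) with hI₄
  set I₅ : ℝ → ℝ := fun θ => L * fni θ / ((1 + (σ + θ * u₁) ^ 2) * (L + θ * u) ^ 2) * (1 - θ)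
    with hI₅
  set I₆ : ℝ → ℝ := fun θ => L * fni θ * (2 * (θ * u₂) * (σ + θ * u₁)
            / ((1 + (σ + θ * u₁) ^ 2) ^ 2 * (L + θ * u) ^ 2)) * (1 - θ) with hI₆
  have cz : ContinuousOn (fun θ => L + θ * u) (Icc 0 1) := by fun_prop
  have cp : ContinuousOn (fun θ => 1 + (σ + θ * u₁) ^ 2) (Icc 0 1) := by fun_prop
  have ct : ContinuousOn (fun θ : ℝ => 1 - θ) (Icc 0 1) := by fun_prop
  have hzn : ∀ (n : ℕ), ∀ θ ∈ Icc (0 : ℝ) 1, (L + θ * u) ^ n ≠ 0 := fun n θ hθ =>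
    pow_ne_zero n (hz θ hθ).ne'
  have hpn : ∀ (n : ℕ), ∀ θ ∈ Icc (0 : ℝ) 1, (1 + (σ + θ * u₁) ^ 2) ^ n ≠ 0 := fun n θ _ =>
    pow_ne_zero n (hp θ).ne'
  have c₁ : ContinuousOn I₁ (Icc 0 1) :=
    ((continuousOn_const.mul hnn).div (cp.pow 2) (hpn 2)).mul ct
  have c₂ : ContinuousOn I₂ (Icc 0 1) :=
    (((continuousOn_const.mul hnn).mul (ContinuousOn.div (by fun_prop) (cp.pow 4) (hpn 4))).add
      (hn.mul (ContinuousOn.div (by fun_prop) (cp.pow 3) (hpn 3)))).mul ct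
  have c₃ : ContinuousOn I₃ (Icc 0 1) :=
    (((continuousOn_const.mul hij).add ((continuousOn_const.mul cz).mul hi)).div (cz.pow 4)
      (hzn 4)).mul ct
  have c₄ : ContinuousOn I₄ (Icc 0 1) :=
    (((continuousOn_const.mul hnn).mul (ContinuousOn.div (by fun_prop) (cp.pow 3) (hpn 3))).add
      (hn.mul (ContinuousOn.div (by fun_prop) (cp.pow 2) (hpn 2)))).mul ct
  have c₅ : ContinuousOn I₅ (Icc 0 1) :=
    ((continuousOn_const.mul hni).div (cp.mul (cz.pow 2)) fun θ hθ =>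
      mul_ne_zero (hp θ).ne' (hzn 2 θ hθ)).mul ct
  have c₆ : ContinuousOn I₆ (Icc 0 1) :=
    ((continuousOn_const.mul hni).mul (ContinuousOn.div (by fun_prop) ((cp.pow 2).mul (cz.pow 2))
      fun θ hθ => mul_ne_zero (hpn 2 θ hθ) (hzn 2 θ hθ))).mul ct
  set I : ℝ → ℝ := fun θ => I₁ θ * u₂ ^ 2 + I₂ θ * u₁ ^ 2 + I₃ θ * u ^ 2
    + I₄ θ * (2 * u₂ * u₁) + I₅ θ * (2 * u * u₂) - I₆ θ * (2 * u * u₁) with hI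
  have hint : (∫ θ in (0 : ℝ)..1, I θ) = (∫ θ in (0 : ℝ)..1, I₁ θ) * u₂ ^ 2
      + (∫ θ in (0 : ℝ)..1, I₂ θ) * u₁ ^ 2 + (∫ θ in (0 : ℝ)..1, I₃ θ) * u ^ 2
      + (∫ θ in (0 : ℝ)..1, I₄ θ) * (2 * u₂ * u₁) + (∫ θ in (0 : ℝ)..1, I₅ θ) * (2 * u * u₂)
      - (∫ θ in (0 : ℝ)..1, I₆ θ) * (2 * u * u₁) := by
    have e₁ := (hII c₁).mul_const (u₂ ^ 2)
    have e₂ := (hII c₂).mul_const (u₁ ^ 2)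
    have e₃ := (hII c₃).mul_const (u ^ 2)
    have e₄ := (hII c₄).mul_const (2 * u₂ * u₁)
    have e₅ := (hII c₅).mul_const (2 * u * u₂)
    have e₆ := (hII c₆).mul_const (2 * u * u₁)
    simp only [hI]
    rw [intervalIntegral.integral_sub ((((e₁.add e₂).add e₃).add e₄).add e₅) e₆,
      intervalIntegral.integral_add (((e₁.add e₂).add e₃).add e₄) e₅,
      intervalIntegral.integral_add ((e₁.add e₂).add e₃) e₄,
      intervalIntegral.integral_add (e₁.add e₂) e₃, intervalIntegral.integral_add e₁ e₂]
    simp only [intervalIntegral.integral_mul_const]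
  have cI : ContinuousOn I (Icc 0 1) :=
    (((((c₁.mul continuousOn_const).add (c₂.mul continuousOn_const)).add
      (c₃.mul continuousOn_const)).add (c₄.mul continuousOn_const)).add
      (c₅.mul continuousOn_const)).sub (c₆.mul continuousOn_const)
  -- `(1 - θ) F'(θ) + F(θ)` is an antiderivative of `(1 - θ) F''(θ) = L I(θ)`
  set α : ℝ → ℝ := fun θ => -(L * u / (L + θ * u) ^ 2) with hα
  set β : ℝ → ℝ := fun θ => L * (-u₂ / (1 + (σ + θ * u₁) ^ 2)
        + 2 * (θ * u₂) * (σ + θ * u₁) * u₁ / (1 + (σ + θ * u₁) ^ 2) ^ 2) with hβ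
  have hder : ∀ θ ∈ uIcc (0 : ℝ) 1, HasDerivAt
      (fun θ => (1 - θ) * (α θ * fi θ + β θ * fn θ) + F θ) (L * I θ) θ := by
    intro θ hθ
    rw [uIcc_of_le zero_le_one] at hθ
    obtain ⟨h1, h2, h3⟩ := hF θ hθ (α θ) (β θ) rfl rfl
    have hzθ := (hz θ hθ).ne'
    have hpθ := (hp θ).ne'
    have dz : HasDerivAt (fun θ => L + θ * u) u θ := by
      simpa using ((hasDerivAt_id θ).mul_const u).const_add L
    have dp : HasDerivAt (fun θ => σ + θ * u₁) u₁ θ := by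
      simpa using ((hasDerivAt_id θ).mul_const u₁).const_add σ
    have dq : HasDerivAt (fun θ => θ * u₂) u₂ θ := by
      simpa using (hasDerivAt_id θ).mul_const u₂
    have dP : HasDerivAt (fun θ => 1 + (σ + θ * u₁) ^ 2) (2 * (σ + θ * u₁) * u₁) θ := by
      simpa using (dp.pow 2).const_add 1
    have dα : HasDerivAt α (2 * L * u ^ 2 / (L + θ * u) ^ 3) θ := by
      refine (((hasDerivAt_const θ (L * u)).div (dz.pow 2) (hzn 2 θ hθ)).neg).congr_deriv ?_
      simp only [Pi.pow_apply]
      field_simp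
      push_cast
      ring
    have dβ : HasDerivAt β (L * (4 * u₂ * (σ + θ * u₁) * u₁ / (1 + (σ + θ * u₁) ^ 2) ^ 2
        + 2 * (θ * u₂) * (1 - 3 * (σ + θ * u₁) ^ 2) * u₁ ^ 2
          / (1 + (σ + θ * u₁) ^ 2) ^ 3)) θ := by
      refine ((((hasDerivAt_const θ (-u₂)).div dP hpθ).add (((((dq.const_mul 2).mul dp).mul_const
        u₁).div (dP.pow 2) (hpn 2 θ hθ)))).const_mul L).congr_deriv ?_
      simp only [Pi.pow_apply, Pi.mul_apply]
      generalize hP : 1 + (σ + θ * u₁) ^ 2 = P at *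
      have hp2 : (σ + θ * u₁) ^ 2 = P - 1 := by linarith
      generalize σ + θ * u₁ = p at *
      field_simp
      push_cast
      ring_nf
      simp only [hp2]
      ring
    have d1 : HasDerivAt (fun θ : ℝ => 1 - θ) (-1) θ := by
      simpa using (hasDerivAt_id θ).const_sub 1
    refine ((d1.mul ((dα.mul h2).add (dβ.mul h3))).add h1).congr_deriv ?_
    simp only [hI, hI₁, hI₂, hI₃, hI₄, hI₅, hI₆, Pi.add_apply, Pi.mul_apply, hα, hβ]
    generalize hP : 1 + (σ + θ * u₁) ^ 2 = P at *
    generalize σ + θ * u₁ = p at *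
    generalize hZ : L + θ * u = z at *
    field_simp
    ring
  have hFTC := intervalIntegral.integral_eq_sub_of_hasDerivAt hder
    ((hII cI).const_mul L)
  rw [intervalIntegral.integral_const_mul, hint] at hFTC
  have h5 : α 0 = -(u / L) := by simp only [hα, zero_mul, add_zero]; field_simp
  have h6 : β 0 = -(L * u₂ / (1 + σ ^ 2)) := by simp only [hβ]; simp; ring
  simp only [h5, h6] at hFTC
  linear_combination -hFTC

section Reduction

variable {m : ℕ} {f : (Fin (m + 1) → ℝ) → ℝ} {K Ω : Set (Fin (m + 1) → ℝ)}

theorem hasDerivAt_comp_vec {h : (Fin (m + 1) → ℝ) → ℝ} {ω : ℝ → Fin (m + 1) → ℝ} {α β θ : ℝ}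
    (hω : HasDerivAt ω (vec m α β) θ) (hh : DifferentiableAt ℝ h (ω θ)) :
    HasDerivAt (fun θ => h (ω θ))
      (α * ∑ i : Fin m, pd i.castSucc h (ω θ) + β * pd (Fin.last m) h (ω θ)) θ := by
  rw [← fderiv_vec hh]
  exact hh.hasFDerivAt.comp_hasDerivAt θ hω

theorem HasDerivAt.vec {a b : ℝ → ℝ} {a' b' θ : ℝ} (ha : HasDerivAt a a' θ)
    (hb : HasDerivAt b b' θ) : HasDerivAt (fun θ => vec m (a θ) (b θ)) (vec m a' b') θ := by
  simp only [vec_eq]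
  exact (ha.smul_const _).add (hb.smul_const _)

theorem hasDerivAt_omega {σ R s θ : ℝ} {u : ℝ → ℝ} (hz : zz σ u s θ ≠ 0) :
    HasDerivAt (omega m σ R u s) (vec m (-(σ * s * u s / (σ * s + θ * u s) ^ 2))
      (σ * s * (-dd R 2 u s / (1 + (σ + θ * dd R 1 u s) ^ 2)
        + 2 * (θ * dd R 2 u s) * (σ + θ * dd R 1 u s) * dd R 1 u s
          / (1 + (σ + θ * dd R 1 u s) ^ 2) ^ 2))) θ := by
  have h : omega m σ R u s = fun θ => vec m (σ * s * (1 / (σ * s + θ * u s)))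
      (σ * s * (-(θ * dd R 2 u s) / (1 + (σ + θ * dd R 1 u s) ^ 2))) := by
    funext θ
    rw [omega, smul_vec]
    rfl
  rw [h]
  have hz' : σ * s + θ * u s ≠ 0 := hz
  have hp : 1 + (σ + θ * dd R 1 u s) ^ 2 ≠ 0 := by positivity
  have dz : HasDerivAt (fun θ => σ * s + θ * u s) (u s) θ := by
    simpa using ((hasDerivAt_id θ).mul_const (u s)).const_add (σ * s)
  have dp : HasDerivAt (fun θ => σ + θ * dd R 1 u s) (dd R 1 u s) θ := by
    simpa using ((hasDerivAt_id θ).mul_const (dd R 1 u s)).const_add σ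
  have dq : HasDerivAt (fun θ => θ * dd R 2 u s) (dd R 2 u s) θ := by
    simpa using (hasDerivAt_id θ).mul_const (dd R 2 u s)
  have dP : HasDerivAt (fun θ => 1 + (σ + θ * dd R 1 u s) ^ 2)
      (2 * (σ + θ * dd R 1 u s) * dd R 1 u s) θ := by
    simpa using (dp.pow 2).const_add 1
  refine HasDerivAt.vec ?_ ?_
  · refine (((hasDerivAt_const θ (1 : ℝ)).div dz hz').const_mul (σ * s)).congr_deriv ?_
    field_simp
    ring
  · refine ((dq.neg.div dP hp).const_mul (σ * s)).congr_deriv ?_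
    simp only [Pi.neg_apply]
    field_simp
    ring

/-- The reduced equation is the second-order Taylor expansion, with integral remainder, of the
self-shrinker equation along the segment from the cone to its solution. -/
theorem reduced_eq_of_shrinker_eq (hΩ : IsSymmHomogeneous Ω f) (hKo : IsOpen K) (hKΩ : K ⊆ Ω)
    (hf : ContDiffOn ℝ (2 : ℕ) f K) (hpos : 0 < pd (Fin.last m) f (vec m 1 0))
    {σ R s : ℝ} {u : ℝ → ℝ} (hσs : 0 < σ * s)
    (hz : ∀ θ ∈ Icc (0 : ℝ) 1, 0 < zz σ u s θ ∧ omega m σ R u s θ ∈ K)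
    (heq : f (vec m (1 / (σ * s + u s)) (-dd R 2 u s / (1 + (σ + dd R 1 u s) ^ 2)))
      + 1 / 2 * (s * dd R 1 u s - u s) = 0) :
    Lop m f σ R u s = (1 + σ ^ 2) / pd (Fin.last m) f (vec m 1 0) *
        (f (vec m 1 0) / (σ * s)
          - (∑ i : Fin m, pd i.castSucc f (vec m 1 0) / (σ ^ 2 * s ^ 2)) * u s
          + Qop m f σ R u s) := by
  have hdf : ∀ x ∈ K, DifferentiableAt ℝ f x := fun x hx =>
    (hf.contDiffAt (hKo.mem_nhds hx)).differentiableAt (by simp)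
  have hdp : ∀ i, ∀ x ∈ K, DifferentiableAt ℝ (pd i f) x := fun i x hx =>
    ((contDiffOn_pd (n := 1) hKo hf i).contDiffAt (hKo.mem_nhds hx)).differentiableAt (by simp)
  have hω : ContinuousOn (omega m σ R u s) (Icc 0 1) := fun θ hθ =>
    (hasDerivAt_omega (hz θ hθ).1.ne').continuousAt.continuousWithinAt
  have hcp : ∀ i j, ContinuousOn (fun θ => pd i (pd j f) (omega m σ R u s θ)) (Icc 0 1) :=
    fun i j => (contDiffOn_pd (n := 0) hKo (contDiffOn_pd (n := 1) hKo hf j) i).continuousOn.comp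
      hω fun θ hθ => (hz θ hθ).2
  have key := taylor_remainder (σ := σ) (u := u s) (u₁ := dd R 1 u s) (u₂ := dd R 2 u s) hσs
    (F := fun θ => f (omega m σ R u s θ))
    (fi := fun θ => ∑ i : Fin m, pd i.castSucc f (omega m σ R u s θ))
    (fn := fun θ => pd (Fin.last m) f (omega m σ R u s θ))
    (fnn := fun θ => pd (Fin.last m) (pd (Fin.last m) f) (omega m σ R u s θ))
    (fni := fun θ => ∑ i : Fin m, pd (Fin.last m) (pd i.castSucc f) (omega m σ R u s θ))
    (fij := fun θ => ∑ i : Fin m, ∑ j : Fin m,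
      pd i.castSucc (pd j.castSucc f) (omega m σ R u s θ))
    (fun θ hθ => (hz θ hθ).1) ?_ (hcp _ _) (continuousOn_finsetSum _ fun i _ => hcp _ _)
    (continuousOn_finsetSum _ fun i _ => continuousOn_finsetSum _ fun j _ => hcp _ _)
  · have h0 : omega m σ R u s 0 = vec m 1 0 := by
      rw [omega, smul_vec]
      simp only [zz, qq, zero_mul, add_zero, neg_zero, zero_div, mul_zero]
      rw [mul_one_div_cancel hσs.ne']
    have h1 : f (omega m σ R u s 1) = σ * s * (-(1 / 2 * (s * dd R 1 u s - u s))) := by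
      have hmem := hKΩ (hz 1 ⟨zero_le_one, le_rfl⟩).2
      rw [omega] at hmem ⊢
      have h2 := hΩ.smul_mem _ hmem (σ * s)⁻¹ (inv_pos.2 hσs)
      rw [smul_smul, inv_mul_cancel₀ hσs.ne', one_smul] at h2
      rw [hΩ.map_smul _ h2 _ hσs]
      simp only [zz, qq, pp, one_mul]
      rw [eq_neg_of_add_eq_zero_left heq]
    simp only [h0, h1] at key
    rw [show Qop m f σ R u s = ((s * dd R 1 u s - u s) * (-1 / 2) - f (vec m 1 0) / (σ * s)
      + u s / (σ * s) ^ 2 * ∑ i : Fin m, pd i.castSucc f (vec m 1 0)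
      + dd R 2 u s / (1 + σ ^ 2) * pd (Fin.last m) f (vec m 1 0)) from ?_]
    · rw [Lop, ← Finset.sum_div]
      have : 1 + σ ^ 2 ≠ 0 := by positivity
      have hs := right_ne_zero_of_mul hσs.ne'
      have hσ := left_ne_zero_of_mul hσs.ne'
      field_simp
      ring
    · have hk : σ * s * Qop m f σ R u s = σ * s * (-(1 / 2 * (s * dd R 1 u s - u s)))
        - (f (vec m 1 0) - u s / (σ * s) * ∑ i : Fin m, pd i.castSucc f (vec m 1 0)
          - σ * s * dd R 2 u s / (1 + σ ^ 2) * pd (Fin.last m) f (vec m 1 0)) := by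
        rw [key, add_sub_cancel_left]
        rfl
      rw [eq_comm, ← mul_right_inj' hσs.ne', hk]
      have : 1 + σ ^ 2 ≠ 0 := by positivity
      have hs := right_ne_zero_of_mul hσs.ne'
      have hσ := left_ne_zero_of_mul hσs.ne'
      field_simp
      ring
  · rintro θ hθ α β rfl rfl
    have hd := hasDerivAt_omega (m := m) (R := R) (hz θ hθ).1.ne'
    have hK := (hz θ hθ).2
    refine ⟨hasDerivAt_comp_vec hd (hdf _ hK), ?_, ?_⟩
    · have h := HasDerivAt.fun_sum (u := Finset.univ) fun (i : Fin m) _ =>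
        hasDerivAt_comp_vec hd (hdp i.castSucc _ hK)
      refine h.congr_deriv ?_
      rw [Finset.sum_add_distrib, ← Finset.mul_sum, ← Finset.mul_sum, Finset.sum_comm]
    · refine (hasDerivAt_comp_vec hd (hdp (Fin.last m) _ hK)).congr_deriv ?_
      simp only [pd_pd_comm hKo hf hK (Fin.last m)]

end Reduction

/-! ### Existence of the radius function -/

/-- The half-line on which the solution lives depends on `f` only through a radius `δ` of a ball
in `K` and the bound `B`. -/
theorem exists_radialSol (m k : ℕ) (hk : 3 ≤ k) {σ δ κ : ℝ} (hσ : 0 < σ) (hδ : 0 < δ)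
    (hκ : 0 < κ) (B : ℝ≥0) : ∃ R, 1 ≤ R ∧
      ∀ (K : Set (Fin (m + 1) → ℝ)) (f : (Fin (m + 1) → ℝ) → ℝ) (A : ℝ≥0), IsOpen K →
        Metric.ball (vec m 1 0) δ ⊆ K → ContDiffOn ℝ (k + 1 : ℕ) f K →
        (∀ x ∈ K, 0 < pd (Fin.last m) f x) → cNorm k K f ≤ A → cNorm (k + 1) K f ≤ B →
        ∃ d : RadialSol k σ A, d.R = R ∧ d.c = f (vec m 1 0) ∧ ∀ s, R < s →
          d.γ 0 s = profile m f (d.η s / s ^ 2) ∧ |d.η s / s ^ 2| < δ ∧ |d.η s / s ^ 2| ≤ κ ∧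
          |d.W s - σ ^ 2| ≤ κ ∧ |(s ^ 2)⁻¹ * d.γ 0 s| ≤ κ := by
  obtain ⟨R, hR, H⟩ := exists_small_solution hσ B.coe_nonneg hδ
    (lt_min hκ (by positivity : (0 : ℝ) < 1 / (4 * (k + 3))))
  refine ⟨R, hR, fun K f A hKo hball hf hpos hA hB => ?_⟩
  have hmem : ∀ y ∈ Ioo (-δ) δ, vec m 1 y ∈ K := fun y hy =>
    vec_mem_of_close hδ hball (by simpa using hδ) (abs_lt.2 hy)
  have hder := iteratedDeriv_profile hKo hf hmem
  have hG1 : ∀ y ∈ Ioo (-δ) δ, 0 < iteratedDeriv 1 (profile m f) y := fun y hy => by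
    rw [iteratedDeriv_one_profile hKo hf hmem hy]
    exact hpos _ (hmem y hy)
  obtain ⟨W, y, Z, hWlim, ⟨M, hM⟩, hsol⟩ := H (fun l => iteratedDeriv l (profile m f))
    (fun i hi y hy => (hder i (by omega) y hy).2 (by omega)) hG1
    (fun i hi y hy => abs_iteratedDeriv_profile_le hKo hf hmem hB (by omega) (by omega) hy)
  have hs0 : ∀ s, R < s → s ≠ 0 := fun s hs => by linarith
  have hyI : ∀ s, R < s → y s ∈ Icc (-(δ / 2)) (δ / 2) := fun s hs => abs_le.1 (hsol s hs).1
  have hIcc : Icc (-(δ / 2)) (δ / 2) ⊆ Ioo (-δ) δ := fun t ht =>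
    ⟨by linarith [ht.1], by linarith [ht.2]⟩
  have hy : ∀ s, R < s → y s ∈ Ioo (-δ) δ := fun s hs => hIcc (hyI s hs)
  have hdiv : ∀ s, R < s → s ^ 2 * y s / s ^ 2 = y s := fun s hs =>
    mul_div_cancel_left₀ _ (pow_ne_zero 2 (hs0 s hs))
  obtain ⟨C, hC⟩ : ∃ C, ∀ t ∈ Icc (-(δ / 2)) (δ / 2),
      |(iteratedDeriv 1 (profile m f) t)⁻¹| ≤ C := by
    refine (isCompact_Icc.exists_bound_of_continuousOn (f := fun t =>
      (iteratedDeriv 1 (profile m f) t)⁻¹) fun t ht => ?_)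
    have ht' := hIcc ht
    exact ((hder 1 (by omega) t ht').2 (by omega)).continuousAt.continuousWithinAt.inv₀
      (hG1 t ht').ne'
  refine ⟨{ R := R
            γ := fun l s => iteratedDeriv l (profile m f) (y s)
            c := f (vec m 1 0)
            W := W
            η := fun s => s ^ 2 * y s
            Z := Z
            one_le := hR
            Z_eq := fun s hs => (hsol s hs).2.2.2.2.2.1
            hη := fun s hs => ?_
            hW := fun s hs => (hsol s hs).2.2.2.2.2.2.1
            hγ := fun l hl s hs => ?_
            γ_le := fun l hl s hs =>
              abs_iteratedDeriv_profile_le hKo hf hmem hA hl (by omega) (hy s hs)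
            γ_one_pos := fun s hs => hG1 _ (hy s hs)
            γ_one_inv_le := ⟨C, fun s hs => hC _ (hyI s hs)⟩
            γ_top_le := ⟨B, fun s hs =>
              abs_iteratedDeriv_profile_le hKo hf hmem hB le_rfl le_rfl (hy s hs)⟩
            γ_sub_le := fun s hs => ?_
            η_le := ⟨M, hM⟩
            W_near := fun s hs => (hsol s hs).2.2.2.1
            W_lim := hWlim
            small := fun s hs => (hsol s hs).2.2.2.2.2.2.2.2.trans (min_le_right _ _) },
    rfl, rfl, fun s hs => ⟨?_, ?_, ?_, ?_, ?_⟩⟩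
  · have hd := (hsol s hs).2.2.2.2.2.2.2.1
    have h := hs0 s hs
    refine ((hasDerivAt_pow 2 s).mul hd).congr_deriv ?_
    field_simp
    push_cast
    ring
  · exact (((hder l (by omega) _ (hy s hs)).2 hl).comp s
      (hsol s hs).2.2.2.2.2.2.2.1).congr_deriv (by ring)
  · have h := (convex_Ioo (-δ) δ).norm_image_sub_le_of_norm_hasDerivWithin_le
      (f := iteratedDeriv 0 (profile m f)) (f' := iteratedDeriv 1 (profile m f)) (C := A)
      (x := 0) (y := y s)
      (fun t ht => ((hder 0 (by omega) t ht).2 (by omega)).hasDerivWithinAt)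
      (fun t ht => abs_iteratedDeriv_profile_le hKo hf hmem hA (by omega) (by omega) ht)
      ⟨by linarith, hδ⟩ (hy s hs)
    have h0 : iteratedDeriv 0 (profile m f) 0 = f (vec m 1 0) := by simp [profile]
    have h1 : (s ^ 2)⁻¹ * |s ^ 2 * y s| = |y s| := by
      have := hs0 s hs
      rw [abs_mul, abs_of_nonneg (sq_nonneg s)]
      field_simp
    rw [h0, sub_zero] at h
    rw [h1]
    exact h
  all_goals simp only [hdiv s hs, iteratedDeriv_zero]
  · exact abs_lt.2 (hy s hs)
  · exact (hsol s hs).2.1.trans (min_le_left _ _)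
  · exact (hsol s hs).2.2.1.trans (min_le_left _ _)
  · have := (hsol s hs).2.2.2.2.1.trans (min_le_left _ _)
    simpa using this

/-- Closeness to the cone, in the quantities `W`, `y`, `γ₀`, that keeps `ω` in a ball of radius
`δ`. -/
theorem exists_closeness {σ δ : ℝ} (hσ : 0 < σ) (hδ : 0 < δ) : ∃ κ, 0 < κ ∧
    ∀ (m k : ℕ) (A : ℝ) (d : RadialSol k σ A) (R : ℝ), 3 ≤ k → d.R < R → ∀ s, R ≤ s →
      |d.η s / s ^ 2| ≤ κ → |d.W s - σ ^ 2| ≤ κ → |(s ^ 2)⁻¹ * d.γ 0 s| ≤ κ →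
      ∀ θ ∈ Icc (0 : ℝ) 1, 0 < zz σ d.u s θ ∧
        ∀ K, Metric.ball (vec m 1 0) δ ⊆ K → omega m σ R d.u s θ ∈ K := by
  refine ⟨min (σ ^ 2 / 4) (min (δ * σ ^ 2 / 4) (δ / (4 * (1 + 9 * σ ^ 2)))), by positivity, ?_⟩
  intro m k A d R hk hR s hs hy hW hγ θ hθ
  set κ := min (σ ^ 2 / 4) (min (δ * σ ^ 2 / 4) (δ / (4 * (1 + 9 * σ ^ 2)))) with hκ
  have k1 : κ ≤ σ ^ 2 / 4 := min_le_left _ _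
  have k2 : κ ≤ δ * σ ^ 2 / 4 := (min_le_right _ _).trans (min_le_left _ _)
  have k3 : κ ≤ δ / (4 * (1 + 9 * σ ^ 2)) := (min_le_right _ _).trans (min_le_right _ _)
  have hRs : d.R < s := hR.trans_le hs
  have hs0 := d.pos_of_lt hRs
  have hWp := d.W_pos hσ hRs
  have hq : 0 < √(d.W s) := Real.sqrt_pos.2 hWp
  have hqq := d.sqrt_W_mul_self hσ hRs
  set q := √(d.W s) with hqdef
  obtain ⟨hW1, hW2⟩ := abs_le.1 hW
  have hσ2 : 0 < σ ^ 2 := by positivity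
  have hq1 : σ / 2 ≤ q := by
    by_contra! h
    nlinarith
  have hq2 : q ≤ 2 * σ := by
    by_contra! h
    nlinarith
  -- the slope stays bounded
  have hsl : d.slope s ^ 2 ≤ 9 * σ ^ 2 := by
    have h1 : |2 * ((s ^ 2)⁻¹ * d.γ 0 s) / q| ≤ σ := by
      rw [abs_div, abs_of_pos hq, div_le_iff₀ hq, abs_mul, abs_two]
      nlinarith
    obtain ⟨h2, h3⟩ := abs_le.1 h1
    have h4 : d.slope s = q - 2 * ((s ^ 2)⁻¹ * d.γ 0 s) / q := rfl
    rw [h4]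
    nlinarith
  have hv : |q - σ| ≤ κ / σ := by
    rw [le_div_iff₀ hσ]
    have h1 : |q - σ| * (q + σ) = |d.W s - σ ^ 2| := by
      rw [← hqq, ← abs_of_pos (add_pos hq hσ), ← abs_mul]
      congr 1; ring
    nlinarith [abs_nonneg (q - σ)]
  have hκσ : κ / σ ≤ σ / 4 := by
    rw [div_le_iff₀ hσ]; nlinarith
  have hθv : |θ * (q - σ)| ≤ κ / σ := by
    rw [abs_mul, abs_of_nonneg hθ.1]
    exact (mul_le_of_le_one_left (abs_nonneg _) hθ.2).trans hv
  have hz2 : σ / 2 ≤ σ + θ * (q - σ) := by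
    have := (abs_le.1 hθv).1
    linarith
  have hz : zz σ d.u s θ = s * (σ + θ * (q - σ)) := by
    simp only [zz, RadialSol.u]; ring
  have hz0 : 0 < σ + θ * (q - σ) := by linarith
  refine ⟨by rw [hz]; positivity, fun K hK => ?_⟩
  rw [omega, smul_vec]
  refine vec_mem_of_close hδ hK ?_ ?_
  · have h1 : σ * s * (1 / zz σ d.u s θ) - 1 = -(θ * (q - σ)) / (σ + θ * (q - σ)) := by
      rw [hz]; field_simp; ring
    rw [h1, abs_div, abs_neg, abs_of_pos hz0, div_lt_iff₀ hz0]
    have h2 : κ / σ ≤ δ * σ / 4 := by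
      rw [div_le_iff₀ hσ]; nlinarith
    have h3 : δ * (σ / 2) ≤ δ * (σ + θ * (q - σ)) := mul_le_mul_of_nonneg_left hz2 hδ.le
    have h4 : 0 < δ * σ := by positivity
    linarith
  · have h2 : dd R 2 d.u s = -(1 + d.slope s ^ 2) * (d.η s / s ^ 2) / (s * q) := by
      rw [d.dd_u hσ hR (by omega) hs, d.iteratedDeriv_two_u hσ hRs]
    simp only [qq, pp, h2]
    set P := 1 + (σ + θ * dd R 1 d.u s) ^ 2 with hP
    have hP1 : 1 ≤ P := le_add_of_nonneg_right (sq_nonneg _)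
    generalize d.η s / s ^ 2 = y at *
    have h3 : σ * s * (-(θ * (-(1 + d.slope s ^ 2) * y / (s * q))) / P)
        = θ * (σ / q) * (1 + d.slope s ^ 2) * y / P := by
      field_simp
    have h4 : σ / q ≤ 2 := by rw [div_le_iff₀ hq]; linarith
    have h4' : 0 ≤ σ / q := by positivity
    have h5 : |θ * (σ / q) * (1 + d.slope s ^ 2) * y| ≤ 1 * 2 * (1 + 9 * σ ^ 2) * κ := by
      rw [abs_mul, abs_of_nonneg (mul_nonneg (mul_nonneg hθ.1 h4') (by positivity))]
      gcongr
      exact hθ.2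
    rw [h3, abs_div, abs_of_pos (by linarith : 0 < P)]
    refine (div_le_self (abs_nonneg _) hP1).trans_lt (h5.trans_lt ?_)
    have h6 : (0 : ℝ) < 1 + 9 * σ ^ 2 := by positivity
    rw [le_div_iff₀ (by positivity)] at k3
    nlinarith

/-! ### Weighted norms and blow-down -/

theorem supNorm_le_of_abs_le {R C : ℝ} {g : ℝ → ℝ} (h : ∀ s, R ≤ s → |g s| ≤ C) :
    supNorm R g ≤ C.toNNReal := by
  refine iSup₂_le fun s hs => ?_
  rw [Real.enorm_eq_ofReal_abs]
  exact ENNReal.ofReal_le_ofReal (h s hs)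

theorem mem_C0k_of_bound {R₁ R C : ℝ} (h1 : 1 ≤ R₁) (hR : R₁ < R) {k : ℕ} {v : ℝ → ℝ}
    (hv : ContDiffOn ℝ k v (Ioi R₁))
    (hb : ∀ s, R₁ < s → ∀ j ≤ k, |s ^ (1 + j) * iteratedDeriv j v s| ≤ C) : v ∈ C0k k R := by
  refine ⟨hv.mono fun s hs => hR.trans_le hs, fun j hj => ?_⟩
  refine squeeze_zero_norm' ?_ (tendsto_const_nhds.div_atTop tendsto_id : Tendsto
    (fun s : ℝ => C / s) atTop (𝓝 0))
  filter_upwards [eventually_ge_atTop R] with s hs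
  have hs1 : 1 ≤ s := by linarith
  have h := hb s (hR.trans_le hs) j hj
  rw [dd_eq_iteratedDeriv hR hv hj hs, Real.norm_eq_abs, le_div_iff₀ (by linarith), mul_comm]
  rw [abs_mul, abs_of_nonneg (by positivity)] at h
  refine le_trans (mul_le_mul_of_nonneg_right ?_ (abs_nonneg _)) h
  rw [pow_add, pow_one]
  exact le_mul_of_one_le_right (by linarith) (one_le_pow₀ hs1)

theorem mem_imSpace_of_bound {R₁ R C : ℝ} (h1 : 1 ≤ R₁) (hR : R₁ < R) {k : ℕ} {v : ℝ → ℝ}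
    (hv : ContDiffOn ℝ k v (Ioi R₁))
    (hb : ∀ s, R₁ < s → ∀ j ≤ k, |s ^ (1 + j) * iteratedDeriv j v s| ≤ C) :
    v ∈ imSpace k R := by
  refine ⟨mem_C0k_of_bound h1 hR hv hb, lt_of_le_of_lt (max_le (iSup₂_le fun j hj =>
    supNorm_le_of_abs_le (C := C) fun s hs => ?_) (supNorm_le_of_abs_le (C := C) fun s hs => ?_))
    ENNReal.coe_lt_top⟩
  · have hj := Finset.mem_range.1 hj
    rw [dd_eq_iteratedDeriv hR hv hj.le hs, add_comm j 1]
    exact hb s (hR.trans_le hs) j hj.le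
  · have hs1 : 1 ≤ s := by linarith
    have h := hb s (hR.trans_le hs) k le_rfl
    rw [dd_eq_iteratedDeriv hR hv le_rfl hs]
    refine le_trans ?_ h
    rw [abs_mul, abs_mul, abs_of_nonneg (by positivity : 0 ≤ s ^ k),
      abs_of_nonneg (by positivity : 0 ≤ s ^ (1 + k))]
    exact mul_le_mul_of_nonneg_right (pow_le_pow_right₀ hs1 (by omega)) (abs_nonneg _)

/-- No regularity of `v` is needed, since both sides are `0` together where a derivative does not
exist. -/
theorem iteratedDeriv_rescale (v : ℝ → ℝ) (ϱ : ℝ) (j : ℕ) (s : ℝ) :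
    iteratedDeriv j (fun x => ϱ * v (x / ϱ)) s = ϱ * ϱ⁻¹ ^ j * iteratedDeriv j v (s / ϱ) := by
  induction j generalizing s with
  | zero => simp
  | succ j ih =>
    have h : iteratedDeriv j (fun x => ϱ * v (x / ϱ))
        = fun s => ϱ * ϱ⁻¹ ^ j * iteratedDeriv j v (ϱ⁻¹ * s) :=
      funext fun s => by rw [ih, div_eq_inv_mul]
    rw [iteratedDeriv_succ, h, deriv_const_mul_field,
      deriv_comp_mul_left ϱ⁻¹ (iteratedDeriv j v), iteratedDeriv_succ, smul_eq_mul,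
      div_eq_inv_mul, pow_succ]
    ring

/-- The blow-downs `ϱ r(s / ϱ)` of `r = σ s + v` converge at the rate `ϱ²`. -/
theorem ckAsymptotic_of_bound {R₁ R C σ : ℝ} (hR : R₁ < R) {k : ℕ} {v : ℝ → ℝ}
    (hv : ContDiffOn ℝ k v (Ioi R₁))
    (hb : ∀ s, R₁ < s → ∀ j ≤ k, |s ^ (1 + j) * iteratedDeriv j v s| ≤ C) :
    CkAsymptotic k σ R (fun s => σ * s + v s) := by
  intro T hT hT0 j hj
  obtain ⟨t₀, ht₀, hTt⟩ : ∃ t₀, 0 < t₀ ∧ ∀ s ∈ T, t₀ ≤ s := by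
    rcases T.eq_empty_or_nonempty with rfl | hne
    · exact ⟨1, one_pos, fun s hs => hs.elim⟩
    · obtain ⟨t, ht, hmin⟩ := hT.exists_isMinOn hne continuousOn_id
      exact ⟨t, hT0 ht, fun s hs => hmin hs⟩
  have hC : 0 ≤ C := (abs_nonneg _).trans (hb R hR 0 (Nat.zero_le _))
  rw [Metric.tendstoUniformlyOn_iff]
  intro ε hε
  have e1 : ∀ᶠ ϱ : ℝ in 𝓝[>] 0, ϱ * R < t₀ := by
    have : Tendsto (fun ϱ : ℝ => ϱ * R) (𝓝[>] 0) (𝓝 0) := by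
      refine Tendsto.mono_left ?_ nhdsWithin_le_nhds
      exact (continuous_id.mul continuous_const).tendsto' _ _ (by simp)
    exact this.eventually_lt_const ht₀
  have e2 : ∀ᶠ ϱ : ℝ in 𝓝[>] 0, C * ϱ ^ 2 / t₀ ^ (1 + j) < ε := by
    have : Tendsto (fun ϱ : ℝ => C * ϱ ^ 2 / t₀ ^ (1 + j)) (𝓝[>] 0) (𝓝 0) := by
      refine Tendsto.mono_left ?_ nhdsWithin_le_nhds
      exact ((continuous_const.mul (continuous_pow 2)).div_const _).tendsto' _ _ (by simp)
    exact this.eventually_lt_const hε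
  filter_upwards [e1, e2, self_mem_nhdsWithin] with ϱ he1 he2 hϱ s hs
  have hϱ0 : 0 < ϱ := hϱ
  have hs0 : t₀ ≤ s := hTt s hs
  have hfun : (fun x => ϱ * (σ * (x / ϱ) + v (x / ϱ)) - σ * x) = fun x => ϱ * v (x / ϱ) := by
    funext x; field_simp; ring
  have hcd : ContDiffOn ℝ k (fun x => ϱ * v (x / ϱ)) (Ioi (ϱ * R₁)) :=
    contDiffOn_const.mul (hv.comp (contDiffOn_id.div_const ϱ) fun x hx =>
      (lt_div_iff₀' hϱ0).2 hx)
  have hsR : R₁ < s / ϱ := (lt_div_iff₀' hϱ0).2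
    (((mul_lt_mul_iff_right₀ hϱ0).2 hR).trans (he1.trans_le hs0))
  have h := hb _ hsR j hj
  rw [dist_comm, Real.dist_eq, sub_zero, hfun,
    dd_eq_iteratedDeriv ((mul_lt_mul_iff_right₀ hϱ0).2 hR) hcd hj (by linarith),
    iteratedDeriv_rescale]
  have hsp : 0 < s := ht₀.trans_le hs0
  have h2 : ϱ * ϱ⁻¹ ^ j * iteratedDeriv j v (s / ϱ)
      = ϱ ^ 2 / s ^ (1 + j) * ((s / ϱ) ^ (1 + j) * iteratedDeriv j v (s / ϱ)) := by
    rw [div_pow, inv_pow, pow_add, pow_add, pow_one, pow_one]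
    field_simp
  rw [h2, abs_mul, abs_of_pos (by positivity)]
  refine lt_of_le_of_lt ?_ he2
  calc _ ≤ ϱ ^ 2 / t₀ ^ (1 + j) * C := by gcongr
    _ = _ := by ring

/-! ### The equations in terms of `r` -/

namespace RadialSol

variable {k : ℕ} {σ A : ℝ}

theorem hasDerivAt_r (hσ : 0 < σ) (d : RadialSol k σ A) {s : ℝ} (hs : d.R < s) :
    HasDerivAt (fun s => σ * s + d.u s) (d.slope s) s :=
  (((hasDerivAt_id s).const_mul σ).add (d.hasDerivAt_u hσ hs)).congr_deriv (by ring)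

theorem dd_r (hσ : 0 < σ) (hk : 3 ≤ k) (d : RadialSol k σ A) {R s : ℝ} (hR : d.R < R)
    (hs : R ≤ s) : dd R 1 (fun s => σ * s + d.u s) s = d.slope s ∧
      dd R 2 (fun s => σ * s + d.u s) s = dd R 2 d.u s := by
  have hRs := hR.trans_le hs
  have hcd : ContDiffOn ℝ k (fun s => σ * s + d.u s) (Ioi d.R) :=
    (contDiffOn_const.mul contDiffOn_id).add (d.contDiffOn_u hσ)
  rw [dd_eq_iteratedDeriv hR hcd (by omega) hs, dd_eq_iteratedDeriv hR hcd (by omega) hs,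
    d.dd_u hσ hR (by omega) hs, d.iteratedDeriv_two_u hσ hRs, iteratedDeriv_one,
    iteratedDeriv_succ, iteratedDeriv_one]
  refine ⟨(d.hasDerivAt_r hσ hRs).deriv, ?_⟩
  have h : deriv (fun s => σ * s + d.u s) =ᶠ[𝓝 s] d.slope :=
    (eventually_gt_nhds hRs).mono fun t ht => (d.hasDerivAt_r hσ ht).deriv
  rw [h.deriv_eq]
  exact (d.hasDerivAt_slope hσ hRs).deriv

theorem solvesShrinker {m : ℕ} {Ω : Set (Fin (m + 1) → ℝ)} {f : (Fin (m + 1) → ℝ) → ℝ}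
    (hσ : 0 < σ) (hk : 3 ≤ k) (hΩ : IsSymmHomogeneous Ω f) (d : RadialSol k σ A) {R : ℝ}
    (hR : d.R < R) (hγ : ∀ s, R ≤ s → d.γ 0 s = profile m f (d.η s / s ^ 2) ∧
      vec m 1 (d.η s / s ^ 2) ∈ Ω) :
    SolvesShrinker m Ω f R (fun s => σ * s + d.u s) := by
  intro s hs
  obtain ⟨h1, h2⟩ := d.dd_r hσ hk hR hs
  obtain ⟨h3, h4⟩ := hγ s hs
  have hRs := hR.trans_le hs
  have hs0 := d.pos_of_lt hRs
  have hq : 0 < √(d.W s) := Real.sqrt_pos.2 (d.W_pos hσ hRs)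
  have hr : σ * s + d.u s = s * √(d.W s) := by simp only [u]; ring
  have hP : 1 + d.slope s ^ 2 ≠ 0 := by positivity
  simp only [h1, h2, hr, d.dd_u hσ hR (by omega : 2 ≤ k) hs, d.iteratedDeriv_two_u hσ hRs]
  have hy : -(-(1 + d.slope s ^ 2) * (d.η s / s ^ 2) / (s * √(d.W s))) / (1 + d.slope s ^ 2)
      / (1 / (s * √(d.W s))) = d.η s / s ^ 2 := by
    field_simp
  have hv := hΩ.apply_vec (a := 1 / (s * √(d.W s)))
    (b := -(-(1 + d.slope s ^ 2) * (d.η s / s ^ 2) / (s * √(d.W s))) / (1 + d.slope s ^ 2))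
    (by positivity) (by rw [hy]; exact h4)
  refine ⟨by positivity, hv.1, ?_⟩
  rw [hv.2, hy, ← h3, slope]
  field_simp
  ring

end RadialSol

end FShrinker

theorem theoremt31 (m k : ℕ) (hk : 3 ≤ k) (σ : ℝ) (hσ : 0 < σ) :
    ∃ (C₁ : ℝ≥0 → ℝ≥0) (C₂ : Set (Fin (m + 1) → ℝ) → ℝ≥0 → ℝ≥0)
      (R₀ : Set (Fin (m + 1) → ℝ) → ℝ≥0 → ℝ),
      ∀ (Ω K : Set (Fin (m + 1) → ℝ)) (f : (Fin (m + 1) → ℝ) → ℝ) (A B : ℝ≥0),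
        FShrinker.IsSymmHomogeneous Ω f →
        IsOpen K → Bornology.IsBounded K → FShrinker.vec m 1 0 ∈ K → K ⊆ Ω →
        ContDiffOn ℝ (k + 1 : ℕ) f K →
        (∀ x ∈ K, ∀ i, 0 < FShrinker.pd i f x) →
        FShrinker.cNorm k K f ≤ A →
        FShrinker.cNorm (k + 1) K f ≤ B →
        ∃ R : ℝ, R = R₀ K B ∧ 1 ≤ R ∧
          ∃ u ∈ FShrinker.imSpace k R,
            (∀ s ∈ Ici R, ∀ θ ∈ Icc (0 : ℝ) 1,
              0 < FShrinker.zz σ u s θ ∧ FShrinker.omega m σ R u s θ ∈ K) ∧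
            FShrinker.SolvesReduced m f σ R u ∧
            (∃ u₀ ∈ FShrinker.C0k k R,
              (∀ s ∈ Ici R, u s = f (FShrinker.vec m 1 0) / (σ * s) + u₀ s) ∧
              ∑ j ∈ Finset.range k,
                FShrinker.supNorm R (fun s => s ^ (j + 3) * FShrinker.dd R j u₀ s) ≤ C₁ A ∧
              FShrinker.supNorm R (fun s => s ^ (k + 1) * FShrinker.dd R k u₀ s) ≤ C₂ K A) ∧
            FShrinker.SolvesShrinker m Ω f R (fun s => σ * s + u s) ∧
            FShrinker.CkAsymptotic k σ R (fun s => σ * s + u s) := by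
  have hδ : ∀ K : Set (Fin (m + 1) → ℝ), ∃ δ : ℝ, 0 < δ ∧
      (IsOpen K → FShrinker.vec m 1 0 ∈ K → Metric.ball (FShrinker.vec m 1 0) δ ⊆ K) := by
    intro K
    by_cases h : IsOpen K ∧ FShrinker.vec m 1 0 ∈ K
    · obtain ⟨δ, hδ, hb⟩ := Metric.isOpen_iff.1 h.1 _ h.2
      exact ⟨δ, hδ, fun _ _ => hb⟩
    · exact ⟨1, one_pos, fun h1 h2 => (h ⟨h1, h2⟩).elim⟩
  choose δ hδ hball using hδ
  -- the arbitrary radius on sets `K` that are not neighbourhoods of `(1, …, 1, 0)` is never used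
  choose κ hκ hclose using fun K => FShrinker.exists_closeness hσ (hδ K)
  choose R₁ hR₁ hsol using fun K B => FShrinker.exists_radialSol m k hk hσ (hδ K) (hκ K) B
  choose C hC hbound using fun A : ℝ≥0 => FShrinker.RadialSol.exists_bound k σ A hσ hk
  -- the solution lives beyond `R₁`, so that on `[R₁ + 1, ∞)` one-sided derivatives are ordinary ones
  refine ⟨fun A => k * (C A).toNNReal, fun _ A => (C A).toNNReal, fun K B => R₁ K B + 1, ?_⟩
  intro Ω K f A B hΩ hKo _ hvec hKΩ hf hpd hA hB
  have hbK := hball K hKo hvec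
  obtain ⟨d, hdR, hdc, hd⟩ := hsol K B K f A hKo hbK hf (fun x hx => hpd x hx _) hA hB
  have h1 : 1 ≤ R₁ K B := hR₁ K B
  have h1d : 1 ≤ d.R := d.one_le
  obtain ⟨R, hRdef⟩ : ∃ R, R = R₁ K B + 1 := ⟨_, rfl⟩
  have hR : d.R < R := by rw [hdR, hRdef]; linarith
  refine ⟨R, hRdef, by linarith, d.u, ?_⟩
  have hds : ∀ s, R ≤ s → _ := fun s hs => hd s (hdR ▸ hR.trans_le hs)
  have hu := d.contDiffOn_u hσ
  have hu₀ := d.contDiffOn_u₀ hσ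
  have hbu : ∀ s, d.R < s → ∀ j ≤ k, |s ^ (1 + j) * iteratedDeriv j d.u s| ≤ C A :=
    fun s hs => (hbound A d s hs).1
  have hbu₀ : ∀ s, d.R < s → ∀ j ≤ k, |s ^ (1 + j) * iteratedDeriv j d.u₀ s| ≤ C A := by
    intro s hs j hj
    rcases hj.lt_or_eq with hj | rfl
    · refine le_trans ?_ ((hbound A d s hs).2.1 j hj)
      have hs1 : 1 ≤ s := h1d.trans hs.le
      rw [abs_mul, abs_mul, abs_of_nonneg (by positivity : 0 ≤ s ^ (1 + j)),
        abs_of_nonneg (by positivity : 0 ≤ s ^ (3 + j))]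
      exact mul_le_mul_of_nonneg_right (pow_le_pow_right₀ hs1 (by omega)) (abs_nonneg _)
    · exact (hbound A d s hs).2.2
  have hω : ∀ s ∈ Ici R, ∀ θ ∈ Icc (0 : ℝ) 1,
      0 < FShrinker.zz σ d.u s θ ∧ FShrinker.omega m σ R d.u s θ ∈ K := fun s hs θ hθ => by
    obtain ⟨_, _, h3, h4, h5⟩ := hds s hs
    have h := hclose K m k A d R hk hR s hs h3 h4 h5 θ hθ
    exact ⟨h.1, h.2 K hbK⟩
  have hshr : FShrinker.SolvesShrinker m Ω f R (fun s => σ * s + d.u s) :=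
    d.solvesShrinker hσ hk hΩ hR fun s hs => ⟨(hds s hs).1,
      hKΩ (FShrinker.vec_mem_of_close (hδ K) hbK (by simpa using hδ K) (hds s hs).2.1)⟩
  refine ⟨FShrinker.mem_imSpace_of_bound h1d hR hu hbu, hω, fun s hs => ?_,
    ⟨d.u₀, FShrinker.mem_C0k_of_bound h1d hR hu₀ hbu₀, fun s _ => ?_, ?_, ?_⟩, hshr,
    FShrinker.ckAsymptotic_of_bound hR hu hbu⟩
  · have hs0 : 0 < s := d.pos_of_lt (hR.trans_le hs)
    refine FShrinker.reduced_eq_of_shrinker_eq hΩ hKo hKΩ (hf.of_le (by norm_cast; omega))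
      (hpd _ hvec _) (mul_pos hσ hs0) (hω s hs) ?_
    have h := (hshr s hs).2.2
    obtain ⟨e1, e2⟩ := d.dd_r hσ hk hR hs
    have e3 : d.slope s = σ + FShrinker.dd R 1 d.u s := by
      rw [d.dd_u hσ hR (by omega) hs, d.iteratedDeriv_one_u hσ (hR.trans_le hs)]; ring
    rw [e1, e2, e3] at h
    rw [← h]
    ring
  · simp only [FShrinker.RadialSol.u₀, hdc]; ring
  · have hsum : ∀ j ∈ Finset.range k, FShrinker.supNorm R
        (fun s => s ^ (j + 3) * FShrinker.dd R j d.u₀ s) ≤ (C A).toNNReal := fun j hj =>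
      FShrinker.supNorm_le_of_abs_le fun s hs => by
        have hj := Finset.mem_range.1 hj
        rw [FShrinker.dd_eq_iteratedDeriv hR hu₀ hj.le hs, add_comm j 3]
        exact (hbound A d s (hR.trans_le hs)).2.1 j hj
    refine (Finset.sum_le_sum hsum).trans ?_
    simp
  · refine FShrinker.supNorm_le_of_abs_le fun s hs => ?_
    rw [FShrinker.dd_eq_iteratedDeriv hR hu₀ le_rfl hs, add_comm k 1]
    exact (hbound A d s (hR.trans_le hs)).2.2
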